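/- **Setting.** Let $s,n,n_1,n_2,r\ge 1$ be integers with $n_1+n_2=n+1$. For $X\in\mathbb C^{s\times n}$ with columns $x_0,\dots,x_{n-1}$, let $\mathcal H(X)\in\mathbb C^{sn_1\times n_2}$ be the vectorized Hankel matrix whose $(j,k)$-th block ($0\le j<n_1$, $0\le k<n_2$) is $x_{j+k}\in\mathbb C^s$, and let $\mathcal H^*$ be its adjoint. With $w_i=\#\{(j,k):j+k=i,\ 0\le j<n_1,\ 0\le k<n_2\}$, let $\mathcal D$ multiply the $i$-th column by $\sqrt{w_i}$, let $D=\mathrm{diag}(\sqrt{w_0},\dots,\sqrt{w_{n-1}})$, $\mathcal G=\mathcal H\mathcal D^{-1}$ and $\mathcal G^*=\mathcal D^{-1}\mathcal H^*$. Given $b_0,\dots,b_{n-1}\in\mathbb C^s$, let $\mathcal A(X)[j]=b_j^{\mathsf H}x_j$, so that $\mathcal A^*(y)=\sum_j y[j]\,b_je_j^{\mathsf T}$. Let $X^\natural\in\mathbb C^{s\times n}$ be such that $Z^\natural=\mathcal H(X^\natural)$ has rank $r$, with compact singular value decomposition $Z^\natural=U\Sigma V^{\mathsf H}$, singular values $\sigma_1\ge\dots\ge\sigma_r>0$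 and $\kappa=\sigma_1/\sigma_r$. Assume that $Z^\natural$ is $\mu_1$-incoherent for some $\mu_1>0$: every $s\times r$ block $U_j$ of $U$ ($0\le j<n_1$) and every row of $V$ satisfy $\|U_j\|_F^2\le\mu_1r/n$ and $\|e_k^{\mathsf T}V\|_2^2\le\mu_1r/n$. Put $M^\natural=\begin{bmatrix}U\Sigma^{1/2}\\ V\Sigma^{1/2}\end{bmatrix}$. Let $b_0,\dots,b_{n-1}$ be i.i.d. random vectors with $\mathbb E\,b_ib_i^{\mathsf H}=I_s$ and $\max_\ell|b_i[\ell]|^2\le\mu_0$ almost surely, and let $y=\mathcal A(X^\natural)$. **Algorithm (PGD-VHL)** with parameters $\mu\ge\mu_1$, $0<\varepsilon\le\frac13$ and step size $\eta\ge0$. Let $\widehat Z_0=\widehat U_0\widehat\Sigma_0\widehat V_0^{\mathsf H}$ be a best rank-$r$ approximation (in Frobenius norm) of $\mathcal H\mathcal A^*(y)$ with a singular value decomposition of it having $r$ (possibly zero) singular values in nonincreasing order, let $\sigma=\sigma_1(\widehat\Sigma_0)/(1-\varepsilon)$, and let $\mathcal M$ be the convex set of all $M=\begin{bmatrix}L\\R\end{bmatrix}$,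 $L\in\mathbb C^{sn_1\times r}$, $R\in\mathbb C^{n_2\times r}$, all of whose $s\times r$ blocks $L_j$ of $L$ and rows of $R$ satisfy $\|L_j\|_F\le\sqrt{\mu r\sigma/n}$ and $\|e_k^{\mathsf T}R\|_2\le\sqrt{\mu r\sigma/n}$. With $\mathcal P_{\mathcal M}$ the projection onto $\mathcal M$ in Frobenius norm, $$M_0=\mathcal P_{\mathcal M}\begin{bmatrix}\widehat U_0\widehat\Sigma_0^{1/2}\\ \widehat V_0\widehat\Sigma_0^{1/2}\end{bmatrix},\qquad M_{t+1}=\mathcal P_{\mathcal M}\bigl(M_t-\eta\nabla f(M_t)\bigr)\quad(t\ge0),$$ where $\nabla f=\begin{bmatrix}\nabla_Lf\\ \nabla_Rf\end{bmatrix}$ is the (Wirtinger) gradient of $f(M)=\frac12\|Dy-\mathcal A\mathcal G^*(LR^{\mathsf H})\|_2^2+\frac12\|(\mathcal I-\mathcal G\mathcal G^*)(LR^{\mathsf H})\|_F^2+\frac1{16}\|L^{\mathsf H}L-R^{\mathsf H}R\|_F^2$, that is, with $W=\mathcal G\mathcal A^*(\mathcal A\mathcal G^*(LR^{\mathsf H})-Dy)+(\mathcal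 I-\mathcal G\mathcal G^*)(LR^{\mathsf H})$, $$\nabla_Lf=WR+\tfrac14L(L^{\mathsf H}L-R^{\mathsf H}R),\qquad \nabla_Rf=W^{\mathsf H}L+\tfrac14R(R^{\mathsf H}R-L^{\mathsf H}L).$$ **Theorem.** There are absolute constants $c_0,c_1,c_2>0$ such that, in the above setting, if $$n\ge c_0\,\varepsilon^{-2}\mu_0^2\,\mu\,s^2r^2\kappa^2\log^2(sn),\qquad 0\le\eta\le\frac{\sigma_r}{9000(\mu_0\mu sr\sigma_1)^2},\qquad \beta=\frac{\sigma_r}{72},$$ then with probability at least $1-c_1(sn)^{-c_2}$, every sequence $\{M_t\}$ produced by PGD-VHL (whatever choices are made in the best rank-$r$ approximation and in its singular value decomposition) satisfies, for all $t\ge0$, $$\mathrm{dist}^2(M_t,M^\natural)\le(1-\eta\beta)^t\cdot\frac{\varepsilon^2\sigma_r}{\mu_0s},\qquad\text{where}\quad \mathrm{dist}(M,M^\natural)=\min_{Q\in\mathbb C^{r\times r},\ QQ^{\mathsf H}=Q^{\mathsf H}Q=I_r}\|M-M^\natural Q\|_F .$$ -/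

import Mathlib

open MeasureTheory ProbabilityTheory
open scoped Matrix

noncomputable section

namespace BlindSR

/-! ### Norms, singular value decompositions, best low-rank approximation -/

section
open scoped Matrix.Norms.Frobenius

/-- The Frobenius norm of a complex matrix. -/
def frobNorm {p q : Type*} [Fintype p] [Fintype q] (A : Matrix p q ℂ) : ℝ := ‖A‖

theorem frobNorm_eq_sqrt {p q : Type*} [Fintype p] [Fintype q] (A : Matrix p q ℂ) :
    frobNorm A = Real.sqrt (∑ i, ∑ j, ‖A i j‖ ^ 2) := by
  rw [frobNorm, Matrix.frobenius_norm_def, Real.sqrt_eq_rpow]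
  norm_cast

end

/-- The Euclidean norm of the `k`-th row of a matrix. -/
def rowNorm {p q : Type*} [Fintype q] (A : Matrix p q ℂ) (k : p) : ℝ :=
  ‖WithLp.toLp 2 (A k)‖

/-- A real vector seen as a complex diagonal matrix. -/
def realDiag {r : ℕ} (d : Fin r → ℝ) : Matrix (Fin r) (Fin r) ℂ :=
  Matrix.diagonal fun l => (d l : ℂ)

/-- `Z = U diag(d) Vᴴ` with orthonormal columns in `U` and `V`, and with the `r` nonnegative
diagonal entries listed in nonincreasing order. -/
structure IsSVD {p q : Type*} [Fintype p] [Fintype q] {r : ℕ} (Z : Matrix p q ℂ)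
    (U : Matrix p (Fin r) ℂ) (d : Fin r → ℝ) (V : Matrix q (Fin r) ℂ) : Prop where
  left_orthonormal : Uᴴ * U = 1
  right_orthonormal : Vᴴ * V = 1
  nonneg : ∀ l, 0 ≤ d l
  antitone : Antitone d
  eq_mul : Z = U * realDiag d * Vᴴ

/-- `Z` is a best approximation of `W`, in Frobenius norm, among matrices of rank at most `r`. -/
def IsBestRankApprox {p q : Type*} [Fintype p] [Fintype q] (r : ℕ) (W Z : Matrix p q ℂ) : Prop :=
  Z.rank ≤ r ∧ ∀ Z' : Matrix p q ℂ, Z'.rank ≤ r → frobNorm (W - Z) ≤ frobNorm (W - Z')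

/-! ### The vectorized Hankel lift

The rows of an `s n₁ × n₂` matrix are indexed by pairs `(j, a)`: the entry `a` of the block `j`. -/

/-- The vectorized Hankel lift: the block `(j, k)` of `hankel X` is the column `j + k` of `X`. -/
def hankel {s n n₁ n₂ : ℕ} (hn : n₁ + n₂ = n + 1) (X : Matrix (Fin s) (Fin n) ℂ) :
    Matrix (Fin n₁ × Fin s) (Fin n₂) ℂ :=
  Matrix.of fun p k => X p.2 ⟨p.1.val + k.val, by have := p.1.isLt; have := k.isLt; omega⟩

/-- The adjoint of the lift: the column `i` is the sum of the blocks `(j, k)` with `j + k = i`. -/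
def hankelAdj {s n₁ n₂ : ℕ} (n : ℕ) (Z : Matrix (Fin n₁ × Fin s) (Fin n₂) ℂ) :
    Matrix (Fin s) (Fin n) ℂ :=
  Matrix.of fun a i => ∑ j : Fin n₁, ∑ k : Fin n₂,
    if j.val + k.val = i.val then Z (j, a) k else 0

/-- `w_i`, the number of blocks `(j, k)` with `j + k = i`. -/
def weight (n₁ n₂ i : ℕ) : ℕ :=
  (Finset.univ.filter fun p : Fin n₁ × Fin n₂ => p.1.val + p.2.val = i).card

/-- The inverse of the operator `𝒟` that multiplies the column `i` by `√w_i`. -/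
def scaleInv {s n : ℕ} (n₁ n₂ : ℕ) (X : Matrix (Fin s) (Fin n) ℂ) : Matrix (Fin s) (Fin n) ℂ :=
  Matrix.of fun a i => ((Real.sqrt (weight n₁ n₂ i) : ℝ) : ℂ)⁻¹ * X a i

/-- `𝒢 = ℋ 𝒟⁻¹`. -/
def opG {s n n₁ n₂ : ℕ} (hn : n₁ + n₂ = n + 1) (X : Matrix (Fin s) (Fin n) ℂ) :
    Matrix (Fin n₁ × Fin s) (Fin n₂) ℂ :=
  hankel hn (scaleInv n₁ n₂ X)

/-- `𝒢* = 𝒟⁻¹ ℋ*`. -/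
def opGAdj {s n₁ n₂ : ℕ} (n : ℕ) (Z : Matrix (Fin n₁ × Fin s) (Fin n₂) ℂ) :
    Matrix (Fin s) (Fin n) ℂ :=
  scaleInv n₁ n₂ (hankelAdj n Z)

/-! ### The measurements -/

/-- The sensing operator `𝒜(X)[j] = ⟨b_j e_jᵀ, X⟩ = b_jᴴ X e_j`. -/
def sense {s n : ℕ} (b : Fin n → Fin s → ℂ) (X : Matrix (Fin s) (Fin n) ℂ) : Fin n → ℂ :=
  fun j => ∑ a, star (b j a) * X a j

/-- The adjoint of the sensing operator, `𝒜*(y) = ∑_j y[j] b_j e_jᵀ`. -/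
def senseAdj {s n : ℕ} (b : Fin n → Fin s → ℂ) (y : Fin n → ℂ) : Matrix (Fin s) (Fin n) ℂ :=
  Matrix.of fun a j => y j * b j a

/-- The weighted vector `D y`, with `D = diag(√w_0, …, √w_{n-1})`. -/
def weighted {n : ℕ} (n₁ n₂ : ℕ) (y : Fin n → ℂ) : Fin n → ℂ :=
  fun i => ((Real.sqrt (weight n₁ n₂ i) : ℝ) : ℂ) * y i

/-! ### Factors, incoherence, feasible set, distance -/

/-- Stacked factors `M = [L; R]`, of size `(s n₁ + n₂) × r`. -/
abbrev Factors (s n₁ n₂ r : ℕ) := Matrix ((Fin n₁ × Fin s) ⊕ Fin n₂) (Fin r) ℂ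

/-- The `j`-th `s × r` block of an `s n₁ × r` matrix. -/
def block {s n₁ r : ℕ} (L : Matrix (Fin n₁ × Fin s) (Fin r) ℂ) (j : Fin n₁) :
    Matrix (Fin s) (Fin r) ℂ :=
  Matrix.of fun a l => L (j, a) l

/-- `μ₁`-incoherence of the singular vectors `U`, `V`. -/
def Incoherent {s n₁ n₂ r : ℕ} (n : ℕ) (μ₁ : ℝ) (U : Matrix (Fin n₁ × Fin s) (Fin r) ℂ)
    (V : Matrix (Fin n₂) (Fin r) ℂ) : Prop :=
  (∀ j, frobNorm (block U j) ^ 2 ≤ μ₁ * r / n) ∧ ∀ k, rowNorm V k ^ 2 ≤ μ₁ * r / n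

/-- The convex set of stacked factors whose blocks of `L` and rows of `R` have norm at most
`√(μ r σ / n)`. -/
def feasible {s n₁ n₂ r : ℕ} (n : ℕ) (μ σ : ℝ) : Set (Factors s n₁ n₂ r) :=
  {M | (∀ j, frobNorm (block M.toRows₁ j) ≤ Real.sqrt (μ * r * σ / n)) ∧
    ∀ k, rowNorm M.toRows₂ k ≤ Real.sqrt (μ * r * σ / n)}

/-- `M'` is the projection of `M` onto `S`: a point of `S` nearest to `M` in Frobenius norm. -/
def IsProjection {p q : Type*} [Fintype p] [Fintype q] (S : Set (Matrix p q ℂ))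
    (M M' : Matrix p q ℂ) : Prop :=
  M' ∈ S ∧ ∀ N ∈ S, frobNorm (M - M') ≤ frobNorm (M - N)

/-- The balanced factors `[U diag(d)^{1/2}; V diag(d)^{1/2}]`. -/
def balanced {s n₁ n₂ r : ℕ} (U : Matrix (Fin n₁ × Fin s) (Fin r) ℂ) (d : Fin r → ℝ)
    (V : Matrix (Fin n₂) (Fin r) ℂ) : Factors s n₁ n₂ r :=
  Matrix.fromRows (U * realDiag fun l => Real.sqrt (d l)) (V * realDiag fun l => Real.sqrt (d l))

/-- The distance up to a unitary rotation, `min_Q ‖M - M♮ Q‖_F` over unitary `Q`. -/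
def rotDist {p : Type*} [Fintype p] {r : ℕ} (M Mstar : Matrix p (Fin r) ℂ) : ℝ :=
  ⨅ Q : Matrix.unitaryGroup (Fin r) ℂ, frobNorm (M - Mstar * (Q : Matrix (Fin r) (Fin r) ℂ))

/-! ### The algorithm -/

/-- `𝒢𝒜*(𝒜𝒢*(LRᴴ) - Dy) + (ℐ - 𝒢𝒢*)(LRᴴ)`, the common factor of the two partial gradients. -/
def gradCore {s n n₁ n₂ r : ℕ} (hn : n₁ + n₂ = n + 1) (b : Fin n → Fin s → ℂ) (y : Fin n → ℂ)
    (L : Matrix (Fin n₁ × Fin s) (Fin r) ℂ) (R : Matrix (Fin n₂) (Fin r) ℂ) :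
    Matrix (Fin n₁ × Fin s) (Fin n₂) ℂ :=
  opG hn (senseAdj b (sense b (opGAdj n (L * Rᴴ)) - weighted n₁ n₂ y)) +
    (L * Rᴴ - opG hn (opGAdj n (L * Rᴴ)))

/-- The gradient `[∇_L f; ∇_R f]` (Wirtinger calculus) of
`f(L, R) = ½‖Dy - 𝒜𝒢*(LRᴴ)‖² + ½‖(ℐ - 𝒢𝒢*)(LRᴴ)‖_F² + (1/16)‖LᴴL - RᴴR‖_F²`. -/
def grad {s n n₁ n₂ r : ℕ} (hn : n₁ + n₂ = n + 1) (b : Fin n → Fin s → ℂ) (y : Fin n → ℂ)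
    (M : Factors s n₁ n₂ r) : Factors s n₁ n₂ r :=
  let L := M.toRows₁
  let R := M.toRows₂
  Matrix.fromRows
    (gradCore hn b y L R * R + (1 / 4 : ℂ) • (L * (Lᴴ * L - Rᴴ * R)))
    ((gradCore hn b y L R)ᴴ * L + (1 / 4 : ℂ) • (R * (Rᴴ * R - Lᴴ * L)))

/-- `M 0, M 1, …` is a run of PGD-VHL on the data `(𝒜, y)`: spectral initialization from a best
rank-`r` approximation `Ẑ₀ = Û diag(d) V̂ᴴ` of `ℋ𝒜*(y)`, and projected gradient steps onto the
feasible set with `σ = σ₁(Ẑ₀)/(1 - ε)`. -/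
def IsPGDRun {s n n₁ n₂ r : ℕ} (hn : n₁ + n₂ = n + 1) (hr : 0 < r) (b : Fin n → Fin s → ℂ)
    (y : Fin n → ℂ) (μ ε η : ℝ) (M : ℕ → Factors s n₁ n₂ r) : Prop :=
  ∃ (Z₀ : Matrix (Fin n₁ × Fin s) (Fin n₂) ℂ) (U : Matrix (Fin n₁ × Fin s) (Fin r) ℂ)
    (d : Fin r → ℝ) (V : Matrix (Fin n₂) (Fin r) ℂ),
    IsBestRankApprox r (hankel hn (senseAdj b y)) Z₀ ∧ IsSVD Z₀ U d V ∧
    IsProjection (feasible n μ (d ⟨0, hr⟩ / (1 - ε))) (balanced U d V) (M 0) ∧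
    ∀ t, IsProjection (feasible n μ (d ⟨0, hr⟩ / (1 - ε)))
      (M t - η • grad hn b y (M t)) (M (t + 1))

/-! ### The random subspace model -/

/-- The vectors `b_0, …, b_{n-1}` are independent and identically distributed, isotropic
(`𝔼 b_i b_iᴴ = I`), and their entries satisfy `|b_i[a]|² ≤ μ₀` almost surely. -/
structure SubspaceModel {Ω : Type*} [MeasurableSpace Ω] (P : Measure Ω) {s n : ℕ} (μ₀ : ℝ)
    (b : Fin n → Ω → Fin s → ℂ) : Prop where
  measurable : ∀ i, Measurable (b i)
  indep : iIndepFun b P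
  identDistrib : ∀ i j, IdentDistrib (b i) (b j) P P
  isotropic : ∀ i a c, ∫ ω, b i ω a * star (b i ω c) ∂P = (1 : Matrix (Fin s) (Fin s) ℂ) a c
  bounded : ∀ i, ∀ᵐ ω ∂P, ∀ a, ‖b i ω a‖ ^ 2 ≤ μ₀

end BlindSR

end

open BlindSR

/-! Once three facts hold for the sampled vectors, the whole run is controlled deterministically.
With `B = μ₀ s` they are: `‖b_i‖² ≤ B`; `𝒜` is nearly isometric, with constant `1/10`, on the images
under `𝒢*` of matrices `A Vᴴ + U C`; and the lift of `𝒜*𝒜(X) - X` has small operator norm. The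
sample size is used only to make these facts likely.

Local convergence (`regularity`, `frobNorm_gradient_step_sq_le`). Let `[L₀; R₀]` be the target after
the best rotation and `[A; C]` the displacement. The residual `L Rᴴ - L₀ R₀ᴴ` is `D + E`, with `D =
A R₀ᴴ + L₀ Cᴴ` tangent and `E = A Cᴴ` quadratic. Paired with the displacement, the gradient gives
`⟨K(D+E), D+2E⟩` plus a balancing term, where `K = 𝒢𝒜*𝒜𝒢* + ℐ - 𝒢𝒢*` is symmetric and nonnegative.
Near-isometry bounds `⟨K D, D⟩` below by `‖D‖²`. Optimal rotation makes `L₀ᴴ A + R₀ᴴ C` Hermitian,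
and then `‖D‖²` together with the balancing term dominates `σ_r (‖A‖² + ‖C‖²)` (`coercivity`). The
`E` terms are of higher order and are absorbed by closeness to the target. A bound on the gradient
norm then turns a small step into a contraction, and projection onto a convex set containing every
rotated target does no harm.

Initialization. The best rank-`r` approximation inherits an error `8 r c²` from an operator norm
error `c` (`frobNorm_sub_sq_le_of_isBestRankApprox`). For balanced factors, closeness of products
gives closeness of factors up to rotation (`frobNorm_sub_sq_le_of_balanced`).

Concentration. The near-isometry is a statement on `∑ (vᵢ vᵢᴴ - Cᵢ)` with independent bounded `vᵢ`.
Its even trace moments are bounded recursively by exchanging one `vᵢ` with an independent copy and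
applying a trace mean value inequality (`integral_trace_pow_le`); Markov's inequality at a moment of
order `log(sn)` concludes. For the spectral error, a Hankel matrix is a corner of a
Fourier-diagonalizable one, so its norm is at most the largest Fourier coefficient of its symbol
(`frobNorm_hankel_mul_le`); each coefficient is a sum of independent variables, treated by
Bernstein's inequality and a union bound. -/

noncomputable section

namespace BlindSR

/-! ### The real Frobenius inner product -/

section Frobenius

variable {p q k r : Type*} [Fintype p] [Fintype q] [Fintype k] [Fintype r]

/-- The real part of the Frobenius inner product. -/
def ip (A B : Matrix p q ℂ) : ℝ := (Aᴴ * B).trace.re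

theorem ip_eq_sum (A B : Matrix p q ℂ) : ip A B = ∑ i, ∑ j, (star (A i j) * B i j).re := by
  simp only [ip, Matrix.trace, Matrix.diag_apply, Matrix.mul_apply, Matrix.conjTranspose_apply,
    Complex.re_sum]
  exact Finset.sum_comm

theorem ip_comm (A B : Matrix p q ℂ) : ip A B = ip B A := by
  simp only [ip_eq_sum]
  refine Finset.sum_congr rfl fun i _ => Finset.sum_congr rfl fun j _ => ?_
  simp [mul_comm]

theorem ip_add_left (A B C : Matrix p q ℂ) : ip (A + B) C = ip A C + ip B C := by
  simp [ip, Matrix.add_mul]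

theorem ip_add_right (A B C : Matrix p q ℂ) : ip A (B + C) = ip A B + ip A C := by
  simp [ip, Matrix.mul_add]

theorem ip_sub_left (A B C : Matrix p q ℂ) : ip (A - B) C = ip A C - ip B C := by
  simp [ip, Matrix.sub_mul]

theorem ip_sub_right (A B C : Matrix p q ℂ) : ip A (B - C) = ip A B - ip A C := by
  simp [ip, Matrix.mul_sub]

theorem ip_neg_left (A B : Matrix p q ℂ) : ip (-A) B = -ip A B := by
  simp [ip]

theorem ip_neg_right (A B : Matrix p q ℂ) : ip A (-B) = -ip A B := by
  simp [ip]

theorem ip_smul_left (c : ℝ) (A B : Matrix p q ℂ) : ip (c • A) B = c * ip A B := by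
  simp [ip]

theorem ip_smul_right (c : ℝ) (A B : Matrix p q ℂ) : ip A (c • B) = c * ip A B := by
  simp [ip]

theorem ip_zero_left (B : Matrix p q ℂ) : ip 0 B = 0 := by simp [ip]

theorem ip_conjTranspose (A B : Matrix p q ℂ) : ip Aᴴ Bᴴ = ip A B := by
  simp only [ip_eq_sum, Matrix.conjTranspose_apply]
  rw [Finset.sum_comm]
  refine Finset.sum_congr rfl fun i _ => Finset.sum_congr rfl fun j _ => ?_
  simp [Complex.mul_re]

theorem ip_mul_left (A : Matrix p k ℂ) (B : Matrix k q ℂ) (C : Matrix p q ℂ) :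
    ip (A * B) C = ip B (Aᴴ * C) := by
  simp [ip, Matrix.mul_assoc]

theorem ip_mul_right (A : Matrix p k ℂ) (B : Matrix k q ℂ) (C : Matrix p q ℂ) :
    ip (A * B) C = ip A (C * Bᴴ) := by
  rw [← ip_conjTranspose, Matrix.conjTranspose_mul, ip_mul_left, Matrix.conjTranspose_conjTranspose,
    ← ip_conjTranspose]
  simp

theorem frobNorm_sq (A : Matrix p q ℂ) : frobNorm A ^ 2 = ip A A := by
  rw [frobNorm_eq_sqrt, Real.sq_sqrt (by positivity), ip_eq_sum]
  refine Finset.sum_congr rfl fun i _ => Finset.sum_congr rfl fun j _ => ?_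
  rw [Complex.star_def, ← Complex.normSq_eq_conj_mul_self, Complex.ofReal_re,
    Complex.normSq_eq_norm_sq]

theorem frobNorm_sq_eq_sum (A : Matrix p q ℂ) : frobNorm A ^ 2 = ∑ i, ∑ j, ‖A i j‖ ^ 2 := by
  rw [frobNorm_eq_sqrt, Real.sq_sqrt (by positivity)]

theorem ip_self_nonneg (A : Matrix p q ℂ) : 0 ≤ ip A A := by
  rw [← frobNorm_sq]; positivity

section
open scoped Matrix.Norms.Frobenius

theorem frobNorm_nonneg (A : Matrix p q ℂ) : 0 ≤ frobNorm A := norm_nonneg A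

theorem frobNorm_add_le (A B : Matrix p q ℂ) : frobNorm (A + B) ≤ frobNorm A + frobNorm B :=
  norm_add_le A B

theorem frobNorm_sub_le (A B : Matrix p q ℂ) : frobNorm (A - B) ≤ frobNorm A + frobNorm B :=
  norm_sub_le A B

theorem frobNorm_neg (A : Matrix p q ℂ) : frobNorm (-A) = frobNorm A := norm_neg A

theorem frobNorm_sub_comm (A B : Matrix p q ℂ) : frobNorm (A - B) = frobNorm (B - A) :=
  norm_sub_rev A B

theorem frobNorm_smul (c : ℂ) (A : Matrix p q ℂ) : frobNorm (c • A) = ‖c‖ * frobNorm A :=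
  norm_smul c A

theorem frobNorm_mul_le (A : Matrix p k ℂ) (B : Matrix k q ℂ) :
    frobNorm (A * B) ≤ frobNorm A * frobNorm B := Matrix.frobenius_norm_mul A B

theorem frobNorm_conjTranspose (A : Matrix p q ℂ) : frobNorm Aᴴ = frobNorm A :=
  Matrix.frobenius_norm_conjTranspose A

theorem continuous_frobNorm : Continuous (frobNorm : Matrix p q ℂ → ℝ) := by
  have : (frobNorm : Matrix p q ℂ → ℝ) = fun A => Real.sqrt (∑ i, ∑ j, ‖A i j‖ ^ 2) :=
    funext frobNorm_eq_sqrt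
  rw [this]
  fun_prop

theorem frobNorm_eq_zero {A : Matrix p q ℂ} : frobNorm A = 0 ↔ A = 0 := norm_eq_zero

end

theorem abs_ip_le (A B : Matrix p q ℂ) : |ip A B| ≤ frobNorm A * frobNorm B := by
  have key : ∀ A B : Matrix p q ℂ, ip A B ≤ frobNorm A * frobNorm B := by
    intro A B
    rcases (frobNorm_nonneg A).eq_or_lt with ha | ha
    · rw [frobNorm_eq_zero.1 ha.symm, ip_zero_left]
      exact mul_nonneg (frobNorm_nonneg _) (frobNorm_nonneg _)
    rcases (frobNorm_nonneg B).eq_or_lt with hb | hb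
    · rw [frobNorm_eq_zero.1 hb.symm, ip_comm, ip_zero_left]
      exact mul_nonneg (frobNorm_nonneg _) (frobNorm_nonneg _)
    have h := ip_self_nonneg (frobNorm B • A - frobNorm A • B)
    simp only [ip_sub_left, ip_sub_right, ip_smul_left, ip_smul_right, ip_comm B A] at h
    rw [← frobNorm_sq, ← frobNorm_sq] at h
    have hab := mul_pos ha hb
    by_contra hc
    push Not at hc
    nlinarith
  refine abs_le.2 ⟨?_, key A B⟩
  have := key (-A) B
  rw [ip_neg_left, frobNorm_neg] at this
  linarith

theorem ip_le (A B : Matrix p q ℂ) : ip A B ≤ frobNorm A * frobNorm B :=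
  (le_abs_self _).trans (abs_ip_le A B)

theorem frobNorm_add_sq (A B : Matrix p q ℂ) :
    frobNorm (A + B) ^ 2 = frobNorm A ^ 2 + 2 * ip A B + frobNorm B ^ 2 := by
  simp only [frobNorm_sq, ip_add_left, ip_add_right, ip_comm B A]; ring

theorem frobNorm_sub_sq (A B : Matrix p q ℂ) :
    frobNorm (A - B) ^ 2 = frobNorm A ^ 2 - 2 * ip A B + frobNorm B ^ 2 := by
  simp only [frobNorm_sq, ip_sub_left, ip_sub_right, ip_comm B A]; ring

theorem frobNorm_fromRows_sq {p' : Type*} [Fintype p'] (A : Matrix p q ℂ) (B : Matrix p' q ℂ) :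
    frobNorm (Matrix.fromRows A B) ^ 2 = frobNorm A ^ 2 + frobNorm B ^ 2 := by
  simp [frobNorm_sq_eq_sum]

theorem frobNorm_mul_unitary [DecidableEq q] (A : Matrix p q ℂ) {Q : Matrix q q ℂ}
    (hQ : Q * Qᴴ = 1) : frobNorm (A * Q) = frobNorm A := by
  rw [← sq_eq_sq₀ (frobNorm_nonneg _) (frobNorm_nonneg _), frobNorm_sq, frobNorm_sq, ip_mul_right,
    Matrix.mul_assoc, hQ, Matrix.mul_one]

theorem frobNorm_orthonormal_mul [DecidableEq k] (B : Matrix k q ℂ) {U : Matrix p k ℂ}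
    (hU : Uᴴ * U = 1) : frobNorm (U * B) = frobNorm B := by
  rw [← sq_eq_sq₀ (frobNorm_nonneg _) (frobNorm_nonneg _), frobNorm_sq, frobNorm_sq, ip_mul_left,
    ← Matrix.mul_assoc, hU, Matrix.one_mul]

/-- Pythagoras for the orthogonal projection `A V Vᴴ` of `A`: the squared norm of `A - A V Vᴴ` is
`‖A‖² - ‖A V‖²`. -/
theorem frobNorm_mul_orthonormal_le [DecidableEq k] (A : Matrix p q ℂ) {V : Matrix q k ℂ}
    (hV : Vᴴ * V = 1) : frobNorm (A * V) ≤ frobNorm A := by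
  have h := ip_self_nonneg (A - A * V * Vᴴ)
  have h1 : ip A (A * V * Vᴴ) = ip (A * V) (A * V) := by
    rw [ip_comm, ip_mul_right, Matrix.conjTranspose_conjTranspose]
  have h2 : ip (A * V * Vᴴ) (A * V * Vᴴ) = ip (A * V) (A * V) := by
    rw [ip_mul_right, Matrix.conjTranspose_conjTranspose, Matrix.mul_assoc (A * V), hV,
      Matrix.mul_one]
  rw [ip_sub_left, ip_sub_right, ip_sub_right, ip_comm (A * V * Vᴴ) A, h1, h2] at h
  refine abs_le_of_sq_le_sq' ?_ (frobNorm_nonneg _) |>.2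
  rw [frobNorm_sq, frobNorm_sq]
  linarith

theorem frobNorm_orthonormal_conjTranspose_mul_le [DecidableEq k] (A : Matrix p q ℂ)
    {U : Matrix p k ℂ} (hU : Uᴴ * U = 1) : frobNorm (Uᴴ * A) ≤ frobNorm A := by
  rw [← frobNorm_conjTranspose, Matrix.conjTranspose_mul, Matrix.conjTranspose_conjTranspose,
    ← frobNorm_conjTranspose A]
  exact frobNorm_mul_orthonormal_le _ hU

end Frobenius

/-! ### Alignment with the target up to a unitary rotation -/

section Alignment

open scoped ComplexOrder

variable {r : ℕ}

theorem isCompact_unitaryGroup :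
    IsCompact (Matrix.unitaryGroup (Fin r) ℂ : Set (Matrix (Fin r) (Fin r) ℂ)) := by
  refine IsCompact.of_isClosed_subset
    (isCompact_univ_pi fun _ : Fin r => isCompact_univ_pi fun _ : Fin r =>
      isCompact_closedBall (0 : ℂ) 1) ?_ ?_
  · have : (Matrix.unitaryGroup (Fin r) ℂ : Set (Matrix (Fin r) (Fin r) ℂ)) =
        {A | A * star A = 1} := by
      ext A; exact Matrix.mem_unitaryGroup_iff
    rw [this]
    exact isClosed_eq (by fun_prop) continuous_const
  · intro A hA
    exact fun i _ j _ => mem_closedBall_zero_iff.2 (entry_norm_bound_of_unitary hA i j)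

/-- Multiplying by the unitary matrix `I + (z - 1) w wᴴ` tests positivity in the direction `w`. -/
theorem one_add_smul_vecMulVec_mem_unitaryGroup (w : Fin r → ℂ) (hw : star w ⬝ᵥ w = 1) (z : ℂ)
    (hz : star z * z = 1) :
    (1 + (z - 1) • Matrix.vecMulVec w (star w)) ∈ Matrix.unitaryGroup (Fin r) ℂ := by
  rw [Matrix.mem_unitaryGroup_iff']
  have hW : (Matrix.vecMulVec w (star w))ᴴ = Matrix.vecMulVec w (star w) := by
    rw [Matrix.conjTranspose_vecMulVec, star_star]
  have hWW : Matrix.vecMulVec w (star w) * Matrix.vecMulVec w (star w) =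
      Matrix.vecMulVec w (star w) := by
    rw [Matrix.vecMulVec_mul_vecMulVec, hw, one_smul]
  rw [Matrix.star_eq_conjTranspose, Matrix.conjTranspose_add, Matrix.conjTranspose_one,
    Matrix.conjTranspose_smul, hW, Matrix.add_mul, Matrix.mul_add, Matrix.mul_add, Matrix.one_mul,
    Matrix.smul_mul, Matrix.mul_smul, Matrix.mul_smul, Matrix.smul_mul, hWW, smul_smul, Matrix.mul_one,
    Matrix.one_mul, add_assoc,
    ← add_smul, ← add_smul]
  have : (z - 1 + (star (z - 1) + (z - 1) * star (z - 1))) = 0 := by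
    rw [star_sub, star_one]; linear_combination hz
  rw [this, zero_smul, add_zero]

/-- First-order optimality, obtained without a polar decomposition: changing the phase of a single
unit direction `w` cannot increase `ip · K`, and this already forces `wᴴ K w ≥ 0`. -/
theorem posSemidef_of_ip_unitary_le {K : Matrix (Fin r) (Fin r) ℂ}
    (h : ∀ Q ∈ Matrix.unitaryGroup (Fin r) ℂ, ip Q K ≤ ip 1 K) : K.PosSemidef := by
  have key : ∀ w : Fin r → ℂ, star w ⬝ᵥ w = 1 → 0 ≤ star w ⬝ᵥ (K *ᵥ w) := by
    intro w hw
    set c : ℂ := star w ⬝ᵥ (K *ᵥ w) with hc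
    have h1 : ∀ z : ℂ, star z * z = 1 → (star (z - 1) * c).re ≤ 0 := by
      intro z hz
      have h2 := h _ (one_add_smul_vecMulVec_mem_unitaryGroup w hw z hz)
      rw [ip_add_left] at h2
      have h3 : ip ((z - 1) • Matrix.vecMulVec w (star w)) K = (star (z - 1) * c).re := by
        rw [ip, Matrix.conjTranspose_smul, Matrix.conjTranspose_vecMulVec, star_star,
          Matrix.smul_mul, Matrix.trace_smul, smul_eq_mul, Matrix.vecMulVec_mul,
          Matrix.trace_vecMulVec, dotProduct_comm, ← Matrix.dotProduct_mulVec, hc]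
      linarith
    have hre : ‖c‖ ≤ c.re := by
      by_cases hc0 : c = 0
      · simp [hc0]
      have hn : (‖c‖ : ℂ) ≠ 0 := by simpa using hc0
      have hnn : star (‖c‖ : ℂ) = ‖c‖ := Complex.conj_ofReal _
      have hcc : star c * c = (‖c‖ : ℂ) ^ 2 := by
        rw [Complex.star_def, ← Complex.normSq_eq_conj_mul_self, Complex.normSq_eq_norm_sq]
        push_cast; rfl
      -- The phase of `c` itself is the best choice: it yields `‖c‖ ≤ Re c`, so `c` is real and
      -- nonnegative.
      have h4 := h1 (c / ‖c‖) (by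
        rw [star_div₀, hnn, div_mul_div_comm, hcc]
        field_simp)
      have h5 : star (c / ‖c‖ - 1) * c = (‖c‖ : ℂ) - c := by
        rw [star_sub, star_one, star_div₀, hnn, sub_mul, div_mul_eq_mul_div, hcc, one_mul]
        congr 1
        field_simp
      rw [h5, Complex.sub_re, Complex.ofReal_re] at h4
      linarith
    have h6 := Complex.re_le_norm c
    have h7 : c.re = ‖c‖ := le_antisymm h6 hre
    have h8 : c.im = 0 := by
      have := Complex.sq_norm c
      rw [Complex.normSq_apply, ← h7] at this
      nlinarith
    rw [Complex.le_def]
    refine ⟨?_, by simpa using h8.symm⟩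
    rw [h7]; simp
  have key2 : ∀ w : Fin r → ℂ, 0 ≤ star w ⬝ᵥ (K *ᵥ w) := by
    intro w
    by_cases hw : w = 0
    · simp [hw]
    have hpos : 0 < star w ⬝ᵥ w := Matrix.dotProduct_star_self_pos_iff.2 hw
    obtain ⟨a, ha, haw⟩ : ∃ a : ℝ, 0 < a ∧ star w ⬝ᵥ w = (a : ℂ) := by
      rw [Complex.lt_def] at hpos
      exact ⟨_, by simpa using hpos.1, Complex.ext rfl (by simpa using hpos.2.symm)⟩
    have hs : (0 : ℝ) < Real.sqrt a := Real.sqrt_pos.2 ha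
    have hsq : ((Real.sqrt a : ℝ) : ℂ) * (Real.sqrt a : ℝ) = a := by
      rw [← Complex.ofReal_mul, Real.mul_self_sqrt ha.le]
    have hs0 : ((Real.sqrt a : ℝ) : ℂ) ≠ 0 := by exact_mod_cast hs.ne'
    have ha0 : (a : ℂ) ≠ 0 := by exact_mod_cast ha.ne'
    have h9 := key (((Real.sqrt a : ℝ) : ℂ)⁻¹ • w) (by
      rw [star_smul, smul_dotProduct, dotProduct_smul, haw, Complex.star_def, map_inv₀,
        Complex.conj_ofReal, smul_eq_mul, smul_eq_mul, ← mul_assoc, ← mul_inv, hsq]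
      field_simp)
    rw [Matrix.mulVec_smul, star_smul, smul_dotProduct, dotProduct_smul, Complex.star_def, map_inv₀,
        Complex.conj_ofReal, smul_eq_mul, smul_eq_mul, ← mul_assoc, ← mul_inv, hsq] at h9
    have h10 := mul_nonneg (show (0 : ℂ) ≤ (a : ℂ) by exact_mod_cast ha.le) h9
    rwa [← mul_assoc, mul_inv_cancel₀ ha0, one_mul] at h10
  refine Matrix.PosSemidef.of_dotProduct_mulVec_nonneg ?_ key2
  -- Over `ℂ`, a matrix whose quadratic form is real is Hermitian.
  rw [← Matrix.isSymmetric_toEuclideanLin_iff, LinearMap.isSymmetric_iff_inner_map_self_real]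
  intro v
  have h11 := key2 v.ofLp
  have h12 : inner ℂ (Matrix.toEuclideanLin K v) v = star (star v.ofLp ⬝ᵥ (K *ᵥ v.ofLp)) := by
    rw [EuclideanSpace.inner_eq_star_dotProduct, Matrix.star_dotProduct, star_star,
      dotProduct_comm]
    rfl
  rw [h12, Complex.star_def, Complex.conj_conj]
  exact (Complex.conj_eq_iff_im.2 (by rw [Complex.le_def] at h11; simpa using h11.2.symm)).symm

theorem rotDist_le {p : Type*} [Fintype p] (M X : Matrix p (Fin r) ℂ)
    {Q : Matrix (Fin r) (Fin r) ℂ} (hQ : Q ∈ Matrix.unitaryGroup (Fin r) ℂ) :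
    rotDist M X ≤ frobNorm (M - X * Q) :=
  ciInf_le ⟨0, by rintro _ ⟨Q', rfl⟩; exact frobNorm_nonneg _⟩
    (⟨Q, hQ⟩ : Matrix.unitaryGroup (Fin r) ℂ)

/-- The distance up to rotation is attained, and at the optimum the cross-Gram matrix is positive
semidefinite. -/
theorem exists_aligned {p : Type*} [Fintype p] (M X : Matrix p (Fin r) ℂ) :
    ∃ Q ∈ Matrix.unitaryGroup (Fin r) ℂ, rotDist M X = frobNorm (M - X * Q) ∧
      ((X * Q)ᴴ * M)ᴴ = (X * Q)ᴴ * M ∧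
      ∀ A : Matrix p (Fin r) ℂ, 0 ≤ ip A (A * ((X * Q)ᴴ * M)) := by
  obtain ⟨Q, hQ, hmin⟩ := (isCompact_unitaryGroup (r := r)).exists_isMinOn
    ⟨1, one_mem (Matrix.unitaryGroup (Fin r) ℂ)⟩
    (f := fun Q => frobNorm (M - X * Q))
    (continuous_frobNorm.comp (by fun_prop)).continuousOn
  have hmin' : ∀ Q' ∈ Matrix.unitaryGroup (Fin r) ℂ,
      frobNorm (M - X * Q) ≤ frobNorm (M - X * Q') := fun Q' hQ' => hmin hQ'
  suffices hK : ((X * Q)ᴴ * M).PosSemidef by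
    refine ⟨Q, hQ, ?_, hK.1, fun A => ?_⟩
    · have : Nonempty (Matrix.unitaryGroup (Fin r) ℂ) := ⟨1⟩
      refine le_antisymm (rotDist_le M X hQ) (le_ciInf fun Q' => hmin' _ Q'.2)
    · have h := (hK.mul_mul_conjTranspose_same A).trace_nonneg
      rw [Complex.le_def] at h
      rw [ip, Matrix.trace_mul_comm]
      simpa using h.1
  -- Since `‖X Q W‖ = ‖X Q‖`, minimizing the distance is the same as maximizing the inner product
  -- with `M`.
  apply posSemidef_of_ip_unitary_le
  intro W hW
  have h1 := hmin' (Q * W) (mul_mem hQ hW)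
  have h2 : frobNorm (M - X * Q) ^ 2 ≤ frobNorm (M - X * (Q * W)) ^ 2 :=
    pow_le_pow_left₀ (frobNorm_nonneg _) h1 2
  have h3 : frobNorm (X * (Q * W)) = frobNorm X :=
    frobNorm_mul_unitary X (Matrix.mem_unitaryGroup_iff.1 (mul_mem hQ hW))
  have h4 : frobNorm (X * Q) = frobNorm X :=
    frobNorm_mul_unitary X (Matrix.mem_unitaryGroup_iff.1 hQ)
  rw [frobNorm_sub_sq, frobNorm_sub_sq, h3, h4] at h2
  have h5 : ip W ((X * Q)ᴴ * M) = ip M (X * (Q * W)) := by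
    rw [← ip_mul_left, ip_comm, Matrix.mul_assoc]
  have h6 : ip 1 ((X * Q)ᴴ * M) = ip M (X * Q) := by
    rw [← ip_mul_left, ip_comm, Matrix.mul_one]
  linarith

theorem rotDist_nonneg {p : Type*} [Fintype p] (M X : Matrix p (Fin r) ℂ) : 0 ≤ rotDist M X :=
  Real.iInf_nonneg fun _ => frobNorm_nonneg _

end Alignment

/-! ### The vectorized Hankel lift -/

section Hankel

variable {s n n₁ n₂ : ℕ}

theorem ip_hankel (hn : n₁ + n₂ = n + 1) (X : Matrix (Fin s) (Fin n) ℂ)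
    (Z : Matrix (Fin n₁ × Fin s) (Fin n₂) ℂ) : ip (hankel hn X) Z = ip X (hankelAdj n Z) := by
  rw [ip_eq_sum, ip_eq_sum]
  simp only [hankel, hankelAdj, Matrix.of_apply, Fintype.sum_prod_type, Finset.mul_sum,
    Complex.re_sum]
  rw [Finset.sum_comm]
  refine Finset.sum_congr rfl fun a _ => Eq.symm ?_
  rw [Finset.sum_comm]
  refine Finset.sum_congr rfl fun j _ => ?_
  rw [Finset.sum_comm]
  refine Finset.sum_congr rfl fun k _ => ?_
  have h : j.val + k.val < n := by have := j.isLt; have := k.isLt; omega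
  rw [Finset.sum_eq_single ⟨j.val + k.val, h⟩]
  · simp
  · intro i _ hi
    rw [if_neg, mul_zero, Complex.zero_re]
    intro hji
    exact hi (Fin.ext hji.symm)
  · simp

theorem ip_scaleInv (X Y : Matrix (Fin s) (Fin n) ℂ) :
    ip (scaleInv n₁ n₂ X) Y = ip X (scaleInv n₁ n₂ Y) := by
  rw [ip_eq_sum, ip_eq_sum]
  refine Finset.sum_congr rfl fun a _ => Finset.sum_congr rfl fun i _ => ?_
  simp only [scaleInv, Matrix.of_apply, star_mul', star_inv₀, Complex.star_def,
    Complex.conj_ofReal]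
  congr 1
  ring

theorem ip_opG (hn : n₁ + n₂ = n + 1) (X : Matrix (Fin s) (Fin n) ℂ)
    (Z : Matrix (Fin n₁ × Fin s) (Fin n₂) ℂ) : ip (opG hn X) Z = ip X (opGAdj n Z) := by
  rw [opG, ip_hankel, ip_scaleInv, opGAdj]

theorem hankelAdj_hankel (hn : n₁ + n₂ = n + 1) (X : Matrix (Fin s) (Fin n) ℂ) :
    hankelAdj n (hankel hn X) = Matrix.of fun a (i : Fin n) => (weight n₁ n₂ i : ℂ) * X a i := by
  ext a i
  simp only [hankelAdj, hankel, Matrix.of_apply, weight]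
  rw [← Fintype.sum_prod_type', Finset.card_filter]
  push_cast
  rw [Finset.sum_mul]
  refine Finset.sum_congr rfl fun p _ => ?_
  by_cases h : p.1.val + p.2.val = i.val
  · rw [if_pos h, if_pos h, one_mul]
    congr 1
    exact Fin.ext h
  · rw [if_neg h, if_neg h, zero_mul]

theorem weight_pos (hn : n₁ + n₂ = n + 1) (h₁ : 0 < n₁) (h₂ : 0 < n₂) (i : Fin n) :
    0 < weight n₁ n₂ i := by
  rw [weight, Finset.card_pos]
  have hi := i.isLt
  by_cases h : i.val < n₁
  · exact ⟨(⟨i, h⟩, ⟨0, h₂⟩), by simp⟩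
  · exact ⟨(⟨n₁ - 1, by omega⟩, ⟨i - (n₁ - 1), by omega⟩), by simp; omega⟩

theorem opGAdj_hankel (hn : n₁ + n₂ = n + 1) (X : Matrix (Fin s) (Fin n) ℂ) :
    opGAdj n (hankel hn X) =
      Matrix.of fun a (i : Fin n) => ((Real.sqrt (weight n₁ n₂ i) : ℝ) : ℂ) * X a i := by
  ext a i
  rw [opGAdj, hankelAdj_hankel]
  simp only [scaleInv, Matrix.of_apply]
  have h : ((weight n₁ n₂ i : ℕ) : ℂ) =
      ((Real.sqrt (weight n₁ n₂ i) : ℝ) : ℂ) * ((Real.sqrt (weight n₁ n₂ i) : ℝ) : ℂ) := by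
    rw [← Complex.ofReal_mul, Real.mul_self_sqrt (Nat.cast_nonneg _), Complex.ofReal_natCast]
  rw [h, mul_assoc]
  by_cases h0 : ((Real.sqrt (weight n₁ n₂ i) : ℝ) : ℂ) = 0
  · simp [h0]
  · rw [inv_mul_cancel_left₀ h0]

/-- This makes `𝒢` an isometry and `𝒢𝒢*` the orthogonal projection onto lifted matrices. Positivity
of every `w_i` is what makes `scaleInv` a genuine inverse scaling. -/
theorem opGAdj_opG (hn : n₁ + n₂ = n + 1) (h₁ : 0 < n₁) (h₂ : 0 < n₂)
    (X : Matrix (Fin s) (Fin n) ℂ) : opGAdj n (opG hn X) = X := by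
  ext a i
  rw [opG, opGAdj_hankel]
  simp only [scaleInv, Matrix.of_apply]
  have h := weight_pos hn h₁ h₂ i
  have h0 : ((Real.sqrt (weight n₁ n₂ i) : ℝ) : ℂ) ≠ 0 := by
    exact_mod_cast (Real.sqrt_pos.2 (by exact_mod_cast h)).ne'
  rw [mul_inv_cancel_left₀ h0]

theorem frobNorm_opG (hn : n₁ + n₂ = n + 1) (h₁ : 0 < n₁) (h₂ : 0 < n₂)
    (X : Matrix (Fin s) (Fin n) ℂ) : frobNorm (opG hn X) = frobNorm X := by
  rw [← sq_eq_sq₀ (frobNorm_nonneg _) (frobNorm_nonneg _), frobNorm_sq, frobNorm_sq, ip_opG,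
    opGAdj_opG hn h₁ h₂]

/-- Pythagoras for the projection `𝒢𝒢*`. -/
theorem frobNorm_sub_opG_sq (hn : n₁ + n₂ = n + 1) (h₁ : 0 < n₁) (h₂ : 0 < n₂)
    (Z : Matrix (Fin n₁ × Fin s) (Fin n₂) ℂ) :
    frobNorm (Z - opG hn (opGAdj n Z)) ^ 2 = frobNorm Z ^ 2 - frobNorm (opGAdj n Z) ^ 2 := by
  rw [frobNorm_sub_sq, frobNorm_opG hn h₁ h₂, ip_comm, ip_opG, ← frobNorm_sq]
  ring

theorem frobNorm_opGAdj_le (hn : n₁ + n₂ = n + 1) (h₁ : 0 < n₁) (h₂ : 0 < n₂)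
    (Z : Matrix (Fin n₁ × Fin s) (Fin n₂) ℂ) : frobNorm (opGAdj n Z) ≤ frobNorm Z := by
  refine (abs_le_of_sq_le_sq' ?_ (frobNorm_nonneg _)).2
  have := frobNorm_sub_opG_sq hn h₁ h₂ Z
  nlinarith [sq_nonneg (frobNorm (Z - opG hn (opGAdj n Z)))]

theorem opGAdj_add (Y Z : Matrix (Fin n₁ × Fin s) (Fin n₂) ℂ) :
    opGAdj n (Y + Z) = opGAdj n Y + opGAdj n Z := by
  ext a i
  simp only [opGAdj, scaleInv, hankelAdj, Matrix.of_apply, Matrix.add_apply, ← mul_add,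
    ← Finset.sum_add_distrib]
  congr 1
  refine Finset.sum_congr rfl fun j _ => Finset.sum_congr rfl fun k _ => ?_
  split_ifs <;> simp

theorem opGAdj_smul (c : ℂ) (Z : Matrix (Fin n₁ × Fin s) (Fin n₂) ℂ) :
    opGAdj n (c • Z) = c • opGAdj n Z := by
  ext a i
  simp only [opGAdj, scaleInv, hankelAdj, Matrix.of_apply, Matrix.smul_apply, smul_eq_mul]
  rw [mul_left_comm]
  congr 1
  rw [Finset.mul_sum]
  refine Finset.sum_congr rfl fun j _ => ?_
  rw [Finset.mul_sum]
  refine Finset.sum_congr rfl fun k _ => ?_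
  split_ifs <;> simp

/-- `𝒢*` as a linear map. -/
def opGAdjHom (s n n₁ n₂ : ℕ) :
    Matrix (Fin n₁ × Fin s) (Fin n₂) ℂ →ₗ[ℂ] Matrix (Fin s) (Fin n) ℂ where
  toFun := opGAdj n
  map_add' := opGAdj_add
  map_smul' := opGAdj_smul

theorem opGAdj_sub (Y Z : Matrix (Fin n₁ × Fin s) (Fin n₂) ℂ) :
    opGAdj n (Y - Z) = opGAdj n Y - opGAdj n Z := (opGAdjHom s n n₁ n₂).map_sub Y Z

theorem opG_add (hn : n₁ + n₂ = n + 1) (X Y : Matrix (Fin s) (Fin n) ℂ) :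
    opG hn (X + Y) = opG hn X + opG hn Y := by
  ext p k
  simp [opG, hankel, scaleInv, mul_add]

theorem hankel_sub (hn : n₁ + n₂ = n + 1) (X Y : Matrix (Fin s) (Fin n) ℂ) :
    hankel hn (X - Y) = hankel hn X - hankel hn Y := rfl

/-! ### The measurements -/

theorem sense_add (b : Fin n → Fin s → ℂ) (X Y : Matrix (Fin s) (Fin n) ℂ) :
    sense b (X + Y) = sense b X + sense b Y := by
  ext j; simp [sense, mul_add, Finset.sum_add_distrib]

theorem sense_sub (b : Fin n → Fin s → ℂ) (X Y : Matrix (Fin s) (Fin n) ℂ) :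
    sense b (X - Y) = sense b X - sense b Y := by
  ext j; simp [sense, mul_sub, Finset.sum_sub_distrib]

/-- The data `D y` is the image of the target lift under the same operator `𝒜𝒢*` as the iterates, so
the misfit depends only on `L Rᴴ - ℋ(X)`. -/
theorem weighted_sense (hn : n₁ + n₂ = n + 1) (b : Fin n → Fin s → ℂ)
    (X : Matrix (Fin s) (Fin n) ℂ) :
    weighted n₁ n₂ (sense b X) = sense b (opGAdj n (hankel hn X)) := by
  rw [opGAdj_hankel]
  ext i
  simp only [weighted, sense, Matrix.of_apply, Finset.mul_sum]
  exact Finset.sum_congr rfl fun a _ => by ring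

theorem ip_senseAdj (b : Fin n → Fin s → ℂ) (y : Fin n → ℂ) (X : Matrix (Fin s) (Fin n) ℂ) :
    ip (senseAdj b y) X = ∑ i, (star (y i) * sense b X i).re := by
  rw [ip_eq_sum, Finset.sum_comm]
  refine Finset.sum_congr rfl fun i _ => ?_
  rw [← Complex.re_sum, sense, Finset.mul_sum]
  congr 1
  refine Finset.sum_congr rfl fun a _ => ?_
  simp only [senseAdj, Matrix.of_apply, star_mul']
  ring

theorem norm_sense_sq_le {B : ℝ} (b : Fin n → Fin s → ℂ) (hb : ∀ i, ∑ a, ‖b i a‖ ^ 2 ≤ B)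
    (X : Matrix (Fin s) (Fin n) ℂ) (i : Fin n) :
    ‖sense b X i‖ ^ 2 ≤ B * ∑ a, ‖X a i‖ ^ 2 := by
  have h1 : ‖sense b X i‖ ≤ ∑ a, ‖b i a‖ * ‖X a i‖ := by
    refine (norm_sum_le _ _).trans (Finset.sum_le_sum fun a _ => ?_)
    rw [norm_mul, norm_star]
  calc ‖sense b X i‖ ^ 2 ≤ (∑ a, ‖b i a‖ * ‖X a i‖) ^ 2 := by gcongr
    _ ≤ (∑ a, ‖b i a‖ ^ 2) * ∑ a, ‖X a i‖ ^ 2 := Finset.sum_mul_sq_le_sq_mul_sq _ _ _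
    _ ≤ _ := by gcongr; exact hb i

theorem sum_norm_sense_sq_le {B : ℝ} (b : Fin n → Fin s → ℂ) (hb : ∀ i, ∑ a, ‖b i a‖ ^ 2 ≤ B)
    (X : Matrix (Fin s) (Fin n) ℂ) :
    ∑ i, ‖sense b X i‖ ^ 2 ≤ B * frobNorm X ^ 2 := by
  rw [frobNorm_sq_eq_sum, Finset.sum_comm, Finset.mul_sum]
  exact Finset.sum_le_sum fun i _ => norm_sense_sq_le b hb X i

theorem frobNorm_senseAdj_sq_le {B : ℝ} (b : Fin n → Fin s → ℂ)
    (hb : ∀ i, ∑ a, ‖b i a‖ ^ 2 ≤ B) (y : Fin n → ℂ) :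
    frobNorm (senseAdj b y) ^ 2 ≤ B * ∑ i, ‖y i‖ ^ 2 := by
  rw [frobNorm_sq_eq_sum, Finset.sum_comm, Finset.mul_sum]
  refine Finset.sum_le_sum fun i _ => ?_
  simp only [senseAdj, Matrix.of_apply, norm_mul, mul_pow, ← Finset.mul_sum]
  rw [mul_comm]
  gcongr
  exact hb i

theorem frobNorm_block_sq {r : ℕ} (L : Matrix (Fin n₁ × Fin s) (Fin r) ℂ) (j : Fin n₁) :
    frobNorm (block L j) ^ 2 = ∑ a, ∑ l, ‖L (j, a) l‖ ^ 2 := by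
  rw [frobNorm_sq_eq_sum]; rfl

theorem sum_frobNorm_block_sq {r : ℕ} (L : Matrix (Fin n₁ × Fin s) (Fin r) ℂ) :
    ∑ j, frobNorm (block L j) ^ 2 = frobNorm L ^ 2 := by
  simp only [frobNorm_block_sq]
  rw [frobNorm_sq_eq_sum, Fintype.sum_prod_type]

theorem rowNorm_nonneg {p q : Type*} [Fintype q] (A : Matrix p q ℂ) (k : p) : 0 ≤ rowNorm A k :=
  norm_nonneg _

theorem rowNorm_sq {p q : Type*} [Fintype q] (A : Matrix p q ℂ) (k : p) :
    rowNorm A k ^ 2 = ∑ l, ‖A k l‖ ^ 2 := by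
  rw [rowNorm, EuclideanSpace.norm_sq_eq]

theorem sum_rowNorm_sq {p q : Type*} [Fintype p] [Fintype q] (A : Matrix p q ℂ) :
    ∑ k, rowNorm A k ^ 2 = frobNorm A ^ 2 := by
  simp only [rowNorm_sq]
  rw [frobNorm_sq_eq_sum]

/-- `b_jᴴ L_j R_kᴴ` is bounded through the norms of `b`, of the block and of the row. -/
theorem norm_sum_block_mul_row_sq_le {r : ℕ} (c : Fin s → ℂ)
    (L : Matrix (Fin n₁ × Fin s) (Fin r) ℂ) (R : Matrix (Fin n₂) (Fin r) ℂ) (j : Fin n₁)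
    (k : Fin n₂) :
    ‖∑ a, star (c a) * (L * Rᴴ) (j, a) k‖ ^ 2 ≤
      (∑ a, ‖c a‖ ^ 2) * (frobNorm (block L j) ^ 2 * rowNorm R k ^ 2) := by
  have h1 : ‖∑ a, star (c a) * (L * Rᴴ) (j, a) k‖ ≤ ∑ a, ‖c a‖ * ‖(L * Rᴴ) (j, a) k‖ := by
    refine (norm_sum_le _ _).trans (Finset.sum_le_sum fun a _ => ?_)
    rw [norm_mul, norm_star]
  have h2 : ∀ a, ‖(L * Rᴴ) (j, a) k‖ ^ 2 ≤ (∑ l, ‖L (j, a) l‖ ^ 2) * rowNorm R k ^ 2 := by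
    intro a
    rw [Matrix.mul_apply, rowNorm_sq]
    have h3 : ‖∑ l, L (j, a) l * Rᴴ l k‖ ≤ ∑ l, ‖L (j, a) l‖ * ‖R k l‖ := by
      refine (norm_sum_le _ _).trans (Finset.sum_le_sum fun l _ => ?_)
      rw [norm_mul, Matrix.conjTranspose_apply, norm_star]
    calc _ ≤ (∑ l, ‖L (j, a) l‖ * ‖R k l‖) ^ 2 := by gcongr
      _ ≤ _ := Finset.sum_mul_sq_le_sq_mul_sq _ _ _
  calc _ ≤ (∑ a, ‖c a‖ * ‖(L * Rᴴ) (j, a) k‖) ^ 2 := by gcongr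
    _ ≤ (∑ a, ‖c a‖ ^ 2) * ∑ a, ‖(L * Rᴴ) (j, a) k‖ ^ 2 := Finset.sum_mul_sq_le_sq_mul_sq _ _ _
    _ ≤ _ := by
      rw [frobNorm_block_sq, Finset.sum_mul _ _ (rowNorm R k ^ 2)]
      have h3 : 0 ≤ ∑ a, ‖c a‖ ^ 2 := by positivity
      exact mul_le_mul_of_nonneg_left (Finset.sum_le_sum fun a _ => h2 a) h3

/-- `𝒢*` averages the `w_i` blocks of the antidiagonal with total factor `1/√w_i`; Cauchy-Schwarz
over these blocks costs exactly `w_i`, so no weight survives in the bound. -/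
theorem norm_sense_opGAdj_mul_sq_le {r : ℕ} (b : Fin n → Fin s → ℂ)
    (L : Matrix (Fin n₁ × Fin s) (Fin r) ℂ) (R : Matrix (Fin n₂) (Fin r) ℂ) (i : Fin n) :
    ‖sense b (opGAdj n (L * Rᴴ)) i‖ ^ 2 ≤ (∑ a, ‖b i a‖ ^ 2) *
      ∑ j : Fin n₁, ∑ k : Fin n₂, if j.val + k.val = i.val then
        frobNorm (block L j) ^ 2 * rowNorm R k ^ 2 else 0 := by
  set w := weight n₁ n₂ i with hw
  set S := Finset.univ.filter fun p : Fin n₁ × Fin n₂ => p.1.val + p.2.val = i.val with hS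
  have h1 : sense b (opGAdj n (L * Rᴴ)) i = ((Real.sqrt w : ℝ) : ℂ)⁻¹ *
      ∑ p ∈ S, ∑ a, star (b i a) * (L * Rᴴ) (p.1, a) p.2 := by
    simp only [sense, opGAdj, scaleInv, hankelAdj, Matrix.of_apply]
    rw [Finset.sum_comm, Finset.mul_sum]
    refine Finset.sum_congr rfl fun a _ => ?_
    rw [← Finset.mul_sum, hS, Finset.sum_filter, Fintype.sum_prod_type]
    ring
  have h2 : ‖∑ p ∈ S, ∑ a, star (b i a) * (L * Rᴴ) (p.1, a) p.2‖ ^ 2 ≤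
      w * ∑ p ∈ S, ((∑ a, ‖b i a‖ ^ 2) * (frobNorm (block L p.1) ^ 2 * rowNorm R p.2 ^ 2)) := by
    calc _ ≤ (∑ p ∈ S, ‖∑ a, star (b i a) * (L * Rᴴ) (p.1, a) p.2‖) ^ 2 := by
          gcongr; exact norm_sum_le _ _
      _ ≤ S.card * ∑ p ∈ S, ‖∑ a, star (b i a) * (L * Rᴴ) (p.1, a) p.2‖ ^ 2 :=
          sq_sum_le_card_mul_sum_sq
      _ ≤ _ := by
          gcongr with p hp
          · exact le_of_eq rfl
          · exact norm_sum_block_mul_row_sq_le _ _ _ _ _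
  have h3 : ∑ p ∈ S, ((∑ a, ‖b i a‖ ^ 2) * (frobNorm (block L p.1) ^ 2 * rowNorm R p.2 ^ 2)) =
      (∑ a, ‖b i a‖ ^ 2) *
      ∑ j : Fin n₁, ∑ k : Fin n₂, if j.val + k.val = i.val then
        frobNorm (block L j) ^ 2 * rowNorm R k ^ 2 else 0 := by
    rw [← Finset.mul_sum, hS, Finset.sum_filter, Fintype.sum_prod_type]
  rw [← h3, h1, norm_mul, mul_pow, norm_inv, Complex.norm_real, Real.norm_eq_abs, inv_pow, sq_abs,
    Real.sq_sqrt (Nat.cast_nonneg _)]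
  have h4 : 0 ≤ ∑ p ∈ S, ((∑ a, ‖b i a‖ ^ 2) *
      (frobNorm (block L p.1) ^ 2 * rowNorm R p.2 ^ 2)) := by positivity
  rcases Nat.eq_zero_or_pos w with h0 | h0
  · rw [h0]; simpa using h4
  · have : (0 : ℝ) < w := by exact_mod_cast h0
    rw [inv_mul_le_iff₀ this]
    exact h2

/-- One measurement of a product with incoherent right factor. -/
theorem norm_sense_opGAdj_mul_sq_le_right {r : ℕ} {B c : ℝ} (b : Fin n → Fin s → ℂ) (i : Fin n)
    (hb : ∑ a, ‖b i a‖ ^ 2 ≤ B)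
    (L : Matrix (Fin n₁ × Fin s) (Fin r) ℂ) (R : Matrix (Fin n₂) (Fin r) ℂ)
    (hR : ∀ k, rowNorm R k ^ 2 ≤ c) (hc : 0 ≤ c) :
    ‖sense b (opGAdj n (L * Rᴴ)) i‖ ^ 2 ≤ B * c * frobNorm L ^ 2 := by
  have hB : 0 ≤ B := le_trans (by positivity) hb
  refine (norm_sense_opGAdj_mul_sq_le b L R i).trans ?_
  rw [mul_assoc, ← sum_frobNorm_block_sq, Finset.mul_sum _ _ c]
  refine mul_le_mul hb (Finset.sum_le_sum fun j _ => ?_) (Finset.sum_nonneg fun _ _ => Finset.sum_nonneg fun _ _ => by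
    split_ifs <;> positivity) hB
  -- The antidiagonal meets each block row in at most one block, so the double sum collapses to a
  -- single sum over `j`.
  by_cases h : ∃ k : Fin n₂, j.val + k.val = i.val
  · obtain ⟨k, hk⟩ := h
    rw [Finset.sum_eq_single k]
    · rw [if_pos hk, mul_comm]
      gcongr
      exact hR k
    · intro k' _ hk'
      rw [if_neg]
      intro h'
      exact hk' (Fin.ext (by omega))
    · simp
  · push Not at h
    rw [Finset.sum_eq_zero fun k _ => if_neg (h k)]
    positivity

/-- One measurement of a product with incoherent left factor. -/
theorem norm_sense_opGAdj_mul_sq_le_left {r : ℕ} {B c : ℝ} (b : Fin n → Fin s → ℂ) (i : Fin n)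
    (hb : ∑ a, ‖b i a‖ ^ 2 ≤ B)
    (L : Matrix (Fin n₁ × Fin s) (Fin r) ℂ) (R : Matrix (Fin n₂) (Fin r) ℂ)
    (hL : ∀ j, frobNorm (block L j) ^ 2 ≤ c) (hc : 0 ≤ c) :
    ‖sense b (opGAdj n (L * Rᴴ)) i‖ ^ 2 ≤ B * c * frobNorm R ^ 2 := by
  have hB : 0 ≤ B := le_trans (by positivity) hb
  refine (norm_sense_opGAdj_mul_sq_le b L R i).trans ?_
  rw [mul_assoc, ← sum_rowNorm_sq, Finset.mul_sum _ _ c, Finset.sum_comm]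
  refine mul_le_mul hb (Finset.sum_le_sum fun k _ => ?_) (Finset.sum_nonneg fun _ _ => Finset.sum_nonneg fun _ _ => by
    split_ifs <;> positivity) hB
  by_cases h : ∃ j : Fin n₁, j.val + k.val = i.val
  · obtain ⟨j, hk⟩ := h
    rw [Finset.sum_eq_single j]
    · rw [if_pos hk]
      gcongr
      exact hL j
    · intro k' _ hk'
      rw [if_neg]
      intro h'
      exact hk' (Fin.ext (by omega))
    · simp
  · push Not at h
    rw [Finset.sum_eq_zero fun j _ => if_neg (h j)]
    positivity

end Hankel

/-! ### The operator norm of a Hankel lift through the discrete Fourier transform -/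

section Fourier

variable {n : ℕ} [NeZero n]

theorem norm_stdAddChar (x : ZMod n) : ‖ZMod.stdAddChar x‖ = 1 := by
  rw [ZMod.stdAddChar_apply]; exact Circle.norm_coe _

theorem sum_stdAddChar_mul (b : ZMod n) :
    ∑ f : ZMod n, ZMod.stdAddChar (f * b) = if b = 0 then (n : ℂ) else 0 := by
  have := AddChar.sum_mulShift b (ZMod.isPrimitive_stdAddChar n)
  rw [this, ZMod.card]
  split_ifs <;> simp

theorem star_stdAddChar (x : ZMod n) :
    star (ZMod.stdAddChar x : ℂ) = ZMod.stdAddChar (-x) := by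
  rw [AddChar.map_neg_eq_inv, Complex.star_def, Complex.inv_def, Complex.normSq_eq_norm_sq,
    norm_stdAddChar]
  simp

/-- Orthogonality of characters. The injection `g` allows vectors shorter than `n`, that is, padding
by zeros. -/
theorem parseval {K : Type*} [Fintype K] (g : K → ZMod n) (hg : Function.Injective g)
    (v : K → ℂ) :
    ∑ f : ZMod n, ‖∑ k, ZMod.stdAddChar (-(f * g k)) * v k‖ ^ 2 = n * ∑ k, ‖v k‖ ^ 2 := by
  classical
  have key : ∑ f : ZMod n, star (∑ k, ZMod.stdAddChar (-(f * g k)) * v k) *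
      (∑ k, ZMod.stdAddChar (-(f * g k)) * v k) = n * ∑ k, star (v k) * v k := by
    simp only [star_sum, Finset.sum_mul_sum, star_mul', star_stdAddChar, neg_neg]
    rw [Finset.sum_comm, Finset.mul_sum]
    refine Finset.sum_congr rfl fun k _ => ?_
    rw [Finset.sum_comm, Finset.sum_eq_single k]
    · have : ∀ f : ZMod n, ZMod.stdAddChar (f * g k) * star (v k) *
          (ZMod.stdAddChar (-(f * g k)) * v k) = star (v k) * v k := by
        intro f
        have h := AddChar.map_add_eq_mul (ZMod.stdAddChar (N := n)) (f * g k) (-(f * g k))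
        rw [add_neg_cancel, AddChar.map_zero_eq_one] at h
        linear_combination -(star (v k) * v k) * h
      rw [Finset.sum_congr rfl fun f _ => this f]
      simp [ZMod.card]
    · intro l _ hl
      have : ∀ f : ZMod n, ZMod.stdAddChar (f * g k) * star (v k) *
          (ZMod.stdAddChar (-(f * g l)) * v l) =
          star (v k) * v l * ZMod.stdAddChar (f * (g k - g l)) := by
        intro f
        have h := AddChar.map_add_eq_mul (ZMod.stdAddChar (N := n)) (f * g k) (-(f * g l))
        rw [show f * (g k - g l) = f * g k + -(f * g l) by ring, h]
        ring
      rw [Finset.sum_congr rfl fun f _ => this f, ← Finset.mul_sum, sum_stdAddChar_mul, if_neg,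
        mul_zero]
      rw [sub_eq_zero]
      exact fun h => hl (hg h).symm
    · simp
  have hz : ∀ z : ℂ, star z * z = ((‖z‖ ^ 2 : ℝ) : ℂ) := by
    intro z
    rw [Complex.star_def, ← Complex.normSq_eq_conj_mul_self, Complex.normSq_eq_norm_sq]
  simp only [hz] at key
  exact_mod_cast key

theorem natCast_injOn {m : ℕ} (hm : m ≤ n) :
    Function.Injective fun k : Fin m => ((k.val : ℕ) : ZMod n) := by
  intro k l h
  have h' := (ZMod.natCast_eq_natCast_iff' _ _ _).1 h
  rw [Nat.mod_eq_of_lt (by omega), Nat.mod_eq_of_lt (by omega)] at h'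
  exact Fin.ext h'

theorem fourier_inversion (y : Fin n → ℂ) (i : Fin n) :
    ∑ f : ZMod n, ZMod.stdAddChar (-(f * (i.val : ZMod n))) *
      (∑ k : Fin n, ZMod.stdAddChar (f * (k.val : ZMod n)) * y k) = n * y i := by
  simp only [Finset.mul_sum]
  rw [Finset.sum_comm, Finset.sum_eq_single i]
  · have : ∀ f : ZMod n, ZMod.stdAddChar (-(f * (i.val : ZMod n))) *
        (ZMod.stdAddChar (f * (i.val : ZMod n)) * y i) = y i := by
      intro f
      have h := AddChar.map_add_eq_mul (ZMod.stdAddChar (N := n)) (f * (i.val : ZMod n))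
        (-(f * (i.val : ZMod n)))
      rw [add_neg_cancel, AddChar.map_zero_eq_one] at h
      linear_combination -(y i) * h
    rw [Finset.sum_congr rfl fun f _ => this f]
    simp [ZMod.card]
  · intro k _ hk
    have : ∀ f : ZMod n, ZMod.stdAddChar (-(f * (i.val : ZMod n))) *
        (ZMod.stdAddChar (f * (k.val : ZMod n)) * y k) =
        y k * ZMod.stdAddChar (f * ((k.val : ZMod n) - (i.val : ZMod n))) := by
      intro f
      have h := AddChar.map_add_eq_mul (ZMod.stdAddChar (N := n)) (f * (k.val : ZMod n))
        (-(f * (i.val : ZMod n)))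
      rw [show f * ((k.val : ZMod n) - (i.val : ZMod n)) =
        f * (k.val : ZMod n) + -(f * (i.val : ZMod n)) by ring, h]
      ring
    rw [Finset.sum_congr rfl fun f _ => this f, ← Finset.mul_sum, sum_stdAddChar_mul, if_neg,
      mul_zero]
    rw [sub_eq_zero]
    exact fun h => hk (natCast_injOn le_rfl h)
  · simp

/-- Fourier inversion of `y` at `j + k` separates the two indices: up to the factor `n`, the product
is an inverse transform of the pointwise product of the transforms of `y` and `v`. Two uses of
Parseval leave only the largest Fourier coefficient of `y`. -/
theorem sum_norm_hankel_row_sq_le {n₁ n₂ : ℕ} (hn : n₁ + n₂ = n + 1) (h₁ : 0 < n₁) (h₂ : 0 < n₂)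
    (y : Fin n → ℂ) {τ : ℝ}
    (hy : ∀ f : ZMod n, ‖∑ i : Fin n, ZMod.stdAddChar (f * (i.val : ZMod n)) * y i‖ ^ 2 ≤ τ)
    (v : Fin n₂ → ℂ) :
    ∑ j : Fin n₁, ‖∑ k : Fin n₂, y ⟨j.val + k.val, by
      have := j.isLt; have := k.isLt; omega⟩ * v k‖ ^ 2 ≤ τ * ∑ k, ‖v k‖ ^ 2 := by
  set yh : ZMod n → ℂ := fun f => ∑ i : Fin n, ZMod.stdAddChar (f * (i.val : ZMod n)) * y i with hyh
  set vh : ZMod n → ℂ := fun f => ∑ k : Fin n₂, ZMod.stdAddChar (-(f * (k.val : ZMod n))) * v k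
    with hvh
  have hn0 : (0 : ℝ) < n := by exact_mod_cast NeZero.pos n
  have h1 : ∀ j : Fin n₁, (n : ℂ) * ∑ k : Fin n₂, y ⟨j.val + k.val, by
      have := j.isLt; have := k.isLt; omega⟩ * v k =
      ∑ f : ZMod n, ZMod.stdAddChar (-((j.val : ZMod n) * f)) * (yh f * vh f) := by
    intro j
    rw [Finset.mul_sum]
    simp only [← mul_assoc, ← fourier_inversion y]
    simp only [hvh, Finset.mul_sum, Finset.sum_mul]
    rw [Finset.sum_comm]
    refine Finset.sum_congr rfl fun f _ => ?_
    refine Finset.sum_congr rfl fun k _ => ?_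
    simp only [hyh, Finset.mul_sum, Finset.sum_mul]
    refine Finset.sum_congr rfl fun i _ => ?_
    have h := AddChar.map_add_eq_mul (ZMod.stdAddChar (N := n)) (-((j.val : ZMod n) * f))
        (-(f * (k.val : ZMod n)))
    rw [show (-(f * ((j.val + k.val : ℕ) : ZMod n))) =
      -((j.val : ZMod n) * f) + -(f * (k.val : ZMod n)) by push_cast; ring, h]
    ring
  -- As `n₁ ≤ n`, the row indices are distinct residues modulo `n`, and the sum over rows extends to
  -- all residues.
  have h2 : ∑ j : Fin n₁, ‖∑ f : ZMod n, ZMod.stdAddChar (-((j.val : ZMod n) * f)) *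
      (yh f * vh f)‖ ^ 2 ≤ n * ∑ f : ZMod n, ‖yh f * vh f‖ ^ 2 := by
    rw [← parseval (fun f : ZMod n => f) Function.injective_id (fun f => yh f * vh f)]
    have hinj := natCast_injOn (n := n) (m := n₁) (by omega)
    rw [← Finset.sum_image (s := Finset.univ) (g := fun j : Fin n₁ => ((j.val : ℕ) : ZMod n))
      (f := fun x : ZMod n => ‖∑ f : ZMod n, ZMod.stdAddChar (-(x * f)) * (yh f * vh f)‖ ^ 2)
      (hinj.injOn)]
    exact Finset.sum_le_sum_of_subset_of_nonneg (Finset.subset_univ _) fun _ _ _ => by positivity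
  have h3 : ∑ f : ZMod n, ‖yh f * vh f‖ ^ 2 ≤ τ * (n * ∑ k, ‖v k‖ ^ 2) := by
    rw [← parseval (fun k : Fin n₂ => ((k.val : ℕ) : ZMod n)) (natCast_injOn (by omega)) v,
      Finset.mul_sum]
    refine Finset.sum_le_sum fun f _ => ?_
    rw [norm_mul, mul_pow]
    exact mul_le_mul_of_nonneg_right (hy f) (by positivity)
  have h4 : (n : ℝ) ^ 2 * ∑ j : Fin n₁, ‖∑ k : Fin n₂, y ⟨j.val + k.val, by
      have := j.isLt; have := k.isLt; omega⟩ * v k‖ ^ 2 ≤ (n : ℝ) ^ 2 * (τ * ∑ k, ‖v k‖ ^ 2) := by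
    calc _ = ∑ j : Fin n₁, ‖∑ f : ZMod n, ZMod.stdAddChar (-((j.val : ZMod n) * f)) *
        (yh f * vh f)‖ ^ 2 := by
          rw [Finset.mul_sum]
          refine Finset.sum_congr rfl fun j _ => ?_
          rw [← h1 j, norm_mul, mul_pow, Complex.norm_natCast]
      _ ≤ n * (τ * (n * ∑ k, ‖v k‖ ^ 2)) := h2.trans (by gcongr)
      _ = _ := by ring
  exact le_of_mul_le_mul_left h4 (by positivity)

/-- Up to a permutation of rows the lift stacks `s` scalar Hankel matrices, one for each coordinate
`a`, and their squared bounds add up. -/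
theorem frobNorm_hankel_mul_le {s n₁ n₂ : ℕ} (hn : n₁ + n₂ = n + 1) (h₁ : 0 < n₁) (h₂ : 0 < n₂)
    (Y : Matrix (Fin s) (Fin n) ℂ) {τ : ℝ}
    (hY : ∀ (f : ZMod n) (a : Fin s),
      ‖∑ i : Fin n, ZMod.stdAddChar (f * (i.val : ZMod n)) * Y a i‖ ^ 2 ≤ τ)
    {q : Type*} [Fintype q] (W : Matrix (Fin n₂) q ℂ) :
    frobNorm (hankel hn Y * W) ^ 2 ≤ s * τ * frobNorm W ^ 2 := by
  rw [frobNorm_sq_eq_sum, frobNorm_sq_eq_sum, Fintype.sum_prod_type, Finset.sum_comm]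
  calc _ ≤ ∑ a : Fin s, τ * ∑ k, ∑ x, ‖W k x‖ ^ 2 := by
        refine Finset.sum_le_sum fun a _ => ?_
        rw [Finset.sum_comm, Finset.sum_comm (s := (Finset.univ : Finset (Fin n₂))), Finset.mul_sum]
        refine Finset.sum_le_sum fun x _ => ?_
        exact sum_norm_hankel_row_sq_le hn h₁ h₂ (Y a) (fun f => hY f a) fun k => W k x
    _ = _ := by simp; ring

end Fourier

/-- Duality: test the bound for `E` on `W = Eᴴ Y`. -/
theorem frobNorm_conjTranspose_mul_le {p q k : Type*} [Fintype p] [Fintype q] [Fintype k]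
    {E : Matrix p q ℂ} {c : ℝ} (hc : 0 ≤ c)
    (hE : ∀ W : Matrix q k ℂ, frobNorm (E * W) ≤ c * frobNorm W) (Y : Matrix p k ℂ) :
    frobNorm (Eᴴ * Y) ≤ c * frobNorm Y := by
  rcases (frobNorm_nonneg (Eᴴ * Y)).eq_or_lt with h0 | h0
  · rw [← h0]
    exact mul_nonneg hc (frobNorm_nonneg _)
  · have h1 : frobNorm (Eᴴ * Y) ^ 2 ≤ frobNorm Y * (c * frobNorm (Eᴴ * Y)) := by
      rw [frobNorm_sq, ip_mul_left, Matrix.conjTranspose_conjTranspose]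
      exact (ip_le _ _).trans (mul_le_mul_of_nonneg_left (hE _) (frobNorm_nonneg _))
    nlinarith

/-! ### Columns of a signal with an incoherent lift -/

section Incoherence

variable {s n n₁ n₂ r : ℕ}

theorem frobNorm_mul_realDiag_sq_le {p : Type*} [Fintype p] (A : Matrix p (Fin r) ℂ)
    {d : Fin r → ℝ} {c : ℝ} (hd0 : ∀ l, 0 ≤ d l) (hd : ∀ l, d l ≤ c) :
    frobNorm (A * realDiag d) ^ 2 ≤ c ^ 2 * frobNorm A ^ 2 := by
  rw [frobNorm_sq_eq_sum, frobNorm_sq_eq_sum, Finset.mul_sum]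
  refine Finset.sum_le_sum fun i _ => ?_
  rw [Finset.mul_sum]
  refine Finset.sum_le_sum fun l _ => ?_
  rw [realDiag, Matrix.mul_diagonal, norm_mul, mul_pow, Complex.norm_real, Real.norm_eq_abs, sq_abs,
    mul_comm]
  have := hd0 l
  gcongr
  exact hd l

/-- The two ranges share only the index `n₁ - 1`, because `n₁ + n₂ = n + 1`. -/
theorem sum_fin_le_add {n n₁ n₂ : ℕ} (hn : n₁ + n₂ = n + 1) (h₁ : 0 < n₁) (h₂ : 0 < n₂) (φ : ℕ → ℝ)
    (hφ : ∀ i, 0 ≤ φ i) :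
    ∑ i : Fin n, φ i ≤ ∑ j : Fin n₁, φ j + ∑ k : Fin n₂, φ (n₁ - 1 + k) := by
  rw [Fin.sum_univ_eq_sum_range φ, Fin.sum_univ_eq_sum_range φ,
    Fin.sum_univ_eq_sum_range fun k => φ (n₁ - 1 + k)]
  obtain ⟨m, rfl⟩ : ∃ m, n₂ = m + 1 := ⟨n₂ - 1, by omega⟩
  obtain rfl : n = n₁ + m := by omega
  rw [Finset.sum_range_add, Finset.sum_range_succ']
  have : ∀ x, n₁ - 1 + (x + 1) = n₁ + x := by intro x; omega
  simp only [this]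
  have := hφ (n₁ - 1 + 0)
  linarith

theorem frobNorm_mul_conjTranspose_orthonormal {p q : Type*} [Fintype p] [Fintype q]
    (A : Matrix p (Fin r) ℂ) {V : Matrix q (Fin r) ℂ} (hV : Vᴴ * V = 1) :
    frobNorm (A * Vᴴ) = frobNorm A := by
  rw [← frobNorm_conjTranspose, Matrix.conjTranspose_mul, Matrix.conjTranspose_conjTranspose,
    frobNorm_orthonormal_mul _ hV, frobNorm_conjTranspose]

theorem block_mul (U : Matrix (Fin n₁ × Fin s) (Fin r) ℂ) {m : ℕ} (A : Matrix (Fin r) (Fin m) ℂ)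
    (j : Fin n₁) : block (U * A) j = block U j * A := rfl

/-- The first block column and the last block row of the lift together contain every column of `X`.
The first is controlled by a single row of `V`, the second by a single block of `U`. -/
theorem frobNorm_sq_le_of_incoherent (hn : n₁ + n₂ = n + 1) (h₁ : 0 < n₁) (h₂ : 0 < n₂)
    {X : Matrix (Fin s) (Fin n) ℂ} {U : Matrix (Fin n₁ × Fin s) (Fin r) ℂ} {d : Fin r → ℝ}
    {V : Matrix (Fin n₂) (Fin r) ℂ} (hX : IsSVD (hankel hn X) U d V) {σ c : ℝ}
    (hd : ∀ l, d l ≤ σ) (hU : ∀ j, frobNorm (block U j) ^ 2 ≤ c)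
    (hV : ∀ k, rowNorm V k ^ 2 ≤ c) : frobNorm X ^ 2 ≤ 2 * σ ^ 2 * c := by
  have hc1 : ∑ j : Fin n₁, ∑ a, ‖hankel hn X (j, a) ⟨0, h₂⟩‖ ^ 2 ≤ σ ^ 2 * c := by
    have e : (hankel hn X).submatrix id (fun _ : Unit => (⟨0, h₂⟩ : Fin n₂)) =
        U * (realDiag d * Vᴴ).submatrix id (fun _ : Unit => (⟨0, h₂⟩ : Fin n₂)) := by
      rw [hX.eq_mul, Matrix.mul_assoc]; rfl
    have e1 := congrArg (fun A => frobNorm A ^ 2) e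
    simp only at e1
    rw [frobNorm_orthonormal_mul _ hX.left_orthonormal, frobNorm_sq_eq_sum, Fintype.sum_prod_type]
      at e1
    simp only [Matrix.submatrix_apply, id, Finset.univ_unique, Finset.sum_singleton] at e1
    rw [e1]
    have e2 : (realDiag d * Vᴴ).submatrix id (fun _ : Unit => (⟨0, h₂⟩ : Fin n₂)) =
        (V.submatrix (fun _ : Unit => (⟨0, h₂⟩ : Fin n₂)) id * realDiag d)ᴴ := by
      ext l u
      simp [realDiag, Matrix.mul_diagonal, Matrix.diagonal_mul, mul_comm]
    rw [e2, frobNorm_conjTranspose]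
    refine (frobNorm_mul_realDiag_sq_le _ hX.nonneg hd).trans ?_
    refine mul_le_mul_of_nonneg_left ?_ (sq_nonneg σ)
    refine le_trans (le_of_eq ?_) (hV ⟨0, h₂⟩)
    rw [rowNorm_sq, frobNorm_sq_eq_sum]
    simp
  have hc2 : ∑ k : Fin n₂, ∑ a, ‖hankel hn X (⟨n₁ - 1, by omega⟩, a) k‖ ^ 2 ≤ σ ^ 2 * c := by
    have e : block (hankel hn X) ⟨n₁ - 1, by omega⟩ =
        block U ⟨n₁ - 1, by omega⟩ * realDiag d * Vᴴ := by
      rw [hX.eq_mul, block_mul, block_mul]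
    have e1 := congrArg (fun A => frobNorm A ^ 2) e
    simp only at e1
    rw [frobNorm_mul_conjTranspose_orthonormal _ hX.right_orthonormal, frobNorm_block_sq,
      Finset.sum_comm] at e1
    rw [e1]
    refine (frobNorm_mul_realDiag_sq_le _ hX.nonneg hd).trans ?_
    exact mul_le_mul_of_nonneg_left (hU _) (sq_nonneg σ)
  have h3 := sum_fin_le_add hn h₁ h₂
    (fun i => if h : i < n then ∑ a, ‖X a ⟨i, h⟩‖ ^ 2 else 0)
    (fun i => by split_ifs <;> positivity)
  have h4 : frobNorm X ^ 2 = ∑ i : Fin n, if h : i.val < n then ∑ a, ‖X a ⟨i, h⟩‖ ^ 2 else 0 := by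
    rw [frobNorm_sq_eq_sum, Finset.sum_comm]
    refine Finset.sum_congr rfl fun i _ => ?_
    rw [dif_pos i.isLt]
  rw [h4]
  refine h3.trans ?_
  have h5 : ∑ j : Fin n₁, (if h : j.val < n then ∑ a, ‖X a ⟨j, h⟩‖ ^ 2 else 0) ≤ σ ^ 2 * c := by
    refine le_trans (le_of_eq (Finset.sum_congr rfl fun j _ => ?_)) hc1
    rw [dif_pos (by omega)]
    rfl
  have h6 : ∑ k : Fin n₂, (if h : n₁ - 1 + k.val < n then ∑ a, ‖X a ⟨n₁ - 1 + k.val, h⟩‖ ^ 2 else 0)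
      ≤ σ ^ 2 * c := by
    refine le_trans (le_of_eq (Finset.sum_congr rfl fun k _ => ?_)) hc2
    rw [dif_pos (by omega)]
    rfl
  linarith

/-- Every column of `X` occurs as some block `U_j Σ v_kᴴ` of the lift, where both outer factors are
incoherent. -/
theorem sum_norm_column_sq_le_of_incoherent (hn : n₁ + n₂ = n + 1) (h₁ : 0 < n₁) (h₂ : 0 < n₂)
    {X : Matrix (Fin s) (Fin n) ℂ} {U : Matrix (Fin n₁ × Fin s) (Fin r) ℂ} {d : Fin r → ℝ}
    {V : Matrix (Fin n₂) (Fin r) ℂ} (hX : IsSVD (hankel hn X) U d V) {σ c : ℝ}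
    (hd : ∀ l, d l ≤ σ) (hU : ∀ j, frobNorm (block U j) ^ 2 ≤ c)
    (hV : ∀ k, rowNorm V k ^ 2 ≤ c) (i : Fin n) : ∑ a, ‖X a i‖ ^ 2 ≤ (σ * c) ^ 2 := by
  obtain ⟨j, k, hjk⟩ : ∃ (j : Fin n₁) (k : Fin n₂), j.val + k.val = i.val := by
    have := weight_pos hn h₁ h₂ i
    rw [weight, Finset.card_pos] at this
    obtain ⟨p, hp⟩ := this
    exact ⟨p.1, p.2, (Finset.mem_filter.1 hp).2⟩
  have h1 : ∀ a, X a i = ((U * realDiag d) * Vᴴ) (j, a) k := by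
    intro a
    rw [← hX.eq_mul]
    simp only [hankel, Matrix.of_apply]
    congr 1
    exact Fin.ext hjk.symm
  have h2 : ∀ a, ‖X a i‖ ^ 2 ≤ (∑ l, ‖(U * realDiag d) (j, a) l‖ ^ 2) * rowNorm V k ^ 2 := by
    intro a
    rw [h1, Matrix.mul_apply, rowNorm_sq]
    have h3 : ‖∑ l, (U * realDiag d) (j, a) l * Vᴴ l k‖ ≤
        ∑ l, ‖(U * realDiag d) (j, a) l‖ * ‖V k l‖ := by
      refine (norm_sum_le _ _).trans (Finset.sum_le_sum fun l _ => ?_)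
      rw [norm_mul, Matrix.conjTranspose_apply, norm_star]
    calc _ ≤ (∑ l, ‖(U * realDiag d) (j, a) l‖ * ‖V k l‖) ^ 2 := by gcongr
      _ ≤ _ := Finset.sum_mul_sq_le_sq_mul_sq _ _ _
  have hc : 0 ≤ c := le_trans (sq_nonneg _) (hV k)
  calc _ ≤ ∑ a, (∑ l, ‖(U * realDiag d) (j, a) l‖ ^ 2) * rowNorm V k ^ 2 :=
        Finset.sum_le_sum fun a _ => h2 a
    _ = frobNorm (block U j * realDiag d) ^ 2 * rowNorm V k ^ 2 := by
        rw [← Finset.sum_mul, ← block_mul, frobNorm_block_sq]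
    _ ≤ (σ ^ 2 * c) * c := by
        gcongr
        · exact (frobNorm_mul_realDiag_sq_le _ hX.nonneg hd).trans
            (mul_le_mul_of_nonneg_left (hU _) (sq_nonneg σ))
        · exact hV k
    _ = _ := by ring

end Incoherence

/-! ### Trace inequalities for Hermitian matrices -/

section Trace

variable {ι : Type*} [Fintype ι] [DecidableEq ι]

/-- A rearrangement inequality: `|·|^k` and `|·|^(2q-k)` order `x` and `y` the same way, so the
product of their differences is nonnegative. -/
theorem pow_mul_pow_add_le (x y : ℝ) (k q : ℕ) (hk : k ≤ 2 * q) :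
    x ^ k * y ^ (2 * q - k) + x ^ (2 * q - k) * y ^ k ≤ x ^ (2 * q) + y ^ (2 * q) := by
  have hmono : ∀ j : ℕ, |x| ≤ |y| → |x| ^ j ≤ |y| ^ j := fun j h =>
    pow_le_pow_left₀ (abs_nonneg _) h j
  have hmono' : ∀ j : ℕ, |y| ≤ |x| → |y| ^ j ≤ |x| ^ j := fun j h =>
    pow_le_pow_left₀ (abs_nonneg _) h j
  have h1 : 0 ≤ (|x| ^ k - |y| ^ k) * (|x| ^ (2 * q - k) - |y| ^ (2 * q - k)) := by
    rcases le_total |x| |y| with h | h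
    · exact mul_nonneg_of_nonpos_of_nonpos (by linarith [hmono k h])
        (by linarith [hmono (2 * q - k) h])
    · exact mul_nonneg (by linarith [hmono' k h]) (by linarith [hmono' (2 * q - k) h])
  have h2 : |x| ^ k * |x| ^ (2 * q - k) = x ^ (2 * q) := by
    rw [← pow_add, Nat.add_sub_cancel' hk, Even.pow_abs (even_two_mul q)]
  have h3 : |y| ^ k * |y| ^ (2 * q - k) = y ^ (2 * q) := by
    rw [← pow_add, Nat.add_sub_cancel' hk, Even.pow_abs (even_two_mul q)]
  have h4 : x ^ k * y ^ (2 * q - k) ≤ |x| ^ k * |y| ^ (2 * q - k) := by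
    rw [← abs_pow, ← abs_pow, ← abs_mul]; exact le_abs_self _
  have h5 : x ^ (2 * q - k) * y ^ k ≤ |x| ^ (2 * q - k) * |y| ^ k := by
    rw [← abs_pow, ← abs_pow, ← abs_mul]; exact le_abs_self _
  nlinarith

/-- Factor the difference of powers as a geometric sum and pair each term with its reflection. -/
theorem sub_mul_pow_sub_pow_le (x y : ℝ) (q : ℕ) :
    (x - y) * (x ^ (2 * q + 1) - y ^ (2 * q + 1)) ≤
      (2 * q + 1 : ℝ) / 2 * ((x - y) ^ 2 * (x ^ (2 * q) + y ^ (2 * q))) := by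
  have h1 : (∑ i ∈ Finset.range (2 * q + 1), x ^ i * y ^ (2 * q + 1 - 1 - i)) * (x - y) =
      x ^ (2 * q + 1) - y ^ (2 * q + 1) := geom_sum₂_mul x y (2 * q + 1)
  rw [Nat.add_sub_cancel] at h1
  have h2 : ∑ i ∈ Finset.range (2 * q + 1), x ^ i * y ^ (2 * q - i) =
      ∑ i ∈ Finset.range (2 * q + 1), x ^ (2 * q - i) * y ^ i := by
    rw [← Finset.sum_range_reflect]
    refine Finset.sum_congr rfl fun i hi => ?_
    have hi' := Finset.mem_range.1 hi
    rw [show 2 * q + 1 - 1 - i = 2 * q - i by omega, show 2 * q - (2 * q - i) = i by omega]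
  have h3 : 2 * ∑ i ∈ Finset.range (2 * q + 1), x ^ i * y ^ (2 * q - i) ≤
      (2 * q + 1 : ℝ) * (x ^ (2 * q) + y ^ (2 * q)) := by
    rw [two_mul]
    nth_rewrite 2 [h2]
    rw [← Finset.sum_add_distrib]
    refine (Finset.sum_le_sum fun i hi => pow_mul_pow_add_le x y i q
      (by have := Finset.mem_range.1 hi; omega)).trans (le_of_eq ?_)
    simp
    ring
  rw [← h1]
  nlinarith [mul_le_mul_of_nonneg_left h3 (sq_nonneg (x - y))]

/-- `A` and `B` need not commute, but such traces become double sums over the two spectra, weighted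
by the squared overlaps of the eigenvectors. This transfers scalar inequalities in two variables to
traces. -/
theorem trace_pow_mul_pow {A B : Matrix ι ι ℂ} (hA : A.IsHermitian) (hB : B.IsHermitian)
    (k l : ℕ) : (A ^ k * B ^ l).trace = ∑ i, ∑ j, ((hA.eigenvalues i ^ k * hB.eigenvalues j ^ l *
      ‖((hA.eigenvectorUnitary : Matrix ι ι ℂ)ᴴ * (hB.eigenvectorUnitary : Matrix ι ι ℂ)) i j‖ ^ 2
        : ℝ) : ℂ) := by
  have hpow : ∀ {C : Matrix ι ι ℂ} (hC : C.IsHermitian) (m : ℕ),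
      C ^ m = (hC.eigenvectorUnitary : Matrix ι ι ℂ) *
        Matrix.diagonal (fun i => ((hC.eigenvalues i ^ m : ℝ) : ℂ)) *
        (hC.eigenvectorUnitary : Matrix ι ι ℂ)ᴴ := by
    intro C hC m
    conv_lhs => rw [hC.spectral_theorem]
    rw [← map_pow, Unitary.conjStarAlgAut_apply, Matrix.diagonal_pow]
    congr 3
    ext i
    simp
  set U : Matrix ι ι ℂ := (hA.eigenvectorUnitary : Matrix ι ι ℂ)
  set W : Matrix ι ι ℂ := (hB.eigenvectorUnitary : Matrix ι ι ℂ)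
  rw [hpow hA, hpow hB]
  have h1 : (U * Matrix.diagonal (fun i => ((hA.eigenvalues i ^ k : ℝ) : ℂ)) * Uᴴ *
      (W * Matrix.diagonal (fun i => ((hB.eigenvalues i ^ l : ℝ) : ℂ)) * Wᴴ)).trace =
      (Matrix.diagonal (fun i => ((hA.eigenvalues i ^ k : ℝ) : ℂ)) * (Uᴴ * W) *
        Matrix.diagonal (fun i => ((hB.eigenvalues i ^ l : ℝ) : ℂ)) * (Uᴴ * W)ᴴ).trace := by
    rw [Matrix.conjTranspose_mul, Matrix.conjTranspose_conjTranspose, Matrix.mul_assoc U,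
      Matrix.mul_assoc U, Matrix.trace_mul_comm U]
    simp only [Matrix.mul_assoc]
  rw [h1, Matrix.trace]
  refine Finset.sum_congr rfl fun i _ => ?_
  rw [Matrix.diag_apply, Matrix.mul_apply]
  refine Finset.sum_congr rfl fun j _ => ?_
  rw [Matrix.mul_diagonal, Matrix.diagonal_mul, Matrix.conjTranspose_apply]
  have : ∀ z : ℂ, z * star z = ((‖z‖ ^ 2 : ℝ) : ℂ) := by
    intro z
    rw [mul_comm, Complex.star_def, ← Complex.normSq_eq_conj_mul_self, Complex.normSq_eq_norm_sq]
  push_cast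
  have h2 := this ((Uᴴ * W) i j)
  push_cast at h2
  linear_combination ((hA.eigenvalues i : ℂ) ^ k * (hB.eigenvalues j : ℂ) ^ l) * h2

/-- A mean value inequality for the trace. -/
theorem trace_sub_mul_pow_sub_pow_le {A B : Matrix ι ι ℂ} (hA : A.IsHermitian)
    (hB : B.IsHermitian) (q : ℕ) :
    ((A - B) * (A ^ (2 * q + 1) - B ^ (2 * q + 1))).trace.re ≤
      (2 * q + 1 : ℝ) / 2 * ((A - B) * (A - B) * (A ^ (2 * q) + B ^ (2 * q))).trace.re := by
  set g : ι → ι → ℝ := fun i j =>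
    ‖((hA.eigenvectorUnitary : Matrix ι ι ℂ)ᴴ * (hB.eigenvectorUnitary : Matrix ι ι ℂ)) i j‖ ^ 2
  set x := hA.eigenvalues
  set y := hB.eigenvalues
  have key : ∀ k l : ℕ, (A ^ k * B ^ l).trace.re = ∑ i, ∑ j, (x i ^ k * y j ^ l * g i j) := by
    intro k l
    rw [trace_pow_mul_pow hA hB k l, Complex.re_sum]
    simp only [Complex.re_sum, Complex.ofReal_re]
    rfl
  have e1 : ((A - B) * (A ^ (2 * q + 1) - B ^ (2 * q + 1))).trace.re =
      (A ^ (2 * q + 2) * B ^ 0).trace.re - (A ^ 1 * B ^ (2 * q + 1)).trace.re -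
      (A ^ (2 * q + 1) * B ^ 1).trace.re + (A ^ 0 * B ^ (2 * q + 2)).trace.re := by
    rw [Matrix.sub_mul, Matrix.mul_sub, Matrix.mul_sub, ← pow_succ', ← pow_succ',
      Matrix.trace_sub, Matrix.trace_sub, Matrix.trace_sub, Matrix.trace_mul_comm B]
    simp only [pow_zero, pow_one, mul_one, one_mul, Complex.sub_re]
    ring
  have e2 : ((A - B) * (A - B) * (A ^ (2 * q) + B ^ (2 * q))).trace.re =
      ((A ^ (2 * q + 2) * B ^ 0).trace.re - 2 * (A ^ (2 * q + 1) * B ^ 1).trace.re +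
        (A ^ (2 * q) * B ^ 2).trace.re) +
      ((A ^ 2 * B ^ (2 * q)).trace.re - 2 * (A ^ 1 * B ^ (2 * q + 1)).trace.re +
        (A ^ 0 * B ^ (2 * q + 2)).trace.re) := by
    have h1 : (A * A * A ^ (2 * q)).trace = (A ^ (2 * q + 2) * B ^ 0).trace := by
      rw [pow_zero, mul_one, ← pow_two, ← pow_add, add_comm]
    have h2 : (A * B * A ^ (2 * q)).trace = (A ^ (2 * q + 1) * B ^ 1).trace := by
      rw [pow_one, Matrix.trace_mul_cycle, ← pow_succ]
    have h3 : (B * A * A ^ (2 * q)).trace = (A ^ (2 * q + 1) * B ^ 1).trace := by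
      rw [pow_one, Matrix.mul_assoc, Matrix.trace_mul_comm, ← pow_succ']
    have h4 : (B * B * A ^ (2 * q)).trace = (A ^ (2 * q) * B ^ 2).trace := by
      rw [Matrix.trace_mul_comm, pow_two]
    have h5 : (A * A * B ^ (2 * q)).trace = (A ^ 2 * B ^ (2 * q)).trace := by rw [pow_two A]
    have h6 : (A * B * B ^ (2 * q)).trace = (A ^ 1 * B ^ (2 * q + 1)).trace := by
      rw [pow_one, Matrix.mul_assoc, ← pow_succ']
    have h7 : (B * A * B ^ (2 * q)).trace = (A ^ 1 * B ^ (2 * q + 1)).trace := by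
      rw [pow_one, Matrix.mul_assoc, Matrix.trace_mul_comm, Matrix.mul_assoc, ← pow_succ]
    have h8 : (B * B * B ^ (2 * q)).trace = (A ^ 0 * B ^ (2 * q + 2)).trace := by
      rw [pow_zero, one_mul, ← pow_two, ← pow_add, add_comm]
    rw [show (A - B) * (A - B) * (A ^ (2 * q) + B ^ (2 * q)) =
      A * A * A ^ (2 * q) - A * B * A ^ (2 * q) - B * A * A ^ (2 * q) + B * B * A ^ (2 * q) +
      (A * A * B ^ (2 * q) - A * B * B ^ (2 * q) - B * A * B ^ (2 * q) + B * B * B ^ (2 * q)) by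
        noncomm_ring]
    simp only [Matrix.trace_add, Matrix.trace_sub, h1, h2, h3, h4, h5, h6, h7, h8, Complex.add_re,
      Complex.sub_re]
    ring
  rw [e1, e2]
  simp only [key, Finset.mul_sum, ← Finset.sum_add_distrib, ← Finset.sum_sub_distrib]
  -- All traces now share the same nonnegative weights, so the scalar inequality applies to each
  -- pair of eigenvalues.
  refine Finset.sum_le_sum fun i _ => Finset.sum_le_sum fun j _ => ?_
  have h := mul_le_mul_of_nonneg_right (sub_mul_pow_sub_pow_le (x i) (y j) q)
    (show 0 ≤ g i j from sq_nonneg _)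
  calc _ = (x i - y j) * (x i ^ (2 * q + 1) - y j ^ (2 * q + 1)) * g i j := by ring
    _ ≤ _ := h
    _ = _ := by ring

/-- The rank-one matrix `v vᴴ`. -/
def outer (v : ι → ℂ) : Matrix ι ι ℂ := Matrix.vecMulVec v (star v)

theorem isHermitian_outer (v : ι → ℂ) : (outer v).IsHermitian := by
  rw [outer, Matrix.IsHermitian, Matrix.conjTranspose_vecMulVec, star_star]

theorem star_dotProduct_self (v : ι → ℂ) : star v ⬝ᵥ v = ((∑ a, ‖v a‖ ^ 2 : ℝ) : ℂ) := by
  simp only [dotProduct, Pi.star_apply]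
  push_cast
  refine Finset.sum_congr rfl fun a _ => ?_
  rw [Complex.star_def, ← Complex.normSq_eq_conj_mul_self, Complex.normSq_eq_norm_sq]
  push_cast; rfl

theorem outer_mul_outer (v : ι → ℂ) :
    outer v * outer v = ((∑ a, ‖v a‖ ^ 2 : ℝ) : ℂ) • outer v := by
  rw [outer, Matrix.vecMulVec_mul_vecMulVec, star_dotProduct_self, Matrix.vecMulVec_smul]

theorem trace_outer_mul (v : ι → ℂ) (N : Matrix ι ι ℂ) :
    (outer v * N).trace = star v ⬝ᵥ N *ᵥ v := by
  rw [outer, Matrix.vecMulVec_mul, Matrix.trace_vecMulVec, dotProduct_comm,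
    ← Matrix.dotProduct_mulVec]

theorem trace_outer_mul_sq_nonneg (v : ι → ℂ) {N : Matrix ι ι ℂ} (hN : N.IsHermitian) :
    0 ≤ (outer v * (N * N)).trace.re := by
  have : star v ⬝ᵥ (N * N) *ᵥ v = star (N *ᵥ v) ⬝ᵥ (N *ᵥ v) := by
    rw [Matrix.star_mulVec, hN, ← Matrix.dotProduct_mulVec, Matrix.mulVec_mulVec]
  rw [trace_outer_mul, this, star_dotProduct_self, Complex.ofReal_re]
  positivity

/-- With `V = v vᴴ` and `W = w wᴴ`, the left side is `‖(V - W) N‖² ≤ 2‖V N‖² + 2‖W N‖²`, and `V² =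
‖v‖² V` trades one factor `V` for `ρ`. -/
theorem trace_outer_sub_sq_mul_le {ρ : ℝ} {v w : ι → ℂ} (hv : ∑ a, ‖v a‖ ^ 2 ≤ ρ)
    (hw : ∑ a, ‖w a‖ ^ 2 ≤ ρ) {N : Matrix ι ι ℂ} (hN : N.IsHermitian) :
    ((outer v - outer w) * (outer v - outer w) * (N * N)).trace.re ≤
      2 * ρ * ((outer v * (N * N)).trace.re + (outer w * (N * N)).trace.re) := by
  have key : ∀ D : Matrix ι ι ℂ, D.IsHermitian →
      (D * D * (N * N)).trace.re = frobNorm (D * N) ^ 2 := by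
    intro D hD
    rw [frobNorm_sq, ip, Matrix.conjTranspose_mul, hD, hN, Matrix.mul_assoc N, Matrix.trace_mul_comm N]
    simp only [Matrix.mul_assoc]
  have h1 : ∀ u : ι → ℂ, ∑ a, ‖u a‖ ^ 2 ≤ ρ →
      frobNorm (outer u * N) ^ 2 ≤ ρ * (outer u * (N * N)).trace.re := by
    intro u hu
    rw [← key _ (isHermitian_outer u), outer_mul_outer, Matrix.smul_mul, Matrix.trace_smul,
      smul_eq_mul, Complex.re_ofReal_mul]
    exact mul_le_mul_of_nonneg_right hu (trace_outer_mul_sq_nonneg u hN)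
  rw [key _ ((isHermitian_outer v).sub (isHermitian_outer w)), Matrix.sub_mul]
  have h2 := frobNorm_sub_sq (outer v * N) (outer w * N)
  have h3 := frobNorm_add_sq (outer v * N) (outer w * N)
  have h4 := h1 v hv
  have h5 := h1 w hw
  nlinarith [sq_nonneg (frobNorm (outer v * N + outer w * N))]

/-- The trace splits into quadratic forms of `C` on the columns of `N`. -/
theorem trace_mul_sq_le {C : Matrix ι ι ℂ} {c : ℝ}
    (hC : ∀ x : ι → ℂ, (star x ⬝ᵥ C *ᵥ x).re ≤ c * ∑ a, ‖x a‖ ^ 2) {N : Matrix ι ι ℂ}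
    (hN : N.IsHermitian) : (C * (N * N)).trace.re ≤ c * (N * N).trace.re := by
  have h1 : (C * (N * N)).trace = ∑ a, star (N.col a) ⬝ᵥ C *ᵥ (N.col a) := by
    rw [← Matrix.mul_assoc, Matrix.trace_mul_comm, Matrix.trace]
    refine Finset.sum_congr rfl fun a _ => ?_
    rw [Matrix.diag_apply, Matrix.mul_apply]
    simp only [dotProduct, Pi.star_apply, Matrix.col_apply, Matrix.mulVec, Matrix.mul_apply]
    refine Finset.sum_congr rfl fun b _ => ?_
    rw [hN.apply]
  have h2 : (N * N).trace.re = ∑ a, ∑ b, ‖N.col a b‖ ^ 2 := by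
    have : (N * N).trace.re = ip N N := by rw [ip, hN]
    rw [this, ← frobNorm_sq, frobNorm_sq_eq_sum, Finset.sum_comm]
    rfl
  rw [h1, h2, Complex.re_sum, Finset.mul_sum]
  exact Finset.sum_le_sum fun a _ => hC _

/-- The trace of an even power is a sum of nonnegative terms `λ^(2p)`, so it controls every
eigenvalue and hence the quadratic form. -/
theorem abs_re_dotProduct_mulVec_pow_le {S : Matrix ι ι ℂ} (hS : S.IsHermitian) {p : ℕ} {δ : ℝ}
    (hδ : 0 ≤ δ) (hp : 0 < p) (h : (S ^ (2 * p)).trace.re ≤ δ ^ (2 * p)) (x : ι → ℂ) :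
    |(star x ⬝ᵥ S *ᵥ x).re| ≤ δ * ∑ a, ‖x a‖ ^ 2 := by
  have h1 : (S ^ (2 * p)).trace.re = ∑ i, hS.eigenvalues i ^ (2 * p) := by
    have h2 := trace_pow_mul_pow hS hS (2 * p) 0
    have h3 : (hS.eigenvectorUnitary : Matrix ι ι ℂ)ᴴ * (hS.eigenvectorUnitary : Matrix ι ι ℂ) = 1 :=
      Matrix.mem_unitaryGroup_iff'.1 hS.eigenvectorUnitary.2
    rw [h3, pow_zero, mul_one] at h2
    rw [h2]
    simp only [Complex.re_sum, Complex.ofReal_re]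
    refine Finset.sum_congr rfl fun i _ => ?_
    rw [Finset.sum_eq_single i]
    · simp
    · intro j _ hj
      simp [Matrix.one_apply_ne' hj]
    · simp
  have h2 : ∀ i, |hS.eigenvalues i| ≤ δ := by
    intro i
    have h3 : hS.eigenvalues i ^ (2 * p) ≤ δ ^ (2 * p) := by
      refine le_trans ?_ (h1 ▸ h)
      exact Finset.single_le_sum (f := fun i => hS.eigenvalues i ^ (2 * p))
        (fun j _ => (even_two_mul p).pow_nonneg _) (Finset.mem_univ i)
    rw [← Even.pow_abs (even_two_mul p)] at h3
    exact le_of_pow_le_pow_left₀ (by omega) hδ h3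
  set U : Matrix ι ι ℂ := (hS.eigenvectorUnitary : Matrix ι ι ℂ) with hU
  have hUU : U * Uᴴ = 1 := Matrix.mem_unitaryGroup_iff.1 hS.eigenvectorUnitary.2
  have h3 : S = U * Matrix.diagonal (fun i => ((hS.eigenvalues i : ℝ) : ℂ)) * Uᴴ := by
    conv_lhs => rw [hS.spectral_theorem]
    rw [Unitary.conjStarAlgAut_apply]
    rfl
  set y := Uᴴ *ᵥ x with hy
  have h4 : star x ⬝ᵥ S *ᵥ x =
      ((∑ i, hS.eigenvalues i * ‖y i‖ ^ 2 : ℝ) : ℂ) := by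
    have : star x ⬝ᵥ S *ᵥ x =
        star y ⬝ᵥ Matrix.diagonal (fun i => ((hS.eigenvalues i : ℝ) : ℂ)) *ᵥ y := by
      conv_lhs => rw [h3]
      rw [hy, Matrix.star_mulVec, Matrix.conjTranspose_conjTranspose, ← Matrix.dotProduct_mulVec,
        Matrix.mulVec_mulVec, Matrix.mulVec_mulVec, Matrix.mul_assoc]
    rw [this]
    simp only [dotProduct, Matrix.mulVec_diagonal, Pi.star_apply]
    push_cast
    refine Finset.sum_congr rfl fun i _ => ?_
    have h5 : star (y i) * y i = ((‖y i‖ ^ 2 : ℝ) : ℂ) := by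
      rw [Complex.star_def, ← Complex.normSq_eq_conj_mul_self, Complex.normSq_eq_norm_sq]
    push_cast at h5
    rw [← h5]; ring
  have h5 : ∑ i, ‖y i‖ ^ 2 = ∑ a, ‖x a‖ ^ 2 := by
    have : star y ⬝ᵥ y = star x ⬝ᵥ x := by
      rw [hy, Matrix.star_mulVec, Matrix.conjTranspose_conjTranspose, ← Matrix.dotProduct_mulVec,
        Matrix.mulVec_mulVec, hUU, Matrix.one_mulVec]
    rw [star_dotProduct_self, star_dotProduct_self] at this
    exact_mod_cast this
  rw [h4, Complex.ofReal_re, ← h5, Finset.mul_sum]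
  refine (Finset.abs_sum_le_sum_abs _ _).trans (Finset.sum_le_sum fun i _ => ?_)
  rw [abs_mul, abs_of_nonneg (sq_nonneg ‖y i‖)]
  exact mul_le_mul_of_nonneg_right (h2 i) (sq_nonneg _)

/-- Expand `0 ≤ ‖S^(q+1) - S^q‖²`. -/
theorem trace_pow_odd_le {S : Matrix ι ι ℂ} (hS : S.IsHermitian) (q : ℕ) :
    (S ^ (2 * q + 1)).trace.re ≤
      ((S ^ (2 * q + 2)).trace.re + (S ^ (2 * q)).trace.re) / 2 := by
  have h := ip_self_nonneg (S ^ (q + 1) - S ^ q)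
  rw [ip, ((hS.pow (q + 1)).sub (hS.pow q)).eq] at h
  have e : (S ^ (q + 1) - S ^ q) * (S ^ (q + 1) - S ^ q) =
      S ^ (2 * q + 2) - S ^ (2 * q + 1) - S ^ (2 * q + 1) + S ^ (2 * q) := by
    rw [Matrix.sub_mul, Matrix.mul_sub, Matrix.mul_sub, ← pow_add, ← pow_add, ← pow_add, ← pow_add,
      show q + 1 + (q + 1) = 2 * q + 2 by ring, show q + 1 + q = 2 * q + 1 by ring,
      show q + (q + 1) = 2 * q + 1 by ring, show q + q = 2 * q by ring]
    abel
  rw [e] at h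
  simp only [Matrix.trace_add, Matrix.trace_sub, Complex.add_re, Complex.sub_re] at h
  linarith

theorem trace_pow_even_nonneg {S : Matrix ι ι ℂ} (hS : S.IsHermitian) (q : ℕ) :
    0 ≤ (S ^ (2 * q)).trace.re := by
  have h := ip_self_nonneg (S ^ q)
  rwa [ip, (hS.pow q).eq, ← pow_add, ← two_mul] at h

end Trace

/-! ### Even trace moments of a centered sum of independent rank-one matrices -/

section Moments

variable {J ι : Type*} [Fintype J] [Fintype ι]

theorem ae_pi_of_ae {E : J → Type*} [∀ j, MeasurableSpace (E j)] (ν : ∀ j, Measure (E j))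
    [∀ j, IsProbabilityMeasure (ν j)] {p : ∀ j, E j → Prop} (h : ∀ j, ∀ᵐ x ∂ν j, p j x) :
    ∀ᵐ c ∂Measure.pi ν, ∀ j, p j (c j) :=
  ae_all_iff.2 fun j => (measurePreserving_eval ν j).quasiMeasurePreserving.ae (h j)

/-- The product law is carried by a compact ball, on which continuous functions are bounded. This
settles all integrability questions about traces of powers. -/
theorem integrable_pi_of_continuous {F : Type*} [NormedAddCommGroup F] [MeasurableSpace F]
    [BorelSpace F] [SecondCountableTopology F] {ρ : ℝ} (ν : J → Measure (ι → ℂ))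
    [∀ j, IsProbabilityMeasure (ν j)] (hν : ∀ j, ∀ᵐ x ∂ν j, ∑ a, ‖x a‖ ^ 2 ≤ ρ)
    {f : (J → ι → ℂ) → F} (hf : Continuous f) : Integrable f (Measure.pi ν) := by
  obtain ⟨B, hB⟩ := (isCompact_closedBall (0 : J → ι → ℂ) (Real.sqrt ρ)).exists_bound_of_continuousOn
    hf.continuousOn
  refine Integrable.of_bound hf.measurable.aestronglyMeasurable B ?_
  filter_upwards [ae_pi_of_ae ν hν] with c hc
  apply hB
  rw [mem_closedBall_zero_iff, pi_norm_le_iff_of_nonneg (Real.sqrt_nonneg _)]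
  intro j
  rw [pi_norm_le_iff_of_nonneg (Real.sqrt_nonneg _)]
  intro a
  refine Real.le_sqrt_of_sq_le (le_trans ?_ (hc j))
  exact Finset.single_le_sum (f := fun a => ‖c j a‖ ^ 2) (fun _ _ => by positivity)
    (Finset.mem_univ a)

theorem integral_pi_comp_perm {E : Type*} [MeasurableSpace E] (ν : J → Measure E)
    [∀ j, IsProbabilityMeasure (ν j)] (σ : Equiv.Perm J) (hσ : ∀ j, ν (σ j) = ν j)
    {f : (J → E) → ℝ} (hf : Measurable f) :
    ∫ c, f (c ∘ σ) ∂Measure.pi ν = ∫ c, f c ∂Measure.pi ν := by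
  have hm : Measurable fun c : J → E => c ∘ σ :=
    measurable_pi_lambda _ fun j => measurable_pi_apply (σ j)
  have h : Measure.pi ν = (Measure.pi ν).map fun c => c ∘ σ := by
    refine Measure.pi_eq fun s hs => ?_
    rw [Measure.map_apply hm (MeasurableSet.univ_pi hs)]
    have : (fun c : J → E => c ∘ σ) ⁻¹' (Set.univ.pi s) = Set.univ.pi fun i => s (σ.symm i) := by
      ext c
      simp only [Set.mem_preimage, Set.mem_pi, Set.mem_univ, forall_const, Function.comp]
      constructor
      · intro h i
        simpa using h (σ.symm i)
      · intro h j
        simpa using h (σ j)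
    rw [this, Measure.pi_pi, ← Equiv.prod_comp σ]
    simp [hσ]
  conv_rhs => rw [h, integral_map hm.aemeasurable hf.aestronglyMeasurable]

variable (ν : J → Measure (ι → ℂ)) [∀ j, IsProbabilityMeasure (ν j)]

/-- The law of two independent copies of the family. -/
def doubled : J ⊕ J → Measure (ι → ℂ) := Sum.elim ν ν

instance (j : J ⊕ J) : IsProbabilityMeasure (doubled ν j) := by
  rcases j with j | j <;> (simp only [doubled, Sum.elim_inl, Sum.elim_inr]; infer_instance)

theorem measurePreserving_split :
    MeasurePreserving (MeasurableEquiv.sumPiEquivProdPi fun _ : J ⊕ J => ι → ℂ)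
      (Measure.pi (doubled ν)) ((Measure.pi ν).prod (Measure.pi ν)) :=
  measurePreserving_sumPiEquivProdPi (doubled ν)

theorem integral_doubled_mul {f g : (J → ι → ℂ) → ℂ} :
    ∫ c, f (fun j => c (Sum.inl j)) * g (fun j => c (Sum.inr j)) ∂Measure.pi (doubled ν) =
      (∫ c, f c ∂Measure.pi ν) * ∫ c, g c ∂Measure.pi ν := by
  rw [← integral_prod_mul]
  exact (measurePreserving_split ν).integral_comp' fun z => f z.1 * g z.2

theorem integral_doubled_left {f : (J → ι → ℂ) → ℝ} :
    ∫ c, f (fun j => c (Sum.inl j)) ∂Measure.pi (doubled ν) = ∫ c, f c ∂Measure.pi ν := by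
  have h := (measurePreserving_split ν).integral_comp' fun z => f z.1 * 1
  have h2 := integral_prod_mul (μ := Measure.pi ν) (ν := Measure.pi ν) f (fun _ => (1 : ℝ))
  rw [h2] at h
  simp only [mul_one, integral_const, probReal_univ, smul_eq_mul] at h
  exact h

variable {ν} {ρ : ℝ}

theorem doubled_bound (hν : ∀ j, ∀ᵐ x ∂ν j, ∑ a, ‖x a‖ ^ 2 ≤ ρ) : ∀ j, ∀ᵐ x ∂doubled ν j, ∑ a, ‖x a‖ ^ 2 ≤ ρ := by
  rintro (j | j)
  · exact hν j
  · exact hν j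

/-- Integrating a factor that is independent of the rest. -/
theorem integral_trace_mul_indep (hν : ∀ j, ∀ᵐ x ∂ν j, ∑ a, ‖x a‖ ^ 2 ≤ ρ) {N : (J → ι → ℂ) → Matrix ι ι ℂ} (hN : Continuous N)
    {M : (ι → ℂ) → Matrix ι ι ℂ} (hM : Continuous M) (i : J) {D : Matrix ι ι ℂ}
    (hD : ∀ a b, ∫ x, M x a b ∂ν i = D a b) :
    ∫ c, (M (c (Sum.inr i)) * N (fun j => c (Sum.inl j))).trace.re ∂Measure.pi (doubled ν) =
      ∫ c, (D * N c).trace.re ∂Measure.pi ν := by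
  have hi : ∀ {K : Type _} [Fintype K] (ν' : K → Measure (ι → ℂ)) [∀ j, IsProbabilityMeasure (ν' j)]
      (_ : ∀ j, ∀ᵐ x ∂ν' j, ∑ a, ‖x a‖ ^ 2 ≤ ρ)
      {f : (K → ι → ℂ) → ℂ} (_ : Continuous f), Integrable f (Measure.pi ν') :=
    fun ν' _ hν' _ hf => integrable_pi_of_continuous ν' hν' hf
  have hre1 := integral_re (𝕜 := ℂ) (μ := Measure.pi (doubled ν))
    (f := fun c => (M (c (Sum.inr i)) * N (fun j => c (Sum.inl j))).trace)
    (hi _ (doubled_bound hν) (by fun_prop))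
  have hre2 := integral_re (𝕜 := ℂ) (μ := Measure.pi ν)
    (f := fun c => (D * N c).trace) (hi _ hν (by fun_prop))
  simp only [RCLike.re_to_complex] at hre1 hre2
  rw [hre1, hre2]
  congr 1
  simp only [Matrix.trace, Matrix.diag_apply, Matrix.mul_apply]
  rw [integral_finsetSum _ fun a _ => hi _ (doubled_bound hν) (by fun_prop),
    integral_finsetSum _ fun a _ => hi _ hν (by fun_prop)]
  refine Finset.sum_congr rfl fun a _ => ?_
  rw [integral_finsetSum _ fun b _ => hi _ (doubled_bound hν) (by fun_prop),
    integral_finsetSum _ fun b _ => hi _ hν (by fun_prop)]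
  refine Finset.sum_congr rfl fun b _ => ?_
  have h1 := integral_doubled_mul ν (f := fun c => N c b a) (g := fun c => M (c i) a b)
  have h2 : ∫ c, M (c i) a b ∂Measure.pi ν = D a b := by
    rw [← hD a b, ← (measurePreserving_eval ν i).map_eq, integral_map]
    · exact (measurable_pi_apply i).aemeasurable
    · have : Continuous fun x => M x a b := by fun_prop
      exact this.measurable.aestronglyMeasurable
  rw [h2] at h1
  rw [integral_const_mul, mul_comm (D a b), ← h1]
  exact integral_congr_ae (Filter.Eventually.of_forall fun c => mul_comm _ _)

/-- The centered sum `∑ᵢ (vᵢ vᵢᴴ - Cᵢ)`. -/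
def centeredSum (C : J → Matrix ι ι ℂ) (c : J → ι → ℂ) : Matrix ι ι ℂ :=
  ∑ i, (outer (c i) - C i)

theorem isHermitian_centeredSum {C : J → Matrix ι ι ℂ} (hC : ∀ i, (C i).IsHermitian)
    (c : J → ι → ℂ) : (centeredSum C c).IsHermitian := by
  classical
  rw [Matrix.IsHermitian, centeredSum, Matrix.conjTranspose_sum]
  exact Finset.sum_congr rfl fun i _ => ((isHermitian_outer _).sub (hC i)).eq

theorem continuous_outer : Continuous (outer : (ι → ℂ) → Matrix ι ι ℂ) := by
  refine continuous_matrix fun a b => ?_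
  simp only [outer, Matrix.vecMulVec_apply, Pi.star_apply]
  fun_prop

theorem continuous_centeredSum (C : J → Matrix ι ι ℂ) : Continuous (centeredSum C) := by
  unfold centeredSum
  exact continuous_finsetSum _ fun i _ =>
    (continuous_outer.comp (continuous_apply i)).sub continuous_const

theorem centeredSum_swap [DecidableEq J] (C : J → Matrix ι ι ℂ) (c : J ⊕ J → ι → ℂ) (i : J) :
    centeredSum C (fun j => c (Sum.inl j)) -
      centeredSum C (fun j => (c ∘ Equiv.swap (Sum.inl i) (Sum.inr i)) (Sum.inl j)) =
      outer (c (Sum.inl i)) - outer (c (Sum.inr i)) := by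
  rw [centeredSum, centeredSum, ← Finset.sum_sub_distrib, Finset.sum_eq_single i]
  · simp
  · intro j _ hj
    have h1 : (Sum.inl j : J ⊕ J) ≠ Sum.inl i := by simpa using hj
    have h2 : (Sum.inl j : J ⊕ J) ≠ Sum.inr i := by simp
    simp [Equiv.swap_apply_of_ne_of_ne h1 h2]
  · simp

/-- The contribution of one summand, by exchanging it with an independent copy. -/
theorem integral_trace_summand_le [DecidableEq ι] (hν : ∀ j, ∀ᵐ x ∂ν j, ∑ a, ‖x a‖ ^ 2 ≤ ρ)
    {C : J → Matrix ι ι ℂ}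
    (hH : ∀ i, (C i).IsHermitian) (hC : ∀ i a b, ∫ x, outer x a b ∂ν i = C i a b) (q : ℕ) (i : J) :
    ∫ c, ((outer (c i) - C i) * centeredSum C c ^ (2 * q + 1)).trace.re ∂Measure.pi ν ≤
      (2 * q + 1) * ρ * (∫ c, (outer (c i) * centeredSum C c ^ (2 * q)).trace.re ∂Measure.pi ν +
        ∫ c, (C i * centeredSum C c ^ (2 * q)).trace.re ∂Measure.pi ν) := by
  classical
  set π := Measure.pi (doubled ν) with hπ
  set σ : Equiv.Perm (J ⊕ J) := Equiv.swap (Sum.inl i) (Sum.inr i) with hσ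
  set S : (J ⊕ J → ι → ℂ) → Matrix ι ι ℂ := fun c => centeredSum C fun j => c (Sum.inl j) with hS
  set T : (J ⊕ J → ι → ℂ) → Matrix ι ι ℂ := fun c => outer (c (Sum.inl i)) with hT
  set T' : (J ⊕ J → ι → ℂ) → Matrix ι ι ℂ := fun c => outer (c (Sum.inr i)) with hT'
  have cS : Continuous S := (continuous_centeredSum C).comp (by fun_prop)
  have cT : Continuous T := continuous_outer.comp (by fun_prop)
  have cT' : Continuous T' := continuous_outer.comp (by fun_prop)
  have hσc : Continuous fun c : J ⊕ J → ι → ℂ => c ∘ σ :=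
    continuous_pi fun j => continuous_apply (σ j)
  have cSσ : Continuous fun c => S (c ∘ σ) := cS.comp hσc
  have hSH : ∀ c, (S c).IsHermitian := fun c => isHermitian_centeredSum hH _
  have hTσ : ∀ c, T (c ∘ σ) = T' c := fun c => by simp [hT, hT', hσ]
  have hTσ' : ∀ c, T' (c ∘ σ) = T c := fun c => by simp [hT, hT', hσ]
  have hσσ : ∀ c : J ⊕ J → ι → ℂ, (c ∘ σ) ∘ σ = c := fun c => by
    ext j; simp [hσ]
  have hdiff : ∀ c, S c - S (c ∘ σ) = T c - T' c := fun c => centeredSum_swap C c i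
  have hswap : ∀ {f : (J ⊕ J → ι → ℂ) → ℝ}, Continuous f → ∫ c, f (c ∘ σ) ∂π = ∫ c, f c ∂π :=
    fun hf => integral_pi_comp_perm (doubled ν) σ (by
      intro j
      by_cases h1 : j = Sum.inl i
      · rw [h1, hσ, Equiv.swap_apply_left]; rfl
      by_cases h2 : j = Sum.inr i
      · rw [h2, hσ, Equiv.swap_apply_right]; rfl
      rw [hσ, Equiv.swap_apply_of_ne_of_ne h1 h2]) hf.measurable
  have hint : ∀ {f : (J ⊕ J → ι → ℂ) → ℝ}, Continuous f → Integrable f π := fun hf =>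
    integrable_pi_of_continuous _ (doubled_bound hν) hf
  have hre : ∀ {f : (J ⊕ J → ι → ℂ) → Matrix ι ι ℂ}, Continuous f →
      Continuous fun c => (f c).trace.re := fun hf =>
    Complex.continuous_re.comp (hf.matrix_trace)
  -- the copy is independent of the sum
  have hzero : ∫ c, ((T' c - C i) * S c ^ (2 * q + 1)).trace.re ∂π = 0 := by
    have h := integral_trace_mul_indep hν (N := fun c => centeredSum C c ^ (2 * q + 1))
      ((continuous_centeredSum C).pow _) (M := fun x => outer x - C i)
      (continuous_outer.sub continuous_const) i (D := 0) (by
        intro a b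
        simp only [Matrix.sub_apply, Matrix.zero_apply]
        rw [integral_sub _ (integrable_const _), hC]
        · simp
        · have h1 := integrable_pi_of_continuous (J := Unit) (ρ := ρ) (fun _ => ν i) (fun _ => hν i)
            (f := fun c => outer (c ()) a b)
            ((continuous_outer.comp (continuous_apply ())).matrix_elem a b)
          have h2 : Continuous fun x : ι → ℂ => outer x a b := continuous_outer.matrix_elem a b
          have h3 := (measurePreserving_eval (fun _ : Unit => ν i) ()).integrable_comp
            (g := fun x => outer x a b) h2.measurable.aestronglyMeasurable
          exact h3.1 h1)
    rw [h]
    simp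
  have hcopy : ∫ c, (T' c * S c ^ (2 * q)).trace.re ∂π =
      ∫ c, (C i * centeredSum C c ^ (2 * q)).trace.re ∂Measure.pi ν :=
    integral_trace_mul_indep hν (N := fun c => centeredSum C c ^ (2 * q))
      ((continuous_centeredSum C).pow _) (M := outer) continuous_outer i (hC i)
  have hself : ∫ c, (T c * S c ^ (2 * q)).trace.re ∂π =
      ∫ c, (outer (c i) * centeredSum C c ^ (2 * q)).trace.re ∂Measure.pi ν :=
    integral_doubled_left ν (f := fun c => (outer (c i) * centeredSum C c ^ (2 * q)).trace.re)
  have hfirst : ∫ c, ((T c - C i) * S c ^ (2 * q + 1)).trace.re ∂π =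
      ∫ c, ((outer (c i) - C i) * centeredSum C c ^ (2 * q + 1)).trace.re ∂Measure.pi ν :=
    integral_doubled_left ν
      (f := fun c => ((outer (c i) - C i) * centeredSum C c ^ (2 * q + 1)).trace.re)
  have cA : Continuous fun c => ((T c - T' c) * S c ^ (2 * q + 1)).trace.re := hre (by fun_prop)
  have cA' : Continuous fun c => ((T c - T' c) * S (c ∘ σ) ^ (2 * q + 1)).trace.re :=
    hre (by fun_prop)
  have cB : Continuous fun c => ((T c - T' c) * (T c - T' c) * S c ^ (2 * q)).trace.re :=
    hre (by fun_prop)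
  have cB' : Continuous fun c => ((T c - T' c) * (T c - T' c) * S (c ∘ σ) ^ (2 * q)).trace.re :=
    hre (by fun_prop)
  -- By independence, the centering `C i` may be replaced by the rank-one matrix of the copy.
  have hA : ∫ c, ((T c - T' c) * S c ^ (2 * q + 1)).trace.re ∂π =
      ∫ c, ((T c - C i) * S c ^ (2 * q + 1)).trace.re ∂π := by
    have : ∀ c, ((T c - T' c) * S c ^ (2 * q + 1)).trace.re =
        ((T c - C i) * S c ^ (2 * q + 1)).trace.re -
        ((T' c - C i) * S c ^ (2 * q + 1)).trace.re := by
      intro c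
      rw [← Complex.sub_re, ← Matrix.trace_sub, ← Matrix.sub_mul]
      congr 3
      abel
    simp only [this]
    rw [integral_sub (hint (hre (by fun_prop))) (hint (hre (by fun_prop))), hzero, sub_zero]
  -- The exchange preserves the law, maps `S` to its modified version and reverses the sign of `T -
  -- T'`.
  have hA' : ∫ c, ((T c - T' c) * S (c ∘ σ) ^ (2 * q + 1)).trace.re ∂π =
      -∫ c, ((T c - T' c) * S c ^ (2 * q + 1)).trace.re ∂π := by
    rw [← hswap cA', ← integral_neg]
    refine integral_congr_ae (Filter.Eventually.of_forall fun c => ?_)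
    simp only [hσσ, hTσ, hTσ']
    rw [← Complex.neg_re, ← Matrix.trace_neg, ← Matrix.neg_mul, neg_sub]
  have hB' : ∫ c, ((T c - T' c) * (T c - T' c) * S (c ∘ σ) ^ (2 * q)).trace.re ∂π =
      ∫ c, ((T c - T' c) * (T c - T' c) * S c ^ (2 * q)).trace.re ∂π := by
    rw [← hswap cB']
    refine integral_congr_ae (Filter.Eventually.of_forall fun c => ?_)
    simp only [hσσ, hTσ, hTσ']
    rw [← neg_sub (T c) (T' c), Matrix.neg_mul, Matrix.mul_neg, neg_neg]
  -- The left side is twice the wanted integral. The mean value inequality applies because the two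
  -- sums differ by exactly `T - T'`.
  have hmv : ∫ c, (((T c - T' c) * S c ^ (2 * q + 1)).trace.re -
      ((T c - T' c) * S (c ∘ σ) ^ (2 * q + 1)).trace.re) ∂π ≤
      ∫ c, (2 * q + 1 : ℝ) / 2 * (((T c - T' c) * (T c - T' c) * S c ^ (2 * q)).trace.re +
        ((T c - T' c) * (T c - T' c) * S (c ∘ σ) ^ (2 * q)).trace.re) ∂π := by
    refine integral_mono ((hint cA).sub (hint cA')) (((hint cB).add (hint cB')).const_mul _) ?_
    intro c
    have h := trace_sub_mul_pow_sub_pow_le (hSH c) (hSH (c ∘ σ)) q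
    rw [hdiff, Matrix.mul_sub, Matrix.mul_add, Matrix.trace_sub, Matrix.trace_add, Complex.sub_re,
      Complex.add_re] at h
    exact h
  rw [integral_sub (hint cA) (hint cA'), integral_const_mul, integral_add (hint cB) (hint cB'),
    hA', hB', hA, hfirst] at hmv
  have hsq : ∫ c, ((T c - T' c) * (T c - T' c) * S c ^ (2 * q)).trace.re ∂π ≤
      2 * ρ * (∫ c, (outer (c i) * centeredSum C c ^ (2 * q)).trace.re ∂Measure.pi ν +
        ∫ c, (C i * centeredSum C c ^ (2 * q)).trace.re ∂Measure.pi ν) := by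
    rw [← hself, ← hcopy, ← integral_add (hint (hre (by fun_prop))) (hint (hre (by fun_prop))),
      ← integral_const_mul]
    refine integral_mono_ae (hint cB)
      (((hint (hre (by fun_prop))).add (hint (hre (by fun_prop)))).const_mul _) ?_
    filter_upwards [ae_pi_of_ae _ (doubled_bound hν)] with c hc
    have h := trace_outer_sub_sq_mul_le (hc (Sum.inl i)) (hc (Sum.inr i)) ((hSH c).pow q)
    rw [← pow_add, ← two_mul] at h
    exact h
  have hq : (0 : ℝ) ≤ 2 * q + 1 := by positivity
  nlinarith

/-- Sum the exchange estimate over the summands. As `∑ vᵢ vᵢᴴ = S + ∑ Cᵢ`, the first traces give an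
odd moment of `S` plus one term in `∑ Cᵢ`, and the second traces give that term again; this is the
source of `2 B`. -/
theorem integral_trace_pow_add_two_le [DecidableEq ι]
    (hν : ∀ j, ∀ᵐ x ∂ν j, ∑ a, ‖x a‖ ^ 2 ≤ ρ) (hρ : 0 ≤ ρ) {C : J → Matrix ι ι ℂ}
    (hH : ∀ i, (C i).IsHermitian) (hC : ∀ i a b, ∫ x, outer x a b ∂ν i = C i a b) {B : ℝ}
    (hB : ∀ x : ι → ℂ, (star x ⬝ᵥ (∑ i, C i) *ᵥ x).re ≤ B * ∑ a, ‖x a‖ ^ 2) (q : ℕ) :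
    ∫ c, (centeredSum C c ^ (2 * q + 2)).trace.re ∂Measure.pi ν ≤
      (2 * q + 1) * ρ * (∫ c, (centeredSum C c ^ (2 * q + 1)).trace.re ∂Measure.pi ν +
        2 * B * ∫ c, (centeredSum C c ^ (2 * q)).trace.re ∂Measure.pi ν) := by
  have cS : Continuous (centeredSum C) := continuous_centeredSum C
  have hint : ∀ {f : (J → ι → ℂ) → ℝ}, Continuous f → Integrable f (Measure.pi ν) := fun hf =>
    integrable_pi_of_continuous _ hν hf
  have hre : ∀ {f : (J → ι → ℂ) → Matrix ι ι ℂ}, Continuous f →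
      Continuous fun c => (f c).trace.re := fun hf =>
    Complex.continuous_re.comp (hf.matrix_trace)
  have cO : ∀ i : J, Continuous fun c : J → ι → ℂ => outer (c i) := fun i =>
    continuous_outer.comp (continuous_apply i)
  have c1 : ∀ i, Continuous fun c : J → ι → ℂ =>
      ((outer (c i) - C i) * centeredSum C c ^ (2 * q + 1)).trace.re :=
    fun i => hre (((cO i).sub continuous_const).mul (cS.pow _))
  have c2 : ∀ i, Continuous fun c : J → ι → ℂ =>
      (outer (c i) * centeredSum C c ^ (2 * q)).trace.re := fun i => hre ((cO i).mul (cS.pow _))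
  have c3 : ∀ i, Continuous fun c : J → ι → ℂ =>
      (C i * centeredSum C c ^ (2 * q)).trace.re := fun i => hre (continuous_const.mul (cS.pow _))
  have c4 : ∀ k, Continuous fun c : J → ι → ℂ => (centeredSum C c ^ k).trace.re :=
    fun k => hre (cS.pow k)
  have h1 : ∫ c, (centeredSum C c ^ (2 * q + 2)).trace.re ∂Measure.pi ν =
      ∑ i, ∫ c, ((outer (c i) - C i) * centeredSum C c ^ (2 * q + 1)).trace.re ∂Measure.pi ν := by
    rw [← integral_finsetSum _ fun i _ => hint (c1 i)]
    refine integral_congr_ae (Filter.Eventually.of_forall fun c => ?_)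
    simp only
    rw [← Complex.re_sum, ← Matrix.trace_sum, ← Matrix.sum_mul, pow_succ']
    rfl
  have h2 := Finset.sum_le_sum fun i (_ : i ∈ Finset.univ) =>
    integral_trace_summand_le hν hH hC q i
  rw [← h1, ← Finset.mul_sum, Finset.sum_add_distrib,
    ← integral_finsetSum _ fun i _ => hint (c2 i), ← integral_finsetSum _ fun i _ => hint (c3 i),
    ← integral_add (hint (continuous_finsetSum _ fun i _ => c2 i))
      (hint (continuous_finsetSum _ fun i _ => c3 i))] at h2
  refine h2.trans (mul_le_mul_of_nonneg_left ?_ (by positivity))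
  rw [← integral_const_mul, ← integral_add (hint (c4 _)) ((hint (c4 _)).const_mul _)]
  refine integral_mono (hint ?_) ((hint (c4 _)).add ((hint (c4 _)).const_mul _)) fun c => ?_
  · exact (continuous_finsetSum _ fun i _ => c2 i).add (continuous_finsetSum _ fun i _ => c3 i)
  simp only
  have h3 := trace_mul_sq_le hB ((isHermitian_centeredSum hH c).pow q)
  rw [← pow_add, ← two_mul] at h3
  have h4 : ∑ i, (outer (c i) * centeredSum C c ^ (2 * q)).trace.re =
      (centeredSum C c ^ (2 * q + 1)).trace.re +
      ((∑ i, C i) * centeredSum C c ^ (2 * q)).trace.re := by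
    rw [pow_succ', ← Complex.re_sum, ← Matrix.trace_sum, ← Matrix.sum_mul, ← Complex.add_re,
      ← Matrix.trace_add, ← Matrix.add_mul]
    congr 3
    rw [centeredSum, Finset.sum_sub_distrib, sub_add_cancel]
  have h5 : ∑ i, (C i * centeredSum C c ^ (2 * q)).trace.re =
      ((∑ i, C i) * centeredSum C c ^ (2 * q)).trace.re := by
    rw [← Complex.re_sum, ← Matrix.trace_sum, ← Matrix.sum_mul]
  rw [h4, h5]
  linarith

/-- Even trace moments of a centered sum of independent rank-one matrices. -/
theorem integral_trace_pow_le [DecidableEq ι]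
    (hν : ∀ j, ∀ᵐ x ∂ν j, ∑ a, ‖x a‖ ^ 2 ≤ ρ) (hρ : 0 ≤ ρ) {C : J → Matrix ι ι ℂ}
    (hH : ∀ i, (C i).IsHermitian) (hC : ∀ i a b, ∫ x, outer x a b ∂ν i = C i a b)
    (hB : ∀ x : ι → ℂ, (star x ⬝ᵥ (∑ i, C i) *ᵥ x).re ≤ 2 * ∑ a, ‖x a‖ ^ 2) (m : ℕ)
    (hm : 2 * m * ρ ≤ 1) (p : ℕ) (hp : p ≤ m) :
    ∫ c, (centeredSum C c ^ (2 * p)).trace.re ∂Measure.pi ν ≤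
      Fintype.card ι * (18 * m * ρ) ^ p := by
  have cS : Continuous (centeredSum C) := continuous_centeredSum C
  have hint : ∀ k, Integrable (fun c => (centeredSum C c ^ k).trace.re) (Measure.pi ν) := fun k =>
    integrable_pi_of_continuous _ hν (Complex.continuous_re.comp (cS.pow k).matrix_trace)
  induction p with
  | zero => simp
  | succ q ih =>
    have ih := ih (by omega)
    have h1 := integral_trace_pow_add_two_le hν hρ hH hC hB q
    have h2 : ∫ c, (centeredSum C c ^ (2 * q + 1)).trace.re ∂Measure.pi ν ≤
        (∫ c, (centeredSum C c ^ (2 * q + 2)).trace.re ∂Measure.pi ν +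
          ∫ c, (centeredSum C c ^ (2 * q)).trace.re ∂Measure.pi ν) / 2 := by
      rw [← integral_add (hint _) (hint _), ← integral_div]
      exact integral_mono (hint _) (((hint _).add (hint _)).div_const _) fun c =>
        trace_pow_odd_le (isHermitian_centeredSum hH c) q
    set x := ∫ c, (centeredSum C c ^ (2 * q + 2)).trace.re ∂Measure.pi ν
    set y := ∫ c, (centeredSum C c ^ (2 * q)).trace.re ∂Measure.pi ν
    have hx : 0 ≤ x := by
      refine integral_nonneg fun c => ?_
      exact trace_pow_even_nonneg (isHermitian_centeredSum hH c) (q + 1)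
    have hy : 0 ≤ y := by
      refine integral_nonneg fun c => ?_
      exact trace_pow_even_nonneg (isHermitian_centeredSum hH c) q
    have hq : (2 * q + 1 : ℝ) ≤ 2 * m := by
      have : (q : ℝ) + 1 ≤ m := by exact_mod_cast hp
      linarith
    have hq0 : (0 : ℝ) ≤ 2 * q + 1 := by positivity
    have h3 : (2 * q + 1) * ρ ≤ 2 * m * ρ := mul_le_mul_of_nonneg_right hq hρ
    -- Here `B = 2`, and the odd moment is at most `(x + y)/2`: together `x/2 + (1/2 + 4) y`.
    have h4 : x ≤ (2 * q + 1) * ρ * (x / 2 + 9 / 2 * y) := by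
      refine h1.trans (mul_le_mul_of_nonneg_left ?_ (mul_nonneg hq0 hρ))
      linarith
    have h5 : x ≤ (2 * m * ρ) * (x / 2 + 9 / 2 * y) :=
      h4.trans (mul_le_mul_of_nonneg_right h3 (by positivity))
    -- Because `2 m ρ ≤ 1`, the `x` term on the right is at most `x/2` and is absorbed.
    have h6 : x ≤ 18 * m * ρ * y := by
      nlinarith [mul_le_mul_of_nonneg_right hm hx]
    have h7 : (0 : ℝ) ≤ 18 * m * ρ := by positivity
    calc x ≤ 18 * m * ρ * y := h6
      _ ≤ 18 * m * ρ * (Fintype.card ι * (18 * m * ρ) ^ q) := mul_le_mul_of_nonneg_left ih h7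
      _ = _ := by ring

end Moments

/-! ### Concentration of the sensing operator on a parametrized subspace -/

section Isometry

variable {Ω : Type*} [MeasurableSpace Ω] {P : Measure Ω} [IsProbabilityMeasure P] {s n : ℕ}
  {μ₀ : ℝ} {b : Fin n → Ω → Fin s → ℂ}

theorem SubspaceModel.measurable_apply (hb : SubspaceModel P μ₀ b) (i : Fin n) (a : Fin s) :
    Measurable fun ω => b i ω a := (measurable_pi_apply a).comp (hb.measurable i)

theorem SubspaceModel.integrable_mul_star (hb : SubspaceModel P μ₀ b) (i : Fin n) (a c : Fin s) :
    Integrable (fun ω => b i ω a * star (b i ω c)) P := by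
  have hm : Measurable fun ω => b i ω a * star (b i ω c) :=
    (hb.measurable_apply i a).mul (continuous_star.measurable.comp (hb.measurable_apply i c))
  refine Integrable.of_bound hm.aestronglyMeasurable μ₀ ?_
  filter_upwards [hb.bounded i] with ω hω
  rw [norm_mul, norm_star]
  nlinarith [hω a, hω c, sq_nonneg (‖b i ω a‖ - ‖b i ω c‖)]

variable {ι : Type*} [Fintype ι] [DecidableEq ι]

/-- The vector representing the functional `x ↦ βᴴ (K x) eᵢ`. -/
def measVec (K : (ι → ℂ) →ₗ[ℂ] Matrix (Fin s) (Fin n) ℂ) (i : Fin n) (β : Fin s → ℂ) : ι → ℂ :=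
  fun e => ∑ a, β a * star (K (Pi.single e 1) a i)

theorem apply_eq_sum_single (K : (ι → ℂ) →ₗ[ℂ] Matrix (Fin s) (Fin n) ℂ) (x : ι → ℂ) (a : Fin s)
    (i : Fin n) : K x a i = ∑ e, x e * K (Pi.single e 1) a i := by
  conv_lhs => rw [LinearMap.pi_apply_eq_sum_univ K x]
  rw [Matrix.sum_apply]
  refine Finset.sum_congr rfl fun e _ => ?_
  have h : (fun j => if e = j then (1 : ℂ) else 0) = Pi.single e 1 := by
    ext j
    simp [Pi.single_apply, eq_comm]
  rw [Matrix.smul_apply, smul_eq_mul, h]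

theorem star_measVec_dotProduct (K : (ι → ℂ) →ₗ[ℂ] Matrix (Fin s) (Fin n) ℂ)
    (β : Fin n → Fin s → ℂ) (i : Fin n) (x : ι → ℂ) :
    star (measVec K i (β i)) ⬝ᵥ x = sense β (K x) i := by
  simp only [sense, apply_eq_sum_single K x, dotProduct, measVec, Pi.star_apply, star_sum,
    star_mul', star_star, Finset.mul_sum, Finset.sum_mul]
  rw [Finset.sum_comm]
  exact Finset.sum_congr rfl fun a _ => Finset.sum_congr rfl fun e _ => by ring

theorem continuous_measVec (K : (ι → ℂ) →ₗ[ℂ] Matrix (Fin s) (Fin n) ℂ) (i : Fin n) :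
    Continuous (measVec K i) := by
  unfold measVec; fun_prop

theorem dotProduct_outer_mulVec (v x : ι → ℂ) :
    star x ⬝ᵥ outer v *ᵥ x = ((‖star v ⬝ᵥ x‖ ^ 2 : ℝ) : ℂ) := by
  have h : star x ⬝ᵥ outer v *ᵥ x = star (star v ⬝ᵥ x) * (star v ⬝ᵥ x) := by
    rw [outer, Matrix.vecMulVec_mulVec, dotProduct_smul, Matrix.star_dotProduct, star_star,
      op_smul_eq_smul, smul_eq_mul, mul_comm]
  rw [h, Complex.star_def, ← Complex.normSq_eq_conj_mul_self, Complex.normSq_eq_norm_sq]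

/-- The second moment matrix of `measVec`. -/
def measCov (K : (ι → ℂ) →ₗ[ℂ] Matrix (Fin s) (Fin n) ℂ) (i : Fin n) : Matrix ι ι ℂ :=
  Matrix.of fun e e' => ∑ a, star (K (Pi.single e 1) a i) * K (Pi.single e' 1) a i

theorem isHermitian_measCov (K : (ι → ℂ) →ₗ[ℂ] Matrix (Fin s) (Fin n) ℂ) (i : Fin n) :
    (measCov K i).IsHermitian := by
  ext e e'
  simp only [Matrix.conjTranspose_apply, measCov, Matrix.of_apply, star_sum, star_mul', star_star]
  exact Finset.sum_congr rfl fun a _ => mul_comm _ _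

theorem dotProduct_measCov_mulVec (K : (ι → ℂ) →ₗ[ℂ] Matrix (Fin s) (Fin n) ℂ) (i : Fin n)
    (x : ι → ℂ) : star x ⬝ᵥ measCov K i *ᵥ x = ((∑ a, ‖K x a i‖ ^ 2 : ℝ) : ℂ) := by
  have h : ∀ a, ((‖K x a i‖ ^ 2 : ℝ) : ℂ) =
      ∑ e, ∑ e', star (x e) * (star (K (Pi.single e 1) a i) * K (Pi.single e' 1) a i * x e') := by
    intro a
    rw [← Complex.normSq_eq_norm_sq, Complex.normSq_eq_conj_mul_self, ← Complex.star_def,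
      apply_eq_sum_single K x, star_sum, Finset.sum_mul_sum]
    refine Finset.sum_congr rfl fun e _ => Finset.sum_congr rfl fun e' _ => ?_
    rw [star_mul']; ring
  rw [Complex.ofReal_sum, Finset.sum_congr rfl fun a _ => h a]
  simp only [dotProduct, Matrix.mulVec, measCov, Matrix.of_apply, Pi.star_apply, Finset.mul_sum,
    Finset.sum_mul]
  rw [Finset.sum_comm]
  rw [Finset.sum_comm (s := (Finset.univ : Finset (Fin s)))]
  rw [Finset.sum_comm]
  refine Finset.sum_congr rfl fun e _ => ?_
  rw [Finset.sum_comm]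

theorem sum_dotProduct_measCov_mulVec (K : (ι → ℂ) →ₗ[ℂ] Matrix (Fin s) (Fin n) ℂ) (x : ι → ℂ) :
    star x ⬝ᵥ (∑ i, measCov K i) *ᵥ x = ((frobNorm (K x) ^ 2 : ℝ) : ℂ) := by
  rw [Matrix.sum_mulVec, dotProduct_sum, frobNorm_sq_eq_sum, Finset.sum_comm]
  simp only [dotProduct_measCov_mulVec, ← Complex.ofReal_sum]

theorem integral_outer_measVec (hb : SubspaceModel P μ₀ b)
    (K : (ι → ℂ) →ₗ[ℂ] Matrix (Fin s) (Fin n) ℂ) (i : Fin n) (e e' : ι) :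
    ∫ ω, outer (measVec K i (b i ω)) e e' ∂P = measCov K i e e' := by
  have h : ∀ ω, outer (measVec K i (b i ω)) e e' = ∑ a, ∑ c, star (K (Pi.single e 1) a i) *
      K (Pi.single e' 1) c i * (b i ω a * star (b i ω c)) := by
    intro ω
    simp only [outer, Matrix.vecMulVec_apply, Pi.star_apply, measVec, star_sum, Finset.sum_mul_sum]
    refine Finset.sum_congr rfl fun a _ => Finset.sum_congr rfl fun c _ => ?_
    rw [star_mul', star_star]; ring
  simp only [h]
  rw [integral_finsetSum _ fun a _ => integrable_finsetSum _ fun c _ =>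
    (hb.integrable_mul_star i a c).const_mul _]
  simp only [measCov, Matrix.of_apply]
  refine Finset.sum_congr rfl fun a _ => ?_
  rw [integral_finsetSum _ fun c _ => (hb.integrable_mul_star i a c).const_mul _,
    Finset.sum_eq_single a]
  · rw [integral_const_mul, hb.isotropic, Matrix.one_apply_eq, mul_one]
  · intro c _ hc
    rw [integral_const_mul, hb.isotropic, Matrix.one_apply_ne' hc, mul_zero]
  · simp

/-- Test the functional on its own representing vector, then divide by the squared norm unless that
is zero. -/
theorem sum_norm_measVec_sq_le {K : (ι → ℂ) →ₗ[ℂ] Matrix (Fin s) (Fin n) ℂ} {ρ : ℝ} (hρ : 0 ≤ ρ)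
    (hK : ∀ β : Fin n → Fin s → ℂ, (∀ i a, ‖β i a‖ ^ 2 ≤ μ₀) →
      ∀ x i, ‖sense β (K x) i‖ ^ 2 ≤ ρ * ∑ e, ‖x e‖ ^ 2) (i : Fin n) {β : Fin s → ℂ}
    (hβ : ∀ a, ‖β a‖ ^ 2 ≤ μ₀) : ∑ e, ‖measVec K i β e‖ ^ 2 ≤ ρ := by
  have h := hK (fun _ => β) (fun _ => hβ) (measVec K i β) i
  rw [← star_measVec_dotProduct, star_dotProduct_self, Complex.norm_real, Real.norm_eq_abs,
    sq_abs] at h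
  rcases (show 0 ≤ ∑ e, ‖measVec K i β e‖ ^ 2 by positivity).eq_or_lt with h0 | h0
  · rw [← h0]; exact hρ
  · rw [pow_two] at h
    exact le_of_mul_le_mul_right h h0

/-- Tail bound for the deviation of the sensing operator from an isometry on the range of `K`. -/
theorem measureReal_not_nearIsometry_le (hb : SubspaceModel P μ₀ b)
    (K : (ι → ℂ) →ₗ[ℂ] Matrix (Fin s) (Fin n) ℂ) {ρ : ℝ} (hρ : 0 ≤ ρ)
    (hK : ∀ β : Fin n → Fin s → ℂ, (∀ i a, ‖β i a‖ ^ 2 ≤ μ₀) →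
      ∀ x i, ‖sense β (K x) i‖ ^ 2 ≤ ρ * ∑ e, ‖x e‖ ^ 2)
    (hK2 : ∀ x, frobNorm (K x) ^ 2 ≤ 2 * ∑ e, ‖x e‖ ^ 2) {δ : ℝ} (hδ : 0 < δ) {m : ℕ} (hm : 0 < m)
    (hmρ : 2 * m * ρ ≤ 1) :
    P.real {ω | ¬ ∀ x, |∑ i, ‖sense (fun i => b i ω) (K x) i‖ ^ 2 - frobNorm (K x) ^ 2| ≤
      δ * ∑ e, ‖x e‖ ^ 2} ≤ Fintype.card ι * (18 * m * ρ / δ ^ 2) ^ m := by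
  set v : Fin n → Ω → ι → ℂ := fun i ω => measVec K i (b i ω) with hv
  have hvm : ∀ i, Measurable (v i) := fun i =>
    (continuous_measVec K i).measurable.comp (hb.measurable i)
  set ν : Fin n → Measure (ι → ℂ) := fun i => P.map (v i) with hν
  have : ∀ i, IsProbabilityMeasure (ν i) := fun i =>
    Measure.isProbabilityMeasure_map (hvm i).aemeasurable
  have hνb : ∀ i, ∀ᵐ x ∂ν i, ∑ a, ‖x a‖ ^ 2 ≤ ρ := by
    intro i
    rw [hν, ae_map_iff (hvm i).aemeasurable (measurableSet_le (by fun_prop) measurable_const)]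
    filter_upwards [hb.bounded i] with ω hω
    exact sum_norm_measVec_sq_le hρ hK i hω
  have hC : ∀ i a c, ∫ x, outer x a c ∂ν i = measCov K i a c := by
    intro i a c
    rw [← integral_outer_measVec hb, hν, integral_map (hvm i).aemeasurable]
    exact (continuous_outer.matrix_elem a c).measurable.aestronglyMeasurable
  have hB : ∀ x : ι → ℂ, (star x ⬝ᵥ (∑ i, measCov K i) *ᵥ x).re ≤ 2 * ∑ a, ‖x a‖ ^ 2 := by
    intro x
    rw [sum_dotProduct_measCov_mulVec, Complex.ofReal_re]
    exact hK2 x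
  have hmom := integral_trace_pow_le hνb hρ (fun i => isHermitian_measCov K i) hC hB m hmρ m le_rfl
  have hind : iIndepFun v P := hb.indep.comp (fun i => measVec K i)
    fun i => (continuous_measVec K i).measurable
  have hlaw : P.map (fun ω i => v i ω) = Measure.pi ν :=
    (iIndepFun_iff_map_fun_eq_pi_map fun i => (hvm i).aemeasurable).1 hind
  set S : Ω → Matrix ι ι ℂ := fun ω => centeredSum (measCov K) fun i => v i ω with hS
  have hSH : ∀ ω, (S ω).IsHermitian := fun ω =>
    isHermitian_centeredSum (fun i => isHermitian_measCov K i) _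
  have hcont : Continuous fun c : Fin n → ι → ℂ =>
      (centeredSum (measCov K) c ^ (2 * m)).trace.re :=
    Complex.continuous_re.comp ((continuous_centeredSum (measCov K)).pow _).matrix_trace
  have hvm' : Measurable fun ω i => v i ω := measurable_pi_lambda _ hvm
  have hintP : Integrable (fun ω => (S ω ^ (2 * m)).trace.re) P := by
    have h := integrable_pi_of_continuous ν hνb hcont
    rw [← hlaw] at h
    exact h.comp_measurable hvm'
  have hmomP : ∫ ω, (S ω ^ (2 * m)).trace.re ∂P ≤ Fintype.card ι * (18 * m * ρ) ^ m := by
    rw [← hlaw, integral_map hvm'.aemeasurable hcont.measurable.aestronglyMeasurable] at hmom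
    exact hmom
  -- Markov's inequality for the trace of the `2m`-th power; outside this event every eigenvalue of
  -- `S` is at most `δ` in absolute value.
  have hmarkov := mul_meas_ge_le_integral_of_nonneg
    (Filter.Eventually.of_forall fun ω => trace_pow_even_nonneg (hSH ω) m) hintP (δ ^ (2 * m))
  have hquad : ∀ ω x, (star x ⬝ᵥ S ω *ᵥ x).re =
      ∑ i, ‖sense (fun i => b i ω) (K x) i‖ ^ 2 - frobNorm (K x) ^ 2 := by
    intro ω x
    have h1 : S ω = ∑ i, outer (v i ω) - ∑ i, measCov K i := by
      simp only [hS, centeredSum, Finset.sum_sub_distrib]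
    rw [h1, Matrix.sub_mulVec, dotProduct_sub, sum_dotProduct_measCov_mulVec, Matrix.sum_mulVec,
      dotProduct_sum, Complex.sub_re, Complex.re_sum, Complex.ofReal_re]
    congr 1
    refine Finset.sum_congr rfl fun i _ => ?_
    rw [dotProduct_outer_mulVec, Complex.ofReal_re, hv,
      star_measVec_dotProduct K (fun i => b i ω) i x]
  have hsub : {ω | ¬ ∀ x, |∑ i, ‖sense (fun i => b i ω) (K x) i‖ ^ 2 - frobNorm (K x) ^ 2| ≤
      δ * ∑ e, ‖x e‖ ^ 2} ⊆ {ω | δ ^ (2 * m) ≤ (S ω ^ (2 * m)).trace.re} := by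
    intro ω hω
    by_contra hlt
    refine hω fun x => ?_
    rw [← hquad ω x]
    exact abs_re_dotProduct_mulVec_pow_le (hSH ω) hδ.le hm (not_le.1 hlt).le x
  have hmono := measureReal_mono (μ := P) hsub
  have hδm : 0 < δ ^ (2 * m) := by positivity
  refine hmono.trans ?_
  rw [div_pow, ← pow_mul, ← mul_div_assoc, le_div_iff₀ hδm, mul_comm]
  exact hmarkov.trans hmomP

end Isometry

/-! ### A scalar Bernstein inequality, and the error of the spectral initialization -/

section Bernstein

variable {Ω : Type*} [MeasurableSpace Ω] {P : Measure Ω} [IsProbabilityMeasure P]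

theorem exp_le_one_add_sq {x : ℝ} (hx : |x| ≤ 1) : Real.exp x ≤ 1 + x + x ^ 2 := by
  have h := Real.abs_exp_sub_one_sub_id_le hx
  have := abs_le.1 h
  linarith

/-- Use `e^x ≤ 1 + x + x²` on `|x| ≤ 1`. Centering at most doubles the range, hence `2 * B`, and
does not increase the second moment. -/
theorem mgf_centered_le {h : Ω → ℝ} (hm : Measurable h) {B V lam : ℝ} (hlam : 0 ≤ lam)
    (hB : ∀ᵐ ω ∂P, |h ω| ≤ B) (hV : ∫ ω, h ω ^ 2 ∂P ≤ V) (hlB : lam * (2 * B) ≤ 1) :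
    mgf (fun ω => h ω - ∫ ω', h ω' ∂P) P lam ≤ Real.exp (lam ^ 2 * V) := by
  set e := ∫ ω', h ω' ∂P with he
  have hB' : |e| ≤ B := by
    have := norm_integral_le_of_norm_le_const (μ := P) (f := h) hB
    simpa using this
  have hint : Integrable h P := Integrable.of_bound hm.aestronglyMeasurable B hB
  have hint2 : Integrable (fun ω => h ω ^ 2) P := by
    refine Integrable.of_bound (hm.pow_const 2).aestronglyMeasurable (B ^ 2) ?_
    filter_upwards [hB] with ω hω
    rw [norm_pow, Real.norm_eq_abs]
    exact pow_le_pow_left₀ (abs_nonneg _) hω 2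
  have hc : ∫ ω, (h ω - e) ∂P = 0 := by
    rw [integral_sub hint (integrable_const _)]; simp [he]
  have hc2 : ∫ ω, (h ω - e) ^ 2 ∂P ≤ V := by
    have h1 : ∀ ω, (h ω - e) ^ 2 = h ω ^ 2 - 2 * e * h ω + e ^ 2 := fun ω => by ring
    simp only [h1]
    have h2 : Integrable (fun ω => h ω ^ 2 - 2 * e * h ω) P := hint2.sub (hint.const_mul _)
    rw [integral_add h2 (integrable_const _),
      integral_sub hint2 (hint.const_mul _), integral_const_mul, ← he]
    simp only [integral_const, probReal_univ, smul_eq_mul, one_mul]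
    nlinarith [sq_nonneg e]
  have hint3 : Integrable (fun ω => h ω - e) P := hint.sub (integrable_const _)
  have hint4 : Integrable (fun ω => (h ω - e) ^ 2) P := by
    have h1 : (fun ω => (h ω - e) ^ 2) = fun ω => h ω ^ 2 - 2 * e * h ω + e ^ 2 := by
      ext ω; ring
    rw [h1]
    exact (hint2.sub (hint.const_mul _)).add (integrable_const _)
  have hbd : ∀ᵐ ω ∂P, |lam * (h ω - e)| ≤ 1 := by
    filter_upwards [hB] with ω hω
    rw [abs_mul, abs_of_nonneg hlam]
    refine le_trans (mul_le_mul_of_nonneg_left ?_ hlam) hlB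
    exact (abs_sub _ _).trans (by linarith)
  have hintexp : Integrable (fun ω => Real.exp (lam * (h ω - e))) P := by
    refine Integrable.of_bound
      (((hm.sub_const e).const_mul lam).exp).aestronglyMeasurable (Real.exp 1) ?_
    filter_upwards [hbd] with ω hω
    rw [Real.norm_eq_abs, Real.abs_exp]
    exact Real.exp_le_exp.2 (abs_le.1 hω).2
  calc mgf (fun ω => h ω - e) P lam = ∫ ω, Real.exp (lam * (h ω - e)) ∂P := rfl
    _ ≤ ∫ ω, (1 + lam * (h ω - e) + lam ^ 2 * (h ω - e) ^ 2) ∂P := by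
        refine integral_mono_ae hintexp
          (((integrable_const _).add (hint3.const_mul _)).add (hint4.const_mul _)) ?_
        filter_upwards [hbd] with ω hω
        have := exp_le_one_add_sq hω
        simpa [mul_pow] using this
    _ = 1 + lam ^ 2 * ∫ ω, (h ω - e) ^ 2 ∂P := by
        have h2 : Integrable (fun ω => 1 + lam * (h ω - e)) P :=
          (integrable_const _).add (hint3.const_mul _)
        rw [integral_add h2 (hint4.const_mul _),
          integral_add (integrable_const _) (hint3.const_mul _), integral_const_mul,
          integral_const_mul, hc]
        simp
    _ ≤ 1 + lam ^ 2 * V := by gcongr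
    _ ≤ Real.exp (lam ^ 2 * V) := by linarith [Real.add_one_le_exp (lam ^ 2 * V)]

/-- Bernstein's inequality for bounded independent variables, with a free parameter. -/
theorem measureReal_sum_centered_ge_le {J : Type*} [Fintype J] {h : J → Ω → ℝ}
    (hm : ∀ i, Measurable (h i)) (hind : iIndepFun h P) {B lam t : ℝ} {V : J → ℝ}
    (hlam : 0 ≤ lam) (hB : ∀ i, ∀ᵐ ω ∂P, |h i ω| ≤ B) (hV : ∀ i, ∫ ω, h i ω ^ 2 ∂P ≤ V i)
    (hlB : lam * (2 * B) ≤ 1) :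
    P.real {ω | t ≤ ∑ i, (h i ω - ∫ ω', h i ω' ∂P)} ≤
      Real.exp (-(lam * t) + lam ^ 2 * ∑ i, V i) := by
  set f : J → Ω → ℝ := fun i ω => h i ω - ∫ ω', h i ω' ∂P with hf
  have hfm : ∀ i, Measurable (f i) := fun i => (hm i).sub_const _
  have hfind : iIndepFun f P := hind.comp (fun i x => x - ∫ ω', h i ω' ∂P)
    fun i => measurable_id.sub_const _
  have hbd : ∀ i, ∀ᵐ ω ∂P, |f i ω| ≤ 2 * B := by
    intro i
    have hB' : |∫ ω', h i ω' ∂P| ≤ B := by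
      have := norm_integral_le_of_norm_le_const (μ := P) (f := h i) (hB i)
      simpa using this
    filter_upwards [hB i] with ω hω
    exact (abs_sub _ _).trans (by linarith)
  have hall : ∀ᵐ ω ∂P, ∀ i, |f i ω| ≤ 2 * B := ae_all_iff.2 hbd
  have hsm : Measurable (∑ i, f i) := by
    have h1 : (∑ i, f i) = fun ω => ∑ i, f i ω := by ext ω; simp
    rw [h1]
    exact Finset.measurable_sum _ fun i _ => hfm i
  have hint : Integrable (fun ω => Real.exp (lam * (∑ i, f i) ω)) P := by
    refine Integrable.of_bound ((hsm.const_mul lam).exp).aestronglyMeasurable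
      (Real.exp (lam * ∑ _i : J, 2 * B)) ?_
    filter_upwards [hall] with ω hω
    rw [Real.norm_eq_abs, Real.abs_exp, Finset.sum_apply]
    refine Real.exp_le_exp.2 (mul_le_mul_of_nonneg_left (Finset.sum_le_sum fun i _ => ?_) hlam)
    exact (le_abs_self _).trans (hω i)
  have h1 := measure_ge_le_exp_mul_mgf (μ := P) (X := ∑ i, f i) t hlam hint
  have h2 : {ω | t ≤ (∑ i, f i) ω} = {ω | t ≤ ∑ i, (h i ω - ∫ ω', h i ω' ∂P)} := by
    ext ω; simp [hf]
  rw [h2, hfind.mgf_sum hfm] at h1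
  refine h1.trans ?_
  rw [Real.exp_add, Finset.mul_sum, Real.exp_sum, neg_mul]
  refine mul_le_mul_of_nonneg_left ?_ (Real.exp_nonneg _)
  exact Finset.prod_le_prod (fun i _ => mgf_nonneg) fun i _ =>
    mgf_centered_le (hm i) hlam (hB i) (hV i) hlB

end Bernstein

/-! ### Fourier coefficients of the error of the spectral initialization -/

section SpectralError

variable {Ω : Type*} [MeasurableSpace Ω] {P : Measure Ω} [IsProbabilityMeasure P] {s n : ℕ}
  {μ₀ : ℝ} {b : Fin n → Ω → Fin s → ℂ}

theorem SubspaceModel.measurable_sense (hb : SubspaceModel P μ₀ b) (X : Matrix (Fin s) (Fin n) ℂ)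
    (i : Fin n) : Measurable fun ω => sense (fun i => b i ω) X i := by
  unfold sense
  exact Finset.measurable_sum _ fun a _ =>
    (continuous_star.measurable.comp (hb.measurable_apply i a)).mul_const _

theorem SubspaceModel.sum_norm_sq_le (hb : SubspaceModel P μ₀ b) (i : Fin n) :
    ∀ᵐ ω ∂P, ∑ a, ‖b i ω a‖ ^ 2 ≤ μ₀ * s := by
  filter_upwards [hb.bounded i] with ω hω
  refine (Finset.sum_le_sum fun a _ => hω a).trans (le_of_eq ?_)
  simp [mul_comm]

theorem SubspaceModel.integral_sense_mul (hb : SubspaceModel P μ₀ b)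
    (X : Matrix (Fin s) (Fin n) ℂ) (i : Fin n) (a : Fin s) :
    ∫ ω, sense (fun i => b i ω) X i * b i ω a ∂P = X a i := by
  have h : ∀ ω, sense (fun i => b i ω) X i * b i ω a =
      ∑ c, X c i * (b i ω a * star (b i ω c)) := by
    intro ω
    rw [sense, Finset.sum_mul]
    exact Finset.sum_congr rfl fun c _ => by ring
  simp only [h]
  rw [integral_finsetSum _ fun c _ => (hb.integrable_mul_star i a c).const_mul _,
    Finset.sum_eq_single a]
  · rw [integral_const_mul, hb.isotropic, Matrix.one_apply_eq, mul_one]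
  · intro c _ hc
    rw [integral_const_mul, hb.isotropic, Matrix.one_apply_ne' hc, mul_zero]
  · simp

theorem SubspaceModel.integrable_norm_sense_sq (hb : SubspaceModel P μ₀ b)
    (X : Matrix (Fin s) (Fin n) ℂ) (i : Fin n) :
    Integrable (fun ω => ‖sense (fun i => b i ω) X i‖ ^ 2) P := by
  refine Integrable.of_bound
    ((hb.measurable_sense X i).norm.pow_const 2).aestronglyMeasurable
    (μ₀ * s * ∑ a, ‖X a i‖ ^ 2) ?_
  filter_upwards [hb.sum_norm_sq_le i] with ω hω
  rw [Real.norm_eq_abs, abs_of_nonneg (by positivity)]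
  exact norm_sense_sq_le (B := μ₀ * s) (fun _ => b i ω) (fun _ => hω) X i

theorem SubspaceModel.integral_norm_sense_sq (hb : SubspaceModel P μ₀ b)
    (X : Matrix (Fin s) (Fin n) ℂ) (i : Fin n) :
    ∫ ω, ‖sense (fun i => b i ω) X i‖ ^ 2 ∂P = ∑ a, ‖X a i‖ ^ 2 := by
  have hz : ∀ z : ℂ, ((‖z‖ ^ 2 : ℝ) : ℂ) = z * star z := by
    intro z
    rw [mul_comm, Complex.star_def, ← Complex.normSq_eq_conj_mul_self, Complex.normSq_eq_norm_sq]
  have h : ∀ ω, ((‖sense (fun i => b i ω) X i‖ ^ 2 : ℝ) : ℂ) =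
      ∑ c, star (X c i) * (sense (fun i => b i ω) X i * b i ω c) := by
    intro ω
    rw [hz]
    nth_rewrite 2 [sense]
    rw [star_sum, Finset.mul_sum]
    refine Finset.sum_congr rfl fun c _ => ?_
    rw [star_mul', star_star]; ring
  have hint : ∀ c, Integrable (fun ω => sense (fun i => b i ω) X i * b i ω c) P := by
    intro c
    have h' : (fun ω => sense (fun i => b i ω) X i * b i ω c) =
        fun ω => ∑ a, X a i * (b i ω c * star (b i ω a)) := by
      ext ω
      rw [sense, Finset.sum_mul]
      exact Finset.sum_congr rfl fun c _ => by ring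
    rw [h']
    exact integrable_finsetSum _ fun a _ => (hb.integrable_mul_star i c a).const_mul _
  have key : ((∫ ω, ‖sense (fun i => b i ω) X i‖ ^ 2 ∂P : ℝ) : ℂ) =
      ((∑ a, ‖X a i‖ ^ 2 : ℝ) : ℂ) := by
    rw [← integral_complex_ofReal]
    simp only [h]
    rw [integral_finsetSum _ fun c _ => (hint c).const_mul _, Complex.ofReal_sum]
    refine Finset.sum_congr rfl fun c _ => ?_
    rw [integral_const_mul, hb.integral_sense_mul, hz, mul_comm]
  exact_mod_cast key

/-- Tail bound for one real functional of `𝒜*𝒜(X) - X`. -/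
theorem measureReal_re_sum_ge_le (hb : SubspaceModel P μ₀ b) (X : Matrix (Fin s) (Fin n) ℂ)
    {c lam t : ℝ} (hX : ∀ i, ∑ a, ‖X a i‖ ^ 2 ≤ c ^ 2) (hc : 0 ≤ c)
    (hlam : 0 ≤ lam) (hlB : lam * (2 * (μ₀ * Real.sqrt s * c)) ≤ 1) (u : Fin n → ℂ)
    (hu : ∀ i, ‖u i‖ = 1) (a : Fin s) :
    P.real {ω | t ≤ (∑ i, u i * (senseAdj (fun i => b i ω) (sense (fun i => b i ω) X) - X) a i).re}
      ≤ Real.exp (-(lam * t) + lam ^ 2 * (μ₀ * frobNorm X ^ 2)) := by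
  set h : Fin n → Ω → ℝ := fun i ω => (u i * (sense (fun i => b i ω) X i * b i ω a)).re with hh
  have hm : ∀ i, Measurable (h i) := fun i =>
    Complex.measurable_re.comp (((hb.measurable_sense X i).mul (hb.measurable_apply i a)).const_mul _)
  have hind : iIndepFun h P := by
    have := hb.indep.comp
      (fun i (β : Fin s → ℂ) => (u i * ((∑ a, star (β a) * X a i) * β a)).re)
      (fun i => by
        have : Continuous fun β : Fin s → ℂ => (u i * ((∑ a, star (β a) * X a i) * β a)).re :=
          Complex.continuous_re.comp (by fun_prop)
        exact this.measurable)
    exact this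
  have hsq : ∀ i, ∀ᵐ ω ∂P, h i ω ^ 2 ≤ μ₀ * ‖sense (fun i => b i ω) X i‖ ^ 2 := by
    intro i
    filter_upwards [hb.bounded i] with ω hω
    have h1 : |h i ω| ≤ ‖sense (fun i => b i ω) X i‖ * ‖b i ω a‖ := by
      refine (Complex.abs_re_le_norm _).trans (le_of_eq ?_)
      rw [norm_mul, hu, one_mul, norm_mul]
    calc h i ω ^ 2 = |h i ω| ^ 2 := (sq_abs _).symm
      _ ≤ (‖sense (fun i => b i ω) X i‖ * ‖b i ω a‖) ^ 2 := by gcongr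
      _ = ‖b i ω a‖ ^ 2 * ‖sense (fun i => b i ω) X i‖ ^ 2 := by ring
      _ ≤ _ := by gcongr; exact hω a
  have hB : ∀ i, ∀ᵐ ω ∂P, |h i ω| ≤ μ₀ * Real.sqrt s * c := by
    intro i
    filter_upwards [hsq i, hb.sum_norm_sq_le i, hb.bounded i] with ω h1 h2 h3
    have h4 := norm_sense_sq_le (B := μ₀ * s) (fun _ => b i ω) (fun _ => h2) X i
    have hμ : 0 ≤ μ₀ := le_trans (sq_nonneg _) (h3 a)
    refine abs_le_of_sq_le_sq ?_ (by positivity)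
    calc h i ω ^ 2 ≤ μ₀ * (μ₀ * s * ∑ a, ‖X a i‖ ^ 2) := h1.trans (mul_le_mul_of_nonneg_left h4 hμ)
      _ ≤ μ₀ * (μ₀ * s * c ^ 2) := by gcongr; exact hX i
      _ = (μ₀ * Real.sqrt s * c) ^ 2 := by
        rw [mul_pow, mul_pow, Real.sq_sqrt (Nat.cast_nonneg _)]; ring
  -- Bounding one factor by `μ₀` and using isotropy for the other keeps the variance free of any
  -- factor `s`.
  have hV : ∀ i, ∫ ω, h i ω ^ 2 ∂P ≤ μ₀ * ∑ a, ‖X a i‖ ^ 2 := by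
    intro i
    rw [← hb.integral_norm_sense_sq X i, ← integral_const_mul]
    refine integral_mono_ae ?_ ((hb.integrable_norm_sense_sq X i).const_mul _) (hsq i)
    refine Integrable.of_bound ((hm i).pow_const 2).aestronglyMeasurable
      ((μ₀ * Real.sqrt s * c) ^ 2) ?_
    filter_upwards [hB i] with ω hω
    rw [norm_pow, Real.norm_eq_abs]
    exact pow_le_pow_left₀ (abs_nonneg _) hω 2
  have hE : ∀ i, ∫ ω, h i ω ∂P = (u i * X a i).re := by
    intro i
    have hint : Integrable (fun ω => u i * (sense (fun i => b i ω) X i * b i ω a)) P := by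
      have h' : (fun ω => u i * (sense (fun i => b i ω) X i * b i ω a)) =
          fun ω => ∑ c, u i * X c i * (b i ω a * star (b i ω c)) := by
        ext ω
        rw [sense, Finset.sum_mul, Finset.mul_sum]
        exact Finset.sum_congr rfl fun c _ => by ring
      rw [h']
      exact integrable_finsetSum _ fun c _ => (hb.integrable_mul_star i a c).const_mul _
    have h1 := integral_re (𝕜 := ℂ) hint
    simp only [RCLike.re_to_complex] at h1
    rw [hh, h1, integral_const_mul, hb.integral_sense_mul]
  have hfin := measureReal_sum_centered_ge_le (t := t) hm hind hlam hB hV hlB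
  have hVsum : ∑ i, μ₀ * ∑ a, ‖X a i‖ ^ 2 = μ₀ * frobNorm X ^ 2 := by
    rw [← Finset.mul_sum, frobNorm_sq_eq_sum, Finset.sum_comm]
  rw [hVsum] at hfin
  refine le_trans (le_of_eq ?_) hfin
  congr 1
  ext ω
  simp only [Set.mem_ofPred_eq]
  rw [Complex.re_sum]
  simp only [hE]
  simp only [hh, senseAdj, Matrix.sub_apply, Matrix.of_apply, mul_sub, Complex.sub_re]

/-- A union bound over `n` frequencies, `s` coordinates and four directions in the complex plane,
which explains the factor `4 (s n)`. -/
theorem measureReal_not_fourier_le (hb : SubspaceModel P μ₀ b) [NeZero n]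
    (X : Matrix (Fin s) (Fin n) ℂ) {c lam t : ℝ} (hX : ∀ i, ∑ a, ‖X a i‖ ^ 2 ≤ c ^ 2) (hc : 0 ≤ c)
    (hlam : 0 ≤ lam) (hlB : lam * (2 * (μ₀ * Real.sqrt s * c)) ≤ 1) :
    P.real {ω | ¬ ∀ (f : ZMod n) (a : Fin s), ‖∑ i : Fin n, ZMod.stdAddChar (f * (i.val : ZMod n)) *
      (senseAdj (fun i => b i ω) (sense (fun i => b i ω) X) - X) a i‖ ^ 2 ≤ 2 * t ^ 2} ≤
      4 * (s * n) * Real.exp (-(lam * t) + lam ^ 2 * (μ₀ * frobNorm X ^ 2)) := by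
  set Y : Ω → Matrix (Fin s) (Fin n) ℂ := fun ω =>
    senseAdj (fun i => b i ω) (sense (fun i => b i ω) X) - X with hY
  -- If `Re(I^k z) < t` for the four quarter turns, then `|Re z|` and `|Im z|` are below `t`, whence
  -- `|z|² ≤ 2 t²`.
  set ph : Fin 4 → ℂ := fun k => Complex.I ^ (k : ℕ) with hph
  set bad : ZMod n × Fin s × Fin 4 → Set Ω := fun x =>
    {ω | t ≤ (∑ i : Fin n, (ph x.2.2 * ZMod.stdAddChar (x.1 * (i.val : ZMod n))) *
      Y ω x.2.1 i).re} with hbad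
  have hsub : {ω | ¬ ∀ (f : ZMod n) (a : Fin s),
      ‖∑ i : Fin n, ZMod.stdAddChar (f * (i.val : ZMod n)) * Y ω a i‖ ^ 2 ≤ 2 * t ^ 2} ⊆
      ⋃ x ∈ (Finset.univ : Finset (ZMod n × Fin s × Fin 4)), bad x := by
    intro ω hω
    by_contra hne
    simp only [hbad, Finset.mem_univ, Set.iUnion_true, Set.mem_iUnion, Set.mem_ofPred_eq, not_exists,
      not_le] at hne
    refine hω fun f a => ?_
    set z := ∑ i : Fin n, ZMod.stdAddChar (f * (i.val : ZMod n)) * Y ω a i with hz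
    have h : ∀ k : Fin 4, (ph k * z).re < t := by
      intro k
      have := hne (f, a, k)
      rw [hz, Finset.mul_sum]
      simpa only [mul_assoc] using this
    have h0 := h 0
    have h1 := h 1
    have h2 := h 2
    have h3 := h 3
    simp only [hph, Fin.val_zero, Fin.val_one, Fin.val_two, pow_zero, pow_one, one_mul,
      Complex.I_sq, Complex.mul_re, Complex.I_re, Complex.I_im, zero_mul, zero_sub,
      Complex.neg_re, neg_mul] at h0 h1 h2
    have h3' : (Complex.I ^ ((3 : Fin 4) : ℕ)) = -Complex.I := Complex.I_pow_three
    simp only [hph, h3', Complex.mul_re, Complex.neg_re, Complex.I_re,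
      Complex.I_im, zero_mul, zero_sub, neg_mul, one_mul, neg_neg] at h3
    rw [← Complex.normSq_eq_norm_sq, Complex.normSq_apply]
    nlinarith
  have h1 := (measureReal_mono (μ := P) hsub (measure_ne_top _ _)).trans (measureReal_biUnion_finset_le _ _)
  refine h1.trans ?_
  have h2 : ∀ x ∈ (Finset.univ : Finset (ZMod n × Fin s × Fin 4)), P.real (bad x) ≤
      Real.exp (-(lam * t) + lam ^ 2 * (μ₀ * frobNorm X ^ 2)) := by
    intro x _
    refine measureReal_re_sum_ge_le hb X hX hc hlam hlB _ (fun i => ?_) x.2.1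
    rw [norm_mul, norm_stdAddChar, hph]
    simp
  refine (Finset.sum_le_card_nsmul _ _ _ h2).trans (le_of_eq ?_)
  simp only [Finset.card_univ, Fintype.card_prod, ZMod.card, Fintype.card_fin, nsmul_eq_mul]
  push_cast
  ring

end SpectralError

/-! ### Best low-rank approximation of a perturbed low-rank matrix -/

section LowRank

variable {p q : Type*} [Fintype p] [Fintype q] {r : ℕ}

theorem ip_outer {k l : Type*} [Fintype k] [Fintype l] (A : Matrix p k ℂ) (B : Matrix q k ℂ)
    (C : Matrix p l ℂ) (D : Matrix q l ℂ) :
    ip (A * Bᴴ) (C * Dᴴ) = ip (Cᴴ * A) (Dᴴ * B) := by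
  rw [ip_mul_right, Matrix.conjTranspose_conjTranspose, ip_comm, Matrix.mul_assoc, ip_mul_left,
    ip_comm]

theorem IsSVD.rank_le {Z : Matrix p q ℂ} {U : Matrix p (Fin r) ℂ} {d : Fin r → ℝ}
    {V : Matrix q (Fin r) ℂ} (h : IsSVD Z U d V) : Z.rank ≤ r := by
  rw [h.eq_mul, Matrix.mul_assoc]
  refine (Matrix.rank_mul_le_left _ _).trans ((Matrix.rank_le_card_width U).trans ?_)
  simp

theorem frobNorm_orthonormal_sq {V : Matrix q (Fin r) ℂ} (hV : Vᴴ * V = 1) :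
    frobNorm V ^ 2 = r := by
  rw [frobNorm_sq, ip, hV]
  simp

/-- Optimality gives `‖Δ‖² ≤ 2⟨E, Δ⟩`. The difference `Δ` has rank at most `2r`: it splits
orthogonally into a part with row space in that of `V` and a part with column space in that of `U'`.
On each part only the operator norm of `E`, times `√r`, is felt. -/
theorem frobNorm_sub_sq_le_of_isBestRankApprox {W Z Z' : Matrix p q ℂ} {U U' : Matrix p (Fin r) ℂ}
    {d d' : Fin r → ℝ} {V V' : Matrix q (Fin r) ℂ} (hZ : IsSVD Z U d V) (hZ' : IsSVD Z' U' d' V')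
    (hbest : IsBestRankApprox r W Z') {c : ℝ} (hc : 0 ≤ c)
    (hE : ∀ Y : Matrix q (Fin r) ℂ, frobNorm ((W - Z) * Y) ≤ c * frobNorm Y) :
    frobNorm (Z' - Z) ^ 2 ≤ 8 * r * c ^ 2 := by
  set E := W - Z with hEdef
  set Δ := Z' - Z with hΔ
  have h1 : frobNorm Δ ^ 2 ≤ 2 * ip E Δ := by
    have h2 := hbest.2 Z hZ.rank_le
    have h3 : W - Z' = E - Δ := by rw [hEdef, hΔ]; abel
    rw [h3] at h2
    have h4 : frobNorm (E - Δ) ^ 2 ≤ frobNorm E ^ 2 := pow_le_pow_left₀ (frobNorm_nonneg _) h2 2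
    rw [frobNorm_sub_sq] at h4
    linarith
  have hZV : Z * V * Vᴴ = Z := by
    rw [hZ.eq_mul, Matrix.mul_assoc (U * realDiag d), hZ.right_orthonormal, Matrix.mul_one]
  have hUZ : U' * (U'ᴴ * Z') = Z' := by
    rw [hZ'.eq_mul, Matrix.mul_assoc U', ← Matrix.mul_assoc U'ᴴ U', hZ'.left_orthonormal,
      Matrix.one_mul]
  -- Removing the row space of `Z` from `Δ` also removes `Z`, so the columns of the remainder lie in
  -- the range of `U'`.
  set F := Δ - Δ * V * Vᴴ with hF
  have hF' : F = Z' - Z' * V * Vᴴ := by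
    rw [hF, hΔ, Matrix.sub_mul, Matrix.sub_mul, hZV]; abel
  have hUF : U' * (U'ᴴ * F) = F := by
    rw [hF', Matrix.mul_sub, Matrix.mul_sub, hUZ, Matrix.mul_assoc Z', ← Matrix.mul_assoc U'ᴴ Z',
      ← Matrix.mul_assoc U', hUZ]
  have h2 : ip E Δ = ip (E * V) (Δ * V) + ip (U'ᴴ * E) (U'ᴴ * F) := by
    have h3 : ip (E * V) (Δ * V) = ip E (Δ * V * Vᴴ) := by rw [ip_mul_right]
    have h4 : ip (U'ᴴ * E) (U'ᴴ * F) = ip E F := by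
      rw [ip_mul_left, Matrix.conjTranspose_conjTranspose, hUF]
    rw [h3, h4, hF, ip_sub_right E Δ (Δ * V * Vᴴ)]; ring
  have h5 : frobNorm Δ ^ 2 = frobNorm (Δ * V) ^ 2 + frobNorm (U'ᴴ * F) ^ 2 := by
    have e1 : frobNorm (U'ᴴ * F) ^ 2 = ip F F := by
      rw [frobNorm_sq, ip_mul_left, Matrix.conjTranspose_conjTranspose, hUF]
    have e2 : ip (Δ * V * Vᴴ) Δ = frobNorm (Δ * V) ^ 2 := by
      rw [ip_mul_right, Matrix.conjTranspose_conjTranspose, frobNorm_sq]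
    have e3 : ip (Δ * V * Vᴴ) (Δ * V * Vᴴ) = frobNorm (Δ * V) ^ 2 := by
      rw [ip_mul_right, Matrix.conjTranspose_conjTranspose, Matrix.mul_assoc (Δ * V),
        hZ.right_orthonormal, Matrix.mul_one, frobNorm_sq]
    rw [e1, hF, ip_sub_left Δ (Δ * V * Vᴴ), ip_sub_right Δ Δ (Δ * V * Vᴴ),
      ip_sub_right (Δ * V * Vᴴ) Δ (Δ * V * Vᴴ), e2, e3, ip_comm Δ (Δ * V * Vᴴ), e2,
      frobNorm_sq]
    ring
  set x := frobNorm (Δ * V)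
  set y := frobNorm (U'ᴴ * F)
  have hx : 0 ≤ x := frobNorm_nonneg _
  have hy : 0 ≤ y := frobNorm_nonneg _
  have h6 : frobNorm (E * V) ≤ c * Real.sqrt r := by
    refine (hE V).trans (le_of_eq ?_)
    rw [← frobNorm_orthonormal_sq hZ.right_orthonormal, Real.sqrt_sq (frobNorm_nonneg _)]
  have h7 : frobNorm (U'ᴴ * E) ≤ c * Real.sqrt r := by
    rw [← frobNorm_conjTranspose, Matrix.conjTranspose_mul, Matrix.conjTranspose_conjTranspose]
    refine (frobNorm_conjTranspose_mul_le hc hE U').trans (le_of_eq ?_)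
    rw [← frobNorm_orthonormal_sq hZ'.left_orthonormal, Real.sqrt_sq (frobNorm_nonneg _)]
  have h8 : ip E Δ ≤ c * Real.sqrt r * (x + y) := by
    rw [h2, mul_add]
    exact add_le_add ((ip_le _ _).trans (mul_le_mul_of_nonneg_right h6 hx))
      ((ip_le _ _).trans (mul_le_mul_of_nonneg_right h7 hy))
  have hr : Real.sqrt r ^ 2 = r := Real.sq_sqrt (Nat.cast_nonneg _)
  rw [h5] at h1 ⊢
  set z := c * Real.sqrt r with hz
  have hz2 : z ^ 2 = r * c ^ 2 := by rw [hz, mul_pow, hr]; ring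
  -- From `x² + y² ≤ 2 z (x + y)`, completing squares gives `x² + y² ≤ 8 z²`.
  nlinarith [sq_nonneg (x - 2 * z), sq_nonneg (y - 2 * z), sq_nonneg (x - y)]

theorem frobNorm_realDiag_mul_sq_le (A : Matrix (Fin r) p ℂ)
    {d : Fin r → ℝ} {c : ℝ} (hd0 : ∀ l, 0 ≤ d l) (hd : ∀ l, d l ≤ c) :
    frobNorm (realDiag d * A) ^ 2 ≤ c ^ 2 * frobNorm A ^ 2 := by
  have h := frobNorm_mul_realDiag_sq_le Aᴴ hd0 hd
  have e : (Aᴴ * realDiag d)ᴴ = realDiag d * A := by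
    rw [Matrix.conjTranspose_mul, Matrix.conjTranspose_conjTranspose, realDiag,
      Matrix.diagonal_conjTranspose]
    congr 2
    ext l
    simp
  rw [← e, frobNorm_conjTranspose]
  rwa [frobNorm_conjTranspose] at h

/-- Weyl's inequality for the leading singular value, tested on the leading right singular vector of
`Z`. It guarantees that the data-driven radius of the feasible set is large enough for the target.
-/
theorem IsSVD.head_le {Z Z' : Matrix p q ℂ} {U U' : Matrix p (Fin r) ℂ} {d d' : Fin r → ℝ}
    {V V' : Matrix q (Fin r) ℂ} (hZ : IsSVD Z U d V) (hZ' : IsSVD Z' U' d' V') (hr : 0 < r) :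
    d ⟨0, hr⟩ ≤ d' ⟨0, hr⟩ + frobNorm (Z' - Z) := by
  set e : Matrix (Fin r) Unit ℂ := Matrix.of fun l _ => if l = ⟨0, hr⟩ then 1 else 0 with he
  have he1 : frobNorm e = 1 := by
    rw [← sq_eq_sq₀ (frobNorm_nonneg _) zero_le_one, frobNorm_sq_eq_sum,
      Finset.sum_eq_single ⟨0, hr⟩]
    · simp [he]
    · intro l _ hl
      simp [he, hl]
    · simp
  have hde : realDiag d * e = (d ⟨0, hr⟩ : ℂ) • e := by
    ext l u
    simp only [realDiag, Matrix.diagonal_mul, he, Matrix.of_apply, Matrix.smul_apply, smul_eq_mul]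
    split_ifs with h
    · rw [h]
    · simp
  have hY : frobNorm (V * e) = 1 := by rw [frobNorm_orthonormal_mul _ hZ.right_orthonormal, he1]
  have hZY : frobNorm (Z * (V * e)) = d ⟨0, hr⟩ := by
    rw [hZ.eq_mul, Matrix.mul_assoc (U * realDiag d), ← Matrix.mul_assoc Vᴴ, hZ.right_orthonormal,
      Matrix.one_mul, Matrix.mul_assoc, frobNorm_orthonormal_mul _ hZ.left_orthonormal, hde,
      frobNorm_smul, he1, Complex.norm_real, Real.norm_eq_abs, abs_of_nonneg (hZ.nonneg _), mul_one]
  have hZY' : frobNorm (Z' * (V * e)) ≤ d' ⟨0, hr⟩ := by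
    have h0 := hZ'.nonneg ⟨0, hr⟩
    rw [hZ'.eq_mul, Matrix.mul_assoc, Matrix.mul_assoc,
      frobNorm_orthonormal_mul _ hZ'.left_orthonormal]
    refine abs_le_of_sq_le_sq' ?_ h0 |>.2
    refine (frobNorm_realDiag_mul_sq_le (c := d' ⟨0, hr⟩) _ hZ'.nonneg
      fun l => hZ'.antitone (Fin.mk_le_of_le_val (Nat.zero_le _))).trans ?_
    have h1 := frobNorm_orthonormal_conjTranspose_mul_le (V * e) hZ'.right_orthonormal
    rw [hY] at h1
    have h2 : frobNorm (V'ᴴ * (V * e)) ^ 2 ≤ 1 := pow_le_one₀ (frobNorm_nonneg _) h1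
    nlinarith [sq_nonneg (d' ⟨0, hr⟩)]
  have h3 : Z * (V * e) = Z' * (V * e) - (Z' - Z) * (V * e) := by
    rw [Matrix.sub_mul]; abel
  have h4 : frobNorm ((Z' - Z) * (V * e)) ≤ frobNorm (Z' - Z) := by
    have := frobNorm_mul_le (Z' - Z) (V * e)
    rwa [hY, mul_one] at this
  rw [← hZY, h3]
  exact (frobNorm_sub_le _ _).trans (add_le_add hZY' h4)

end LowRank

/-! ### The feasible set -/

section Feasible

variable {p q : Type*} [Fintype p] [Fintype q]

/-- The obtuse angle criterion: moving from the projection towards `N` inside the convex set cannot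
approach `M`. -/
theorem frobNorm_projection_sub_le {S : Set (Matrix p q ℂ)}
    (hS : ∀ A ∈ S, ∀ B ∈ S, ∀ θ : ℝ, 0 ≤ θ → θ ≤ 1 → (1 - θ) • A + θ • B ∈ S)
    {M M' N : Matrix p q ℂ} (h : IsProjection S M M') (hN : N ∈ S) :
    frobNorm (M' - N) ≤ frobNorm (M - N) := by
  have h1 : ip (M - M') (N - M') ≤ 0 := by
    by_contra hc
    push Not at hc
    set a := ip (M - M') (N - M') with ha
    set w := frobNorm (N - M') ^ 2 with hw
    have hw0 : 0 ≤ w := sq_nonneg _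
    have key : ∀ θ : ℝ, 0 ≤ θ → θ ≤ 1 → 2 * θ * a ≤ θ ^ 2 * w := by
      intro θ h0 h1
      have h2 := h.2 _ (hS M' h.1 N hN θ h0 h1)
      have h3 : M - ((1 - θ) • M' + θ • N) = (M - M') - θ • (N - M') := by
        rw [sub_smul, smul_sub, one_smul]; abel
      rw [h3] at h2
      have h4 := pow_le_pow_left₀ (frobNorm_nonneg _) h2 2
      rw [frobNorm_sub_sq (M - M') (θ • (N - M')), ip_smul_right, frobNorm_sq (θ • (N - M')), ip_smul_left, ip_smul_right,
        ← frobNorm_sq (N - M')] at h4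
      nlinarith
    have hpos : 0 < w + a := by linarith
    -- This value of `θ` lies in `[0, 1]` even when `w = 0`, and is small enough for the linear term
    -- to win.
    have h5 := key (a / (w + a)) (by positivity) ((div_le_one hpos).2 (by linarith))
    rw [div_pow, mul_div_assoc', div_mul_eq_mul_div, div_mul_eq_mul_div, div_le_div_iff₀ hpos
      (by positivity)] at h5
    nlinarith [mul_pos hc hpos, mul_pos (mul_pos hc hc) hpos, mul_nonneg hw0 hc.le]
  have h2 : M - N = (M - M') + (M' - N) := by abel
  have h3 : ip (M - M') (M' - N) = -ip (M - M') (N - M') := by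
    rw [← ip_neg_right, neg_sub]
  refine (abs_le_of_sq_le_sq' ?_ (frobNorm_nonneg _)).2
  rw [h2, frobNorm_add_sq, h3]
  nlinarith [sq_nonneg (frobNorm (M - M'))]

variable {s n n₁ n₂ r : ℕ}

theorem rowNorm_eq_frobNorm (A : Matrix p q ℂ) (k : p) :
    rowNorm A k = frobNorm (A.submatrix (fun _ : Unit => k) id) := by
  rw [← sq_eq_sq₀ (rowNorm_nonneg _ _) (frobNorm_nonneg _), rowNorm_sq, frobNorm_sq_eq_sum]
  simp

theorem frobNorm_real_smul (c : ℝ) (A : Matrix p q ℂ) : frobNorm (c • A) = |c| * frobNorm A := by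
  have h : c • A = (c : ℂ) • A := by ext; simp
  rw [h, frobNorm_smul, Complex.norm_real, Real.norm_eq_abs]

theorem feasible_convex (μ σ : ℝ) : ∀ A ∈ (feasible n μ σ : Set (Factors s n₁ n₂ r)),
    ∀ B ∈ (feasible n μ σ : Set (Factors s n₁ n₂ r)), ∀ θ : ℝ, 0 ≤ θ → θ ≤ 1 →
    (1 - θ) • A + θ • B ∈ (feasible n μ σ : Set (Factors s n₁ n₂ r)) := by
  have key : ∀ {p q : Type} [Fintype p] [Fintype q] (A B : Matrix p q ℂ) (c θ : ℝ), 0 ≤ θ → θ ≤ 1 →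
      frobNorm A ≤ c → frobNorm B ≤ c → frobNorm ((1 - θ) • A + θ • B) ≤ c := by
    intro p q _ _ A B c θ h0 h1 hA hB
    refine (frobNorm_add_le _ _).trans ?_
    rw [frobNorm_real_smul, frobNorm_real_smul, abs_of_nonneg h0, abs_of_nonneg (sub_nonneg.2 h1)]
    nlinarith
  intro A hA B hB θ h0 h1
  refine ⟨fun j => key (block A.toRows₁ j) (block B.toRows₁ j) _ θ h0 h1 (hA.1 j) (hB.1 j),
    fun k => ?_⟩
  have hA' := hA.2 k
  have hB' := hB.2 k
  rw [rowNorm_eq_frobNorm] at hA' hB' ⊢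
  exact key _ _ _ θ h0 h1 hA' hB'

theorem balanced_mul (U : Matrix (Fin n₁ × Fin s) (Fin r) ℂ) (d : Fin r → ℝ)
    (V : Matrix (Fin n₂) (Fin r) ℂ) (Q : Matrix (Fin r) (Fin r) ℂ) :
    balanced U d V * Q = Matrix.fromRows (U * realDiag (fun l => Real.sqrt (d l)) * Q)
      (V * realDiag (fun l => Real.sqrt (d l)) * Q) := by
  rw [balanced, Matrix.fromRows_mul]

theorem balanced_mul_mem_feasible {U : Matrix (Fin n₁ × Fin s) (Fin r) ℂ} {d : Fin r → ℝ}
    {V : Matrix (Fin n₂) (Fin r) ℂ} {Q : Matrix (Fin r) (Fin r) ℂ}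
    (hQ : Q ∈ Matrix.unitaryGroup (Fin r) ℂ) {μ₁ μ σ : ℝ} (hinc : Incoherent n μ₁ U V)
    (hμ : μ₁ ≤ μ) (hd : ∀ l, d l ≤ σ) (hσ : 0 ≤ σ) :
    balanced U d V * Q ∈ (feasible n μ σ : Set (Factors s n₁ n₂ r)) := by
  have hQ' : Q * Qᴴ = 1 := Matrix.mem_unitaryGroup_iff.1 hQ
  have key : ∀ {p : Type} [Fintype p] (A : Matrix p (Fin r) ℂ), frobNorm A ^ 2 ≤ μ₁ * r / n →
      frobNorm (A * realDiag (fun l => Real.sqrt (d l)) * Q) ≤ Real.sqrt (μ * r * σ / n) := by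
    intro p _ A hA
    rw [frobNorm_mul_unitary _ hQ']
    refine Real.le_sqrt_of_sq_le ?_
    refine (frobNorm_mul_realDiag_sq_le A (c := Real.sqrt σ) (fun l => Real.sqrt_nonneg _)
      fun l => Real.sqrt_le_sqrt (hd l)).trans ?_
    rw [Real.sq_sqrt hσ]
    calc σ * frobNorm A ^ 2 ≤ σ * (μ₁ * r / n) := mul_le_mul_of_nonneg_left hA hσ
      _ ≤ σ * (μ * r / n) := by gcongr
      _ = _ := by ring
  rw [balanced_mul]
  refine ⟨fun j => ?_, fun k => ?_⟩
  · rw [Matrix.toRows₁_fromRows, block_mul, block_mul]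
    exact key _ (hinc.1 j)
  · rw [Matrix.toRows₂_fromRows, rowNorm_eq_frobNorm]
    have h := hinc.2 k
    rw [rowNorm_eq_frobNorm] at h
    exact key _ h

end Feasible

/-! ### Factorized matrices near balanced factors -/

section Balanced

variable {p q k : Type*} [Fintype p] [Fintype q] [Fintype k]

theorem fromRows_conjTranspose_mul (A C : Matrix p k ℂ) (B D : Matrix q k ℂ) :
    (Matrix.fromRows A B)ᴴ * Matrix.fromRows C D = Aᴴ * C + Bᴴ * D := by
  rw [Matrix.conjTranspose_fromRows_eq_fromCols_conjTranspose, Matrix.fromCols_mul_fromRows]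

theorem fromRows_sub_fromRows (A C : Matrix p k ℂ) (B D : Matrix q k ℂ) :
    Matrix.fromRows A B - Matrix.fromRows C D = Matrix.fromRows (A - C) (B - D) := by
  ext (i | i) j <;> simp

theorem ip_fromRows (A C : Matrix p k ℂ) (B D : Matrix q k ℂ) :
    ip (Matrix.fromRows A B) (Matrix.fromRows C D) = ip A C + ip B D := by
  rw [ip, fromRows_conjTranspose_mul, Matrix.trace_add, Complex.add_re]
  rfl

/-- With stacked factors `M`, `X`, the left side is `‖M Mᴴ - X Xᴴ‖²`. For balanced factors, the
excess of the right side over it is a multiple of `‖L₀ᴴ L - R₀ᴴ R‖²`. -/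
theorem gram_defect_le {L L₀ : Matrix p k ℂ} {R R₀ : Matrix q k ℂ} (hM : Lᴴ * L = Rᴴ * R)
    (hX : L₀ᴴ * L₀ = R₀ᴴ * R₀) :
    frobNorm (Lᴴ * L + Rᴴ * R) ^ 2 + frobNorm (L₀ᴴ * L₀ + R₀ᴴ * R₀) ^ 2 -
      2 * frobNorm (L₀ᴴ * L + R₀ᴴ * R) ^ 2 ≤ 4 * frobNorm (L * Rᴴ - L₀ * R₀ᴴ) ^ 2 := by
  rw [← hM, ← hX, frobNorm_sub_sq (L * Rᴴ), ip_outer L R L₀ R₀, frobNorm_sq (L * Rᴴ), ip_outer L R L R,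
    frobNorm_sq (L₀ * R₀ᴴ), ip_outer L₀ R₀, ← hM, ← hX, frobNorm_add_sq, frobNorm_add_sq,
    frobNorm_add_sq, ← frobNorm_sq, ← frobNorm_sq]
  have h := sq_nonneg (frobNorm (L₀ᴴ * L - R₀ᴴ * R))
  rw [frobNorm_sub_sq] at h
  linarith

/-- For `H = M - X`, alignment makes `A = Xᴴ H` Hermitian and `N + A` positive. The defect becomes
`2⟨N,G⟩ + 2‖A‖² + 4⟨A,G⟩ + ‖G‖²` with `G = Hᴴ H`; positivity of `⟨G, N + A⟩` and a completed square
leave `(4/5)⟨N,G⟩`. -/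
theorem frobNorm_sub_sq_le_gram_defect {M X : Matrix p k ℂ} {S : Matrix k k ℂ} {σ : ℝ}
    (hS : Xᴴ * X = S + S)
    (hK : (Xᴴ * M)ᴴ = Xᴴ * M) (hpos : ∀ A : Matrix p k ℂ, 0 ≤ ip A (A * (Xᴴ * M)))
    (hσ : σ * frobNorm (M - X) ^ 2 ≤ ip (M - X) ((M - X) * S)) :
    8 / 5 * (σ * frobNorm (M - X) ^ 2) ≤ frobNorm (Mᴴ * M) ^ 2 + frobNorm (Xᴴ * X) ^ 2 -
      2 * frobNorm (Xᴴ * M) ^ 2 := by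
  obtain ⟨H, rfl⟩ : ∃ H, M = X + H := ⟨M - X, by abel⟩
  rw [add_sub_cancel_left] at hσ ⊢
  set N := Xᴴ * X with hN
  set A := Xᴴ * H with hA
  set G := Hᴴ * H with hG
  have hK' : Xᴴ * (X + H) = N + A := by rw [Matrix.mul_add]
  rw [hK'] at hK hpos ⊢
  have hNh : Nᴴ = N := by rw [hN, Matrix.conjTranspose_mul, Matrix.conjTranspose_conjTranspose]
  have hAh : Hᴴ * X = A := by
    rw [Matrix.conjTranspose_add, hNh] at hK
    rw [← add_left_cancel hK, hA, Matrix.conjTranspose_mul, Matrix.conjTranspose_conjTranspose]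
  have hMM : (X + H)ᴴ * (X + H) = N + (A + A + G) := by
    rw [Matrix.conjTranspose_add, Matrix.add_mul, hK', Matrix.mul_add, hAh]; abel
  rw [hMM]
  have h1 : ip G (N + A) = ip H (H * (N + A)) := by
    rw [hG, ip_mul_left, Matrix.conjTranspose_conjTranspose]
  have h2 : ip G N = 2 * ip H (H * S) := by
    rw [hG, ip_mul_left, Matrix.conjTranspose_conjTranspose, hS, Matrix.mul_add, ip_add_right]
    ring
  have h3 := hpos H
  rw [← h1, ip_add_right] at h3
  -- `7/5` is a rational value just below `√2`: its square must not exceed the coefficient `2` of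
  -- `‖A‖²`.
  have h4 := sq_nonneg (frobNorm (G + (7 / 5 : ℝ) • A))
  rw [frobNorm_add_sq, ip_smul_right, frobNorm_sq ((7 / 5 : ℝ) • A), ip_smul_left, ip_smul_right,
    ← frobNorm_sq A] at h4
  have h5 := sq_nonneg (frobNorm A)
  rw [frobNorm_add_sq N (A + A + G), frobNorm_add_sq (A + A) G, frobNorm_add_sq A A,
    frobNorm_add_sq N A, ip_add_right, ip_add_right, ip_add_left, ip_comm A G, ip_comm N G,
    ← frobNorm_sq A]
  nlinarith

theorem frobNorm_sub_sq_le_of_balanced {L L₀ : Matrix p k ℂ} {R R₀ : Matrix q k ℂ} {σ : ℝ}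
    (hM : Lᴴ * L = Rᴴ * R) (hX : L₀ᴴ * L₀ = R₀ᴴ * R₀)
    (hK : ((Matrix.fromRows L₀ R₀)ᴴ * Matrix.fromRows L R)ᴴ =
      (Matrix.fromRows L₀ R₀)ᴴ * Matrix.fromRows L R)
    (hpos : ∀ A : Matrix (p ⊕ q) k ℂ,
      0 ≤ ip A (A * ((Matrix.fromRows L₀ R₀)ᴴ * Matrix.fromRows L R)))
    (hσ : ∀ A : Matrix (p ⊕ q) k ℂ, σ * frobNorm A ^ 2 ≤ ip A (A * (L₀ᴴ * L₀))) :
    2 / 5 * (σ * frobNorm (Matrix.fromRows L R - Matrix.fromRows L₀ R₀) ^ 2) ≤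
      frobNorm (L * Rᴴ - L₀ * R₀ᴴ) ^ 2 := by
  have h1 := frobNorm_sub_sq_le_gram_defect (S := L₀ᴴ * L₀)
    (by rw [fromRows_conjTranspose_mul, ← hX]) hK hpos (hσ _)
  have h2 := gram_defect_le hM hX
  rw [fromRows_conjTranspose_mul, fromRows_conjTranspose_mul, fromRows_conjTranspose_mul] at h1
  linarith

/-- The squares of the two summands give the left side, so only the cross term `2⟨a, bᴴ⟩` can hurt,
with `a = L₀ᴴ A` and `b = R₀ᴴ B`. As `a + b` is Hermitian, polarization gives `4⟨a, bᴴ⟩ = ‖a + b‖² -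
⟨a - b, (a - b)ᴴ⟩`; the balancing term compensates the negative part. -/
theorem coercivity {L₀ A : Matrix p k ℂ} {R₀ B : Matrix q k ℂ} {σ : ℝ}
    (hX : L₀ᴴ * L₀ = R₀ᴴ * R₀) (hK : (L₀ᴴ * A + R₀ᴴ * B)ᴴ = L₀ᴴ * A + R₀ᴴ * B)
    (hA : σ * frobNorm A ^ 2 ≤ ip A (A * (L₀ᴴ * L₀)))
    (hB : σ * frobNorm B ^ 2 ≤ ip B (B * (L₀ᴴ * L₀))) :
    σ * (frobNorm A ^ 2 + frobNorm B ^ 2) ≤ frobNorm (A * R₀ᴴ + L₀ * Bᴴ) ^ 2 +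
      1 / 8 * frobNorm ((L₀ᴴ * A - R₀ᴴ * B) + (L₀ᴴ * A - R₀ᴴ * B)ᴴ) ^ 2 := by
  have e1 : frobNorm (A * R₀ᴴ) ^ 2 = ip A (A * (L₀ᴴ * L₀)) := by
    rw [frobNorm_sq, ip_outer, ← hX, ip_mul_left, Matrix.conjTranspose_conjTranspose]
  have e2 : frobNorm (L₀ * Bᴴ) ^ 2 = ip B (B * (L₀ᴴ * L₀)) := by
    rw [frobNorm_sq, ip_outer, ip_comm, ip_mul_left, Matrix.conjTranspose_conjTranspose]
  have e3 : ip (A * R₀ᴴ) (L₀ * Bᴴ) = ip (L₀ᴴ * A) (R₀ᴴ * B)ᴴ := by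
    rw [ip_outer, Matrix.conjTranspose_mul, Matrix.conjTranspose_conjTranspose]
  rw [frobNorm_add_sq (A * R₀ᴴ), e1, e2, e3]
  set a := L₀ᴴ * A
  set b := R₀ᴴ * B
  have hab : aᴴ + bᴴ = a + b := by rw [← Matrix.conjTranspose_add, hK]
  have h1 : ip a (aᴴ + bᴴ) = ip a (a + b) := by rw [hab]
  have h2 : ip b (aᴴ + bᴴ) = ip b (a + b) := by rw [hab]
  have h3 : ip b aᴴ = ip a bᴴ := by
    rw [← ip_conjTranspose, Matrix.conjTranspose_conjTranspose, ip_comm]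
  have h4 := ip_le (a - b) (a - b)ᴴ
  rw [frobNorm_conjTranspose, ← sq] at h4
  have h5 := sq_nonneg (frobNorm (a + b))
  have h6 : frobNorm ((a - b) + (a - b)ᴴ) ^ 2 =
      2 * frobNorm (a - b) ^ 2 + 2 * ip (a - b) (a - b)ᴴ := by
    rw [frobNorm_add_sq, frobNorm_conjTranspose]; ring
  have h7 : ip (a - b) (a - b)ᴴ = ip a aᴴ + ip b bᴴ - 2 * ip a bᴴ := by
    rw [Matrix.conjTranspose_sub, ip_sub_left, ip_sub_right, ip_sub_right, h3]; ring
  have h8 := sq_nonneg (frobNorm (a - b))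
  rw [frobNorm_add_sq] at h5
  rw [ip_add_right, ip_add_right, ← frobNorm_sq] at h1
  rw [ip_add_right, ip_add_right, h3, ← frobNorm_sq, ip_comm b a] at h2
  linarith

theorem quarter_smul_eq (A : Matrix p q ℂ) : (1 / 4 : ℂ) • A = (1 / 4 : ℝ) • A := by
  ext i j
  simp only [Matrix.smul_apply, Complex.real_smul, smul_eq_mul]
  norm_num

/-- The pairing of the gradient with a displacement, with the factors moved so that `W` faces the
first variation of the product and the imbalance faces half of its own variation. -/
theorem ip_gradient (W : Matrix p q ℂ) (L A : Matrix p k ℂ) (R B : Matrix q k ℂ) :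
    ip (W * R + (1 / 4 : ℂ) • (L * (Lᴴ * L - Rᴴ * R))) A +
      ip (Wᴴ * L + (1 / 4 : ℂ) • (R * (Rᴴ * R - Lᴴ * L))) B =
    ip W (A * Rᴴ + L * Bᴴ) + 1 / 4 * ip (Lᴴ * L - Rᴴ * R) (Lᴴ * A - Rᴴ * B) := by
  have e1 : ip (Wᴴ * L) B = ip W (L * Bᴴ) := by
    rw [ip_mul_right, ← ip_conjTranspose, Matrix.conjTranspose_conjTranspose,
      Matrix.conjTranspose_mul, Matrix.conjTranspose_conjTranspose]
  have e2 : ip (R * (Rᴴ * R - Lᴴ * L)) B = -ip (Lᴴ * L - Rᴴ * R) (Rᴴ * B) := by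
    rw [ip_mul_left, ← neg_sub (Lᴴ * L), ip_neg_left]
  rw [quarter_smul_eq, quarter_smul_eq, ip_add_left, ip_add_left, ip_smul_left, ip_smul_left,
    ip_mul_right, e1, e2, ip_mul_left L, ip_add_right, ip_sub_right (Lᴴ * L - Rᴴ * R)]
  ring

/-- The pairing equals `½‖P + Pᴴ‖² + 3⟨Γ, P⟩ + ‖Γ‖²`; the mixed term is absorbed by expanding `‖P +
Pᴴ + 3Γ‖² ≥ 0`. -/
theorem ip_imbalance_ge {L₀ A : Matrix p k ℂ} {R₀ B : Matrix q k ℂ}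
    (hX : L₀ᴴ * L₀ = R₀ᴴ * R₀) :
    1 / 4 * frobNorm ((L₀ᴴ * A - R₀ᴴ * B) + (L₀ᴴ * A - R₀ᴴ * B)ᴴ) ^ 2 -
      5 / 4 * frobNorm (Aᴴ * A - Bᴴ * B) ^ 2 ≤
    ip ((L₀ + A)ᴴ * (L₀ + A) - (R₀ + B)ᴴ * (R₀ + B)) ((L₀ + A)ᴴ * A - (R₀ + B)ᴴ * B) := by
  set P := L₀ᴴ * A - R₀ᴴ * B with hP
  set Γ := Aᴴ * A - Bᴴ * B with hΓ
  have e1 : (L₀ + A)ᴴ * A - (R₀ + B)ᴴ * B = P + Γ := by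
    rw [Matrix.conjTranspose_add, Matrix.conjTranspose_add, Matrix.add_mul, Matrix.add_mul, hP, hΓ]
    abel
  have e2 : (L₀ + A)ᴴ * (L₀ + A) - (R₀ + B)ᴴ * (R₀ + B) = P + Pᴴ + Γ := by
    have e3 : Pᴴ = Aᴴ * L₀ - Bᴴ * R₀ := by
      rw [hP, Matrix.conjTranspose_sub, Matrix.conjTranspose_mul, Matrix.conjTranspose_mul,
        Matrix.conjTranspose_conjTranspose, Matrix.conjTranspose_conjTranspose]
    rw [Matrix.conjTranspose_add, Matrix.conjTranspose_add, Matrix.add_mul, Matrix.add_mul,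
      Matrix.mul_add, Matrix.mul_add, Matrix.mul_add, Matrix.mul_add, hX, e3, hP, hΓ]
    abel
  have hΓh : Γᴴ = Γ := by
    rw [hΓ, Matrix.conjTranspose_sub, Matrix.conjTranspose_mul, Matrix.conjTranspose_mul,
      Matrix.conjTranspose_conjTranspose, Matrix.conjTranspose_conjTranspose]
  rw [e1, e2]
  clear_value P Γ
  have e3 : ip Γ Pᴴ = ip Γ P := by rw [← ip_conjTranspose, Matrix.conjTranspose_conjTranspose, hΓh]
  have h := sq_nonneg (frobNorm ((P + Pᴴ) + (3 : ℝ) • Γ))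
  rw [frobNorm_add_sq, ip_smul_right, frobNorm_sq ((3 : ℝ) • Γ), ip_smul_left, ip_smul_right,
    ← frobNorm_sq Γ] at h
  have e4 : frobNorm (P + Pᴴ) ^ 2 = 2 * frobNorm P ^ 2 + 2 * ip P Pᴴ := by
    rw [frobNorm_add_sq, frobNorm_conjTranspose]; ring
  rw [ip_add_left (P + Pᴴ), ip_add_right, ip_add_right, ip_add_left P, ← frobNorm_sq,
    ip_comm Pᴴ P, ← frobNorm_sq Γ]
  rw [e4, ip_add_left] at h
  rw [e4]
  have e5 : ip P Γ = ip Γ P := ip_comm _ _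
  have e6 : ip Pᴴ Γ = ip Γ P := by rw [ip_comm, e3]
  rw [ip_add_left, e5, e6]
  rw [e5, e6] at h
  linarith

end Balanced

/-! ### The operator `𝒢𝒜*𝒜𝒢* + ℐ - 𝒢𝒢*` -/

section Core

variable {s n n₁ n₂ r : ℕ}

/-- The operator `𝒢𝒜*𝒜𝒢* + ℐ - 𝒢𝒢*`. -/
def coreOp (hn : n₁ + n₂ = n + 1) (b : Fin n → Fin s → ℂ) (D : Matrix (Fin n₁ × Fin s) (Fin n₂) ℂ) :
    Matrix (Fin n₁ × Fin s) (Fin n₂) ℂ :=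
  opG hn (senseAdj b (sense b (opGAdj n D))) + (D - opG hn (opGAdj n D))

/-- Lifts are fixed by `𝒢𝒢*`, so the penalty `ℐ - 𝒢𝒢*` ignores the target, and the data term sees it
through `weighted_sense`. Thus the core of the gradient is linear in the residual. -/
theorem gradCore_eq (hn : n₁ + n₂ = n + 1) (h₁ : 0 < n₁) (h₂ : 0 < n₂) (b : Fin n → Fin s → ℂ)
    (X : Matrix (Fin s) (Fin n) ℂ) (L : Matrix (Fin n₁ × Fin s) (Fin r) ℂ)
    (R : Matrix (Fin n₂) (Fin r) ℂ) :
    gradCore hn b (sense b X) L R = coreOp hn b (L * Rᴴ - hankel hn X) := by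
  have h : opG hn (opGAdj n (hankel hn X)) = hankel hn X := by
    have h0 : frobNorm (hankel hn X - opG hn (opGAdj n (hankel hn X))) ^ 2 = 0 := by
      rw [frobNorm_sub_opG_sq hn h₁ h₂]
      have h1 : hankel hn X = opG hn (opGAdj n (hankel hn X)) := by
        rw [opG]
        congr 1
        rw [opGAdj_hankel]
        ext a i
        have hw : (0 : ℝ) < weight n₁ n₂ i := by exact_mod_cast weight_pos hn h₁ h₂ i
        have hs : ((Real.sqrt (weight n₁ n₂ i) : ℝ) : ℂ) ≠ 0 := by
          exact_mod_cast (Real.sqrt_pos.2 hw).ne'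
        simp only [scaleInv, Matrix.of_apply]
        field_simp
      have h2 : frobNorm (hankel hn X) = frobNorm (opGAdj n (hankel hn X)) := by
        conv_lhs => rw [h1]
        exact frobNorm_opG hn h₁ h₂ _
      rw [h2, sub_self]
    exact (sub_eq_zero.1 (frobNorm_eq_zero.1 (pow_eq_zero_iff two_ne_zero |>.1 h0))).symm
  have hsub : ∀ Y Z : Matrix (Fin s) (Fin n) ℂ, opG hn (Y - Z) = opG hn Y - opG hn Z := by
    intro Y Z
    ext
    simp [opG, hankel, scaleInv, mul_sub]
  rw [gradCore, coreOp, weighted_sense hn b X, ← sense_sub, ← opGAdj_sub]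
  congr 1
  rw [opGAdj_sub, hsub, h]
  abel

theorem ip_coreOp (hn : n₁ + n₂ = n + 1) (b : Fin n → Fin s → ℂ)
    (D E : Matrix (Fin n₁ × Fin s) (Fin n₂) ℂ) :
    ip (coreOp hn b D) E = ∑ i, (star (sense b (opGAdj n D) i) * sense b (opGAdj n E) i).re +
      (ip D E - ip (opGAdj n D) (opGAdj n E)) := by
  rw [coreOp, ip_add_left, ip_sub_left, ip_opG, ip_opG, ip_senseAdj]

theorem ip_coreOp_comm (hn : n₁ + n₂ = n + 1) (b : Fin n → Fin s → ℂ)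
    (D E : Matrix (Fin n₁ × Fin s) (Fin n₂) ℂ) : ip (coreOp hn b D) E = ip (coreOp hn b E) D := by
  rw [ip_coreOp, ip_coreOp, ip_comm D E, ip_comm (opGAdj n D)]
  congr 1
  refine Finset.sum_congr rfl fun i _ => ?_
  simp [mul_comm]

theorem coreOp_add (hn : n₁ + n₂ = n + 1) (b : Fin n → Fin s → ℂ)
    (D E : Matrix (Fin n₁ × Fin s) (Fin n₂) ℂ) :
    coreOp hn b (D + E) = coreOp hn b D + coreOp hn b E := by
  have h : ∀ y z : Fin n → ℂ, senseAdj b (y + z) = senseAdj b y + senseAdj b z := by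
    intro y z
    ext
    simp [senseAdj, add_mul]
  simp only [coreOp, opGAdj_add, sense_add, opG_add, h]
  abel

theorem ip_coreOp_self (hn : n₁ + n₂ = n + 1) (b : Fin n → Fin s → ℂ)
    (D : Matrix (Fin n₁ × Fin s) (Fin n₂) ℂ) :
    ip (coreOp hn b D) D = ∑ i, ‖sense b (opGAdj n D) i‖ ^ 2 +
      (frobNorm D ^ 2 - frobNorm (opGAdj n D) ^ 2) := by
  rw [ip_coreOp, frobNorm_sq, frobNorm_sq]
  congr 1
  refine Finset.sum_congr rfl fun i _ => ?_
  rw [← Complex.normSq_eq_norm_sq, Complex.normSq_apply]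
  simp

theorem ip_coreOp_self_nonneg (hn : n₁ + n₂ = n + 1) (h₁ : 0 < n₁) (h₂ : 0 < n₂)
    (b : Fin n → Fin s → ℂ) (D : Matrix (Fin n₁ × Fin s) (Fin n₂) ℂ) :
    0 ≤ ip (coreOp hn b D) D := by
  rw [ip_coreOp_self, ← frobNorm_sub_opG_sq hn h₁ h₂]
  positivity

variable {B : ℝ}

/-- The sensing term contributes at most `B‖𝒢* D‖²` and the orthogonal complement its own squared
norm; since `B ≥ 1`, the two recombine into `B‖D‖²`. -/
theorem ip_coreOp_self_le (hn : n₁ + n₂ = n + 1) (h₁ : 0 < n₁) (h₂ : 0 < n₂)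
    (b : Fin n → Fin s → ℂ) (hB : 1 ≤ B) (hb : ∀ i, ∑ a, ‖b i a‖ ^ 2 ≤ B)
    (D : Matrix (Fin n₁ × Fin s) (Fin n₂) ℂ) : ip (coreOp hn b D) D ≤ B * frobNorm D ^ 2 := by
  rw [ip_coreOp_self]
  have h := sum_norm_sense_sq_le b hb (opGAdj n D)
  have h2 := frobNorm_sub_opG_sq hn h₁ h₂ D
  nlinarith [sq_nonneg (frobNorm (D - opG hn (opGAdj n D)))]

theorem frobNorm_coreOp_le (hn : n₁ + n₂ = n + 1) (h₁ : 0 < n₁) (h₂ : 0 < n₂)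
    (b : Fin n → Fin s → ℂ) (hB : 1 ≤ B) (hb : ∀ i, ∑ a, ‖b i a‖ ^ 2 ≤ B)
    (D : Matrix (Fin n₁ × Fin s) (Fin n₂) ℂ) : frobNorm (coreOp hn b D) ≤ 2 * B * frobNorm D := by
  have hD := frobNorm_nonneg D
  have h1 : frobNorm (senseAdj b (sense b (opGAdj n D))) ≤ B * frobNorm D := by
    refine (abs_le_of_sq_le_sq' ?_ (by positivity)).2
    have e1 := frobNorm_senseAdj_sq_le b hb (sense b (opGAdj n D))
    have e2 := sum_norm_sense_sq_le b hb (opGAdj n D)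
    have e3 := pow_le_pow_left₀ (frobNorm_nonneg _) (frobNorm_opGAdj_le hn h₁ h₂ D) 2
    calc _ ≤ _ := e1
      _ ≤ B * (B * frobNorm D ^ 2) := by gcongr; exact e2.trans (by gcongr)
      _ = _ := by ring
  have h2 : frobNorm (D - opG hn (opGAdj n D)) ≤ frobNorm D := by
    refine (abs_le_of_sq_le_sq' ?_ hD).2
    rw [frobNorm_sub_opG_sq hn h₁ h₂]
    linarith [sq_nonneg (frobNorm (opGAdj n D))]
  rw [coreOp]
  refine (frobNorm_add_le _ _).trans ?_
  rw [frobNorm_opG hn h₁ h₂]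
  nlinarith

/-! ### One gradient step -/

/-- The quadratic form of `coreOp` is nonnegative, so `⟨K(D+E), D+2E⟩ ≥ ½⟨K D, D⟩ - (5/2)⟨K E, E⟩`.
Near-isometry and `coercivity` give `0.45 σ (‖A‖² + ‖C‖²)`. By `hsmall` the quadratic remainders
take away at most `(5/8 + 5/16)/9` of `σ (‖A‖² + ‖C‖²)`, leaving more than one third. -/
theorem regularity (hn : n₁ + n₂ = n + 1) (h₁ : 0 < n₁) (h₂ : 0 < n₂)
    (b : Fin n → Fin s → ℂ) (hB : 1 ≤ B) (hb : ∀ i, ∑ a, ‖b i a‖ ^ 2 ≤ B) {σ : ℝ}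
    {L₀ A : Matrix (Fin n₁ × Fin s) (Fin r) ℂ} {R₀ C : Matrix (Fin n₂) (Fin r) ℂ}
    (hX : L₀ᴴ * L₀ = R₀ᴴ * R₀) (hK : (L₀ᴴ * A + R₀ᴴ * C)ᴴ = L₀ᴴ * A + R₀ᴴ * C)
    (hA : σ * frobNorm A ^ 2 ≤ ip A (A * (L₀ᴴ * L₀)))
    (hC : σ * frobNorm C ^ 2 ≤ ip C (C * (L₀ᴴ * L₀)))
    (hrip : frobNorm (opGAdj n (A * R₀ᴴ + L₀ * Cᴴ)) ^ 2 -
      ∑ i, ‖sense b (opGAdj n (A * R₀ᴴ + L₀ * Cᴴ)) i‖ ^ 2 ≤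
        1 / 10 * frobNorm (A * R₀ᴴ + L₀ * Cᴴ) ^ 2)
    (hsmall : B * (frobNorm A ^ 2 + frobNorm C ^ 2) ≤ σ / 9) :
    1 / 3 * (σ * (frobNorm A ^ 2 + frobNorm C ^ 2)) ≤
      ip (coreOp hn b ((L₀ + A) * (R₀ + C)ᴴ - L₀ * R₀ᴴ)) (A * (R₀ + C)ᴴ + (L₀ + A) * Cᴴ) +
      1 / 4 * ip ((L₀ + A)ᴴ * (L₀ + A) - (R₀ + C)ᴴ * (R₀ + C))
        ((L₀ + A)ᴴ * A - (R₀ + C)ᴴ * C) := by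
  have h1 := coercivity hX hK hA hC
  have h2 := ip_imbalance_ge (A := A) (B := C) hX
  set D := A * R₀ᴴ + L₀ * Cᴴ with hD
  set E := A * Cᴴ with hE
  have e1 : (L₀ + A) * (R₀ + C)ᴴ - L₀ * R₀ᴴ = D + E := by
    rw [Matrix.conjTranspose_add, Matrix.add_mul, Matrix.mul_add, Matrix.mul_add, hD, hE]; abel
  have e2 : A * (R₀ + C)ᴴ + (L₀ + A) * Cᴴ = D + (2 : ℝ) • E := by
    rw [Matrix.conjTranspose_add, Matrix.add_mul, Matrix.mul_add, hD, hE, two_smul]; abel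
  rw [e1, e2]
  clear_value D E
  rw [coreOp_add, ip_add_left, ip_add_right, ip_add_right, ip_smul_right, ip_smul_right,
    ip_coreOp_comm hn b E D]
  set x := frobNorm A ^ 2 with hx
  set y := frobNorm C ^ 2 with hy
  have hx0 : 0 ≤ x := sq_nonneg _
  have hy0 : 0 ≤ y := sq_nonneg _
  have h3 : ip (coreOp hn b E) E ≤ B * ((x + y) ^ 2 / 4) := by
    refine (ip_coreOp_self_le hn h₁ h₂ b hB hb E).trans ?_
    have h := pow_le_pow_left₀ (frobNorm_nonneg _) (frobNorm_mul_le A Cᴴ) 2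
    rw [← hE, mul_pow, frobNorm_conjTranspose] at h
    gcongr
    refine h.trans ?_
    nlinarith [sq_nonneg (x - y)]
  have h4 : frobNorm (Aᴴ * A - Cᴴ * C) ^ 2 ≤ (x + y) ^ 2 := by
    refine pow_le_pow_left₀ (frobNorm_nonneg _) ((frobNorm_sub_le _ _).trans ?_) 2
    have h5 := frobNorm_mul_le Aᴴ A
    have h6 := frobNorm_mul_le Cᴴ C
    rw [frobNorm_conjTranspose, ← sq] at h5 h6
    linarith
  have h5 : 9 / 10 * frobNorm D ^ 2 ≤ ip (coreOp hn b D) D := by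
    rw [ip_coreOp_self]; linarith
  -- Cauchy-Schwarz for the form of `coreOp`, obtained by expanding it at `D + 3E`.
  have h6 : -(1 / 2 * ip (coreOp hn b D) D + 9 / 2 * ip (coreOp hn b E) E) ≤
      3 * ip (coreOp hn b D) E := by
    have h := ip_coreOp_self_nonneg hn h₁ h₂ b (D + (3 : ℝ) • E)
    have hsm : coreOp hn b (D + (3 : ℝ) • E) =
        coreOp hn b D + (3 : ℝ) • coreOp hn b E := by
      have : (3 : ℝ) • E = E + (E + E) := by
        rw [show (3 : ℝ) = 1 + (1 + 1) by norm_num, add_smul, add_smul, one_smul]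
      rw [this, coreOp_add, coreOp_add, coreOp_add,
        show (3 : ℝ) = 1 + (1 + 1) by norm_num, add_smul, add_smul, one_smul]
    rw [hsm, ip_add_left, ip_add_right, ip_add_right, ip_smul_left, ip_smul_right, ip_smul_left,
      ip_smul_right, ip_coreOp_comm hn b E D] at h
    linarith
  have h7 : (x + y) ^ 2 ≤ B * (x + y) ^ 2 := le_mul_of_one_le_left (sq_nonneg _) hB
  have h8 : B * (x + y) ^ 2 ≤ σ / 9 * (x + y) := by
    have := mul_le_mul_of_nonneg_right hsmall (add_nonneg hx0 hy0)
    nlinarith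
  have h9 := sq_nonneg (frobNorm (L₀ᴴ * A - R₀ᴴ * C + (L₀ᴴ * A - R₀ᴴ * C)ᴴ))
  have h10 : 0 ≤ (x + y) ^ 2 := sq_nonneg _
  have h11 : 0 ≤ σ / 9 * (x + y) := h10.trans (h7.trans h8)
  nlinarith

/-- Within distance `w/3` of the target the factors have norm at most `4w/3`, and the residual and
the imbalance are of order `w g`. Each half of the gradient is then at most `8 B w² g`, whose square
contributes `64`. -/
theorem frobNorm_gradient_sq_le (hn : n₁ + n₂ = n + 1) (h₁ : 0 < n₁) (h₂ : 0 < n₂)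
    (b : Fin n → Fin s → ℂ) (hB : 1 ≤ B) (hb : ∀ i, ∑ a, ‖b i a‖ ^ 2 ≤ B) {w g : ℝ}
    {L₀ A : Matrix (Fin n₁ × Fin s) (Fin r) ℂ} {R₀ C : Matrix (Fin n₂) (Fin r) ℂ}
    (hX : L₀ᴴ * L₀ = R₀ᴴ * R₀) (hw : 0 ≤ w) (hg : 0 ≤ g) (hL : frobNorm L₀ ≤ w)
    (hR : frobNorm R₀ ≤ w) (hAC : frobNorm A ^ 2 + frobNorm C ^ 2 = g ^ 2) (hgw : g ≤ w / 3)
    {L : Matrix (Fin n₁ × Fin s) (Fin r) ℂ} {R : Matrix (Fin n₂) (Fin r) ℂ}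
    (hLA : L = L₀ + A) (hRC : R = R₀ + C) :
    let W := coreOp hn b (L * Rᴴ - L₀ * R₀ᴴ)
    frobNorm (W * R + (1 / 4 : ℂ) • (L * (Lᴴ * L - Rᴴ * R))) ^ 2 +
      frobNorm (Wᴴ * L + (1 / 4 : ℂ) • (R * (Rᴴ * R - Lᴴ * L))) ^ 2 ≤
      128 * (B * w ^ 2) ^ 2 * g ^ 2 := by
  intro W
  have hA0 := frobNorm_nonneg A
  have hC0 := frobNorm_nonneg C
  have hAg : frobNorm A ≤ g := (abs_le_of_sq_le_sq' (by nlinarith) hg).2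
  have hCg : frobNorm C ≤ g := (abs_le_of_sq_le_sq' (by nlinarith) hg).2
  have hsum : frobNorm A + frobNorm C ≤ 3 / 2 * g := by
    refine (abs_le_of_sq_le_sq' ?_ (by positivity)).2
    nlinarith [sq_nonneg (frobNorm A - frobNorm C)]
  have hL' : frobNorm L ≤ 4 / 3 * w := by
    rw [hLA]; linarith [frobNorm_add_le L₀ A]
  have hR' : frobNorm R ≤ 4 / 3 * w := by
    rw [hRC]; linarith [frobNorm_add_le R₀ C]
  have hD : frobNorm (L * Rᴴ - L₀ * R₀ᴴ) ≤ 2 * w * g := by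
    have e : L * Rᴴ - L₀ * R₀ᴴ = A * Rᴴ + L₀ * Cᴴ := by
      rw [hLA, hRC, Matrix.conjTranspose_add, Matrix.add_mul, Matrix.mul_add, Matrix.mul_add]; abel
    rw [e]
    have e1 := frobNorm_mul_le A Rᴴ
    have e2 := frobNorm_mul_le L₀ Cᴴ
    rw [frobNorm_conjTranspose] at e1 e2
    have e3 : frobNorm A * frobNorm R ≤ frobNorm A * (4 / 3 * w) := by gcongr
    have e4 : frobNorm L₀ * frobNorm C ≤ w * frobNorm C := by gcongr
    have e5 := mul_le_mul_of_nonneg_left hsum hw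
    have e6 := mul_nonneg hw hC0
    refine (frobNorm_add_le _ _).trans ?_
    linarith
  have hW : frobNorm W ≤ 4 * B * w * g := by
    refine (frobNorm_coreOp_le hn h₁ h₂ b hB hb _).trans ?_
    calc 2 * B * frobNorm (L * Rᴴ - L₀ * R₀ᴴ) ≤ 2 * B * (2 * w * g) := by gcongr
      _ = _ := by ring
  have hΛ : frobNorm (Lᴴ * L - Rᴴ * R) ≤ 7 / 2 * w * g := by
    have e : Lᴴ * L - Rᴴ * R = (Aᴴ * L + L₀ᴴ * A) - (Cᴴ * R + R₀ᴴ * C) := by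
      rw [hLA, hRC, Matrix.conjTranspose_add, Matrix.conjTranspose_add, Matrix.add_mul L₀ᴴ,
        Matrix.add_mul R₀ᴴ, Matrix.mul_add L₀ᴴ, Matrix.mul_add R₀ᴴ, hX]
      abel
    rw [e]
    have e1 := frobNorm_mul_le Aᴴ L
    have e2 := frobNorm_mul_le L₀ᴴ A
    have e3 := frobNorm_mul_le Cᴴ R
    have e4 := frobNorm_mul_le R₀ᴴ C
    rw [frobNorm_conjTranspose] at e1 e2 e3 e4
    have f1 : frobNorm A * frobNorm L ≤ frobNorm A * (4 / 3 * w) := by gcongr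
    have f2 : frobNorm L₀ * frobNorm A ≤ w * frobNorm A := by gcongr
    have f3 : frobNorm C * frobNorm R ≤ frobNorm C * (4 / 3 * w) := by gcongr
    have f4 : frobNorm R₀ * frobNorm C ≤ w * frobNorm C := by gcongr
    have f5 := mul_le_mul_of_nonneg_left hsum hw
    refine (frobNorm_sub_le _ _).trans ((add_le_add (frobNorm_add_le _ _)
      (frobNorm_add_le _ _)).trans ?_)
    linarith
  have hBwg : 0 ≤ w ^ 2 * g := by positivity
  have hBwg' : w ^ 2 * g ≤ B * (w ^ 2 * g) := le_mul_of_one_le_left hBwg hB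
  have bound : ∀ {p q : Type} [Fintype p] [Fintype q] (Y : Matrix p q ℂ) (M : Matrix q (Fin r) ℂ)
      (M' : Matrix p (Fin r) ℂ) (Λ : Matrix (Fin r) (Fin r) ℂ), frobNorm Y ≤ 4 * B * w * g →
      frobNorm M ≤ 4 / 3 * w → frobNorm M' ≤ 4 / 3 * w → frobNorm Λ ≤ 7 / 2 * w * g →
      frobNorm (Y * M + (1 / 4 : ℂ) • (M' * Λ)) ^ 2 ≤ 64 * (B * w ^ 2) ^ 2 * g ^ 2 := by
    intro p q _ _ Y M M' Λ hY hM hM' hΛ'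
    have e1 : frobNorm (Y * M) ≤ 4 * B * w * g * (4 / 3 * w) :=
      (frobNorm_mul_le _ _).trans (mul_le_mul hY hM (frobNorm_nonneg _) (by positivity))
    have e2 : frobNorm (M' * Λ) ≤ 4 / 3 * w * (7 / 2 * w * g) :=
      (frobNorm_mul_le _ _).trans (mul_le_mul hM' hΛ' (frobNorm_nonneg _) (by positivity))
    have e3 : frobNorm (Y * M + (1 / 4 : ℂ) • (M' * Λ)) ≤ 8 * (B * w ^ 2) * g := by
      refine (frobNorm_add_le _ _).trans ?_
      rw [quarter_smul_eq, frobNorm_real_smul, abs_of_pos (by norm_num)]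
      linarith
    calc _ ≤ (8 * (B * w ^ 2) * g) ^ 2 := pow_le_pow_left₀ (frobNorm_nonneg _) e3 2
      _ = _ := by ring
  have b1 := bound W R L _ hW hR' hL' hΛ
  have b2 := bound Wᴴ L R (Rᴴ * R - Lᴴ * L) (by rwa [frobNorm_conjTranspose]) hL' hR'
    (by rwa [frobNorm_sub_comm])
  linarith

end Core

/-! ### The balanced factors of the target -/

section Target

variable {p q k : Type*} [Fintype p] [Fintype q] [Fintype k] {r : ℕ}

theorem realDiag_conjTranspose (d : Fin r → ℝ) : (realDiag d)ᴴ = realDiag d := by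
  rw [realDiag, Matrix.diagonal_conjTranspose]
  congr 1
  ext l
  simp

theorem realDiag_sqrt_mul_self {d : Fin r → ℝ} (hd : ∀ l, 0 ≤ d l) :
    realDiag (fun l => Real.sqrt (d l)) * realDiag (fun l => Real.sqrt (d l)) = realDiag d := by
  rw [realDiag, Matrix.diagonal_mul_diagonal, realDiag]
  congr 1
  ext l
  rw [← Complex.ofReal_mul, Real.mul_self_sqrt (hd l)]

theorem gram_factor {U : Matrix p (Fin r) ℂ} (hU : Uᴴ * U = 1) {d : Fin r → ℝ}
    (hd : ∀ l, 0 ≤ d l) (Q : Matrix (Fin r) (Fin r) ℂ) :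
    (U * realDiag (fun l => Real.sqrt (d l)) * Q)ᴴ * (U * realDiag (fun l => Real.sqrt (d l)) * Q) =
      Qᴴ * realDiag d * Q := by
  rw [Matrix.conjTranspose_mul, Matrix.conjTranspose_mul, realDiag_conjTranspose]
  simp only [Matrix.mul_assoc]
  rw [← Matrix.mul_assoc Uᴴ, hU, Matrix.one_mul, ← Matrix.mul_assoc (realDiag _),
    realDiag_sqrt_mul_self hd]

theorem factor_mul_conjTranspose (U : Matrix p (Fin r) ℂ) (V : Matrix q (Fin r) ℂ) {d : Fin r → ℝ}
    (hd : ∀ l, 0 ≤ d l) {Q : Matrix (Fin r) (Fin r) ℂ} (hQ : Q * Qᴴ = 1) :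
    (U * realDiag (fun l => Real.sqrt (d l)) * Q) * (V * realDiag (fun l => Real.sqrt (d l)) * Q)ᴴ =
      U * realDiag d * Vᴴ := by
  rw [Matrix.conjTranspose_mul, Matrix.conjTranspose_mul, realDiag_conjTranspose]
  simp only [Matrix.mul_assoc]
  rw [← Matrix.mul_assoc Q, hQ, Matrix.one_mul, ← Matrix.mul_assoc (realDiag _) (realDiag _),
    realDiag_sqrt_mul_self hd]

theorem le_ip_mul_gram {d : Fin r → ℝ} {σ : ℝ} (hσ : ∀ l, σ ≤ d l)
    {Q : Matrix (Fin r) (Fin r) ℂ} (hQ : Qᴴ * Q = 1) (A : Matrix k (Fin r) ℂ) :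
    σ * frobNorm A ^ 2 ≤ ip A (A * (Qᴴ * realDiag d * Q)) := by
  have h1 : frobNorm (A * Qᴴ) = frobNorm A :=
    frobNorm_mul_unitary _ (by rwa [Matrix.conjTranspose_conjTranspose])
  have h2 : ip A (A * (Qᴴ * realDiag d * Q)) = ip (A * Qᴴ) (A * Qᴴ * realDiag d) := by
    rw [ip_mul_right, Matrix.conjTranspose_conjTranspose]
    simp only [Matrix.mul_assoc]
  rw [← h1, h2, frobNorm_sq_eq_sum, ip_eq_sum, Finset.mul_sum]
  refine Finset.sum_le_sum fun i _ => ?_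
  rw [Finset.mul_sum]
  refine Finset.sum_le_sum fun l _ => ?_
  rw [realDiag, Matrix.mul_diagonal, ← mul_assoc, Complex.re_mul_ofReal]
  have : (star ((A * Qᴴ) i l) * (A * Qᴴ) i l).re = ‖(A * Qᴴ) i l‖ ^ 2 := by
    rw [← Complex.normSq_eq_norm_sq, Complex.normSq_apply]
    simp
  rw [this, mul_comm]
  exact mul_le_mul_of_nonneg_left (hσ l) (sq_nonneg _)

theorem frobNorm_factor_sq_le {U : Matrix p (Fin r) ℂ} (hU : Uᴴ * U = 1) {d : Fin r → ℝ} {σ : ℝ}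
    (hσ : 0 ≤ σ) (hd : ∀ l, d l ≤ σ) {Q : Matrix (Fin r) (Fin r) ℂ} (hQ : Q * Qᴴ = 1) :
    frobNorm (U * realDiag (fun l => Real.sqrt (d l)) * Q) ^ 2 ≤ r * σ := by
  rw [frobNorm_mul_unitary _ hQ]
  refine (frobNorm_mul_realDiag_sq_le U (c := Real.sqrt σ) (fun l => Real.sqrt_nonneg _)
    fun l => Real.sqrt_le_sqrt (hd l)).trans ?_
  rw [Real.sq_sqrt hσ, frobNorm_orthonormal_sq hU, mul_comm]

/-- A matrix of the form `A Vᴴ + U C` can be rewritten in that form with orthogonal summands. -/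
theorem exists_tangent_coordinates {U : Matrix p (Fin r) ℂ} {V : Matrix q (Fin r) ℂ}
    (hU : Uᴴ * U = 1) (hV : Vᴴ * V = 1) (A : Matrix p (Fin r) ℂ) (C : Matrix (Fin r) q ℂ) :
    ∃ (A' : Matrix p (Fin r) ℂ) (C' : Matrix (Fin r) q ℂ), A' * Vᴴ + U * C' = A * Vᴴ + U * C ∧
      frobNorm A' ^ 2 + frobNorm C' ^ 2 = frobNorm (A * Vᴴ + U * C) ^ 2 := by
  refine ⟨A - U * (Uᴴ * A), Uᴴ * A * Vᴴ + C, ?_, ?_⟩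
  · rw [Matrix.sub_mul, Matrix.mul_add]
    simp only [Matrix.mul_assoc]
    abel
  · have h1 : A * Vᴴ + U * C = (A - U * (Uᴴ * A)) * Vᴴ + U * (Uᴴ * A * Vᴴ + C) := by
      rw [Matrix.sub_mul, Matrix.mul_add]
      simp only [Matrix.mul_assoc]
      abel
    rw [h1, frobNorm_add_sq ((A - U * (Uᴴ * A)) * Vᴴ), frobNorm_orthonormal_mul _ hU,
      frobNorm_mul_conjTranspose_orthonormal _ hV]
    have h2 : ip ((A - U * (Uᴴ * A)) * Vᴴ) (U * (Uᴴ * A * Vᴴ + C)) = 0 := by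
      rw [ip_comm, ip_mul_left, ← Matrix.mul_assoc Uᴴ, Matrix.mul_sub, ← Matrix.mul_assoc Uᴴ U, hU,
        Matrix.one_mul, sub_self, Matrix.zero_mul, ip_comm, ip_zero_left]
    rw [h2]
    ring

end Target

/-! ### Convergence on a good event -/

section Convergence

variable {s n n₁ n₂ r : ℕ} {hn : n₁ + n₂ = n + 1} {b : Fin n → Fin s → ℂ}
  {X : Matrix (Fin s) (Fin n) ℂ} {U : Matrix (Fin n₁ × Fin s) (Fin r) ℂ} {d : Fin r → ℝ}
  {V : Matrix (Fin n₂) (Fin r) ℂ} {B σ σ₁ η : ℝ}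

/-- Expand the square: `regularity` supplies a decrease of `(2/3) η σ g²`, while the step size
limits the second-order term to `(128/9000) η σ g²`. The difference leaves ample room for the rate
`σ/72`. -/
theorem frobNorm_gradient_step_sq_le (h₁ : 0 < n₁) (h₂ : 0 < n₂) (hX : IsSVD (hankel hn X) U d V)
    (hσ : 0 < σ) (hσd : ∀ l, σ ≤ d l) (hd : ∀ l, d l ≤ σ₁) (hr : 0 < r)
    (hB : 1 ≤ B) (hb : ∀ i, ∑ a, ‖b i a‖ ^ 2 ≤ B)
    (hrip : ∀ A C, |∑ i, ‖sense b (opGAdj n (A * Vᴴ + U * C)) i‖ ^ 2 -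
      frobNorm (opGAdj n (A * Vᴴ + U * C)) ^ 2| ≤ 1 / 10 * (frobNorm A ^ 2 + frobNorm C ^ 2))
    (hη0 : 0 ≤ η) (hη : η * (9000 * (B * (r * σ₁)) ^ 2) ≤ σ) (M : Factors s n₁ n₂ r)
    {Q : Matrix (Fin r) (Fin r) ℂ} (hQ : Q ∈ Matrix.unitaryGroup (Fin r) ℂ)
    (hK : ((balanced U d V * Q)ᴴ * M)ᴴ = (balanced U d V * Q)ᴴ * M)
    (hM : B * frobNorm (M - balanced U d V * Q) ^ 2 ≤ σ / 9) :
    frobNorm (M - η • grad hn b (sense b X) M - balanced U d V * Q) ^ 2 ≤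
      (1 - η * (σ / 72)) * frobNorm (M - balanced U d V * Q) ^ 2 := by
  have hQ1 : Q * Qᴴ = 1 := Matrix.mem_unitaryGroup_iff.1 hQ
  have hQ2 : Qᴴ * Q = 1 := Matrix.mem_unitaryGroup_iff'.1 hQ
  have hσ₁ : σ ≤ σ₁ := (hσd ⟨0, hr⟩).trans (hd _)
  set L₀ := U * realDiag (fun l => Real.sqrt (d l)) * Q with hL₀
  set R₀ := V * realDiag (fun l => Real.sqrt (d l)) * Q with hR₀
  have hG : balanced U d V * Q = Matrix.fromRows L₀ R₀ := balanced_mul U d V Q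
  have hLS : L₀ᴴ * L₀ = Qᴴ * realDiag d * Q := gram_factor hX.left_orthonormal hX.nonneg Q
  have hRS : R₀ᴴ * R₀ = Qᴴ * realDiag d * Q := gram_factor hX.right_orthonormal hX.nonneg Q
  have hLR : L₀ᴴ * L₀ = R₀ᴴ * R₀ := hLS.trans hRS.symm
  have hZ : L₀ * R₀ᴴ = hankel hn X := by
    rw [hL₀, hR₀, factor_mul_conjTranspose U V hX.nonneg hQ1, ← hX.eq_mul]
  have hco : ∀ {k : Type} [Fintype k] (Y : Matrix k (Fin r) ℂ),
      σ * frobNorm Y ^ 2 ≤ ip Y (Y * (L₀ᴴ * L₀)) := by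
    intro k _ Y
    rw [hLS]
    exact le_ip_mul_gram hσd hQ2 Y
  have hL₀n : frobNorm L₀ ≤ Real.sqrt (r * σ₁) :=
    Real.le_sqrt_of_sq_le (frobNorm_factor_sq_le hX.left_orthonormal (hσ.le.trans hσ₁) hd hQ1)
  have hR₀n : frobNorm R₀ ≤ Real.sqrt (r * σ₁) :=
    Real.le_sqrt_of_sq_le (frobNorm_factor_sq_le hX.right_orthonormal (hσ.le.trans hσ₁) hd hQ1)
  obtain ⟨A, C, rfl⟩ : ∃ A C, M = Matrix.fromRows (L₀ + A) (R₀ + C) :=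
    ⟨M.toRows₁ - L₀, M.toRows₂ - R₀, by
      rw [add_sub_cancel, add_sub_cancel, Matrix.fromRows_toRows]⟩
  have hH : Matrix.fromRows (L₀ + A) (R₀ + C) - balanced U d V * Q = Matrix.fromRows A C := by
    rw [hG, fromRows_sub_fromRows, add_sub_cancel_left, add_sub_cancel_left]
  have hK' : (L₀ᴴ * A + R₀ᴴ * C)ᴴ = L₀ᴴ * A + R₀ᴴ * C := by
    have e : L₀ᴴ * A + R₀ᴴ * C = (balanced U d V * Q)ᴴ * Matrix.fromRows (L₀ + A) (R₀ + C) -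
        (L₀ᴴ * L₀ + R₀ᴴ * R₀) := by
      rw [hG, fromRows_conjTranspose_mul, Matrix.mul_add, Matrix.mul_add]; abel
    rw [e, Matrix.conjTranspose_sub, hK, Matrix.conjTranspose_add,
      (Matrix.isHermitian_conjTranspose_mul_self L₀).eq,
      (Matrix.isHermitian_conjTranspose_mul_self R₀).eq]
  have hg2 : frobNorm A ^ 2 + frobNorm C ^ 2 = frobNorm (Matrix.fromRows A C) ^ 2 :=
    (frobNorm_fromRows_sq _ _).symm
  rw [hH] at hM
  have hD : frobNorm (opGAdj n (A * R₀ᴴ + L₀ * Cᴴ)) ^ 2 -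
      ∑ i, ‖sense b (opGAdj n (A * R₀ᴴ + L₀ * Cᴴ)) i‖ ^ 2 ≤
        1 / 10 * frobNorm (A * R₀ᴴ + L₀ * Cᴴ) ^ 2 := by
    have e : A * R₀ᴴ + L₀ * Cᴴ = (A * (Qᴴ * realDiag fun l => Real.sqrt (d l))) * Vᴴ +
        U * ((realDiag (fun l => Real.sqrt (d l)) * Q) * Cᴴ) := by
      rw [hR₀, hL₀, Matrix.conjTranspose_mul, Matrix.conjTranspose_mul, realDiag_conjTranspose]
      simp only [Matrix.mul_assoc]
    rw [e]
    -- `hrip` is stated through coordinates; orthogonal ones turn its right side into the squared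
    -- norm of the tangent matrix itself.
    obtain ⟨A', C', h1, h2⟩ := exists_tangent_coordinates hX.left_orthonormal hX.right_orthonormal
      (A * (Qᴴ * realDiag fun l => Real.sqrt (d l)))
      ((realDiag (fun l => Real.sqrt (d l)) * Q) * Cᴴ)
    rw [← h2, ← h1]
    exact (le_abs_self _).trans (by rw [abs_sub_comm]; exact hrip A' C')
  have hreg := regularity hn h₁ h₂ b hB hb hLR hK' (hco A) (hco C) hD (by rwa [hg2])
  set g := frobNorm (Matrix.fromRows A C) with hg
  have hg0 : 0 ≤ g := frobNorm_nonneg _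
  have hr1 : (1 : ℝ) ≤ r := by exact_mod_cast hr
  have hν : σ ≤ r * σ₁ := hσ₁.trans (le_mul_of_one_le_left (hσ.le.trans hσ₁) hr1)
  have hw2 : Real.sqrt (r * σ₁) ^ 2 = r * σ₁ := Real.sq_sqrt (hσ.le.trans hν)
  have hgw : g ≤ Real.sqrt (r * σ₁) / 3 := by
    refine (abs_le_of_sq_le_sq' ?_ (by positivity)).2
    rw [div_pow, hw2]
    have : g ^ 2 ≤ B * g ^ 2 := le_mul_of_one_le_left (sq_nonneg _) hB
    linarith
  have hgrad := frobNorm_gradient_sq_le hn h₁ h₂ b hB hb hLR (Real.sqrt_nonneg (r * σ₁)) hg0 hL₀n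
    hR₀n hg2 hgw rfl rfl
  simp only at hgrad
  rw [hw2, hZ, ← gradCore_eq hn h₁ h₂] at hgrad
  rw [hZ, ← gradCore_eq hn h₁ h₂, ← ip_gradient, hg2] at hreg
  set Gr := grad hn b (sense b X) (Matrix.fromRows (L₀ + A) (R₀ + C)) with hGr
  have hGr' : Gr = Matrix.fromRows
      (gradCore hn b (sense b X) (L₀ + A) (R₀ + C) * (R₀ + C) +
        (1 / 4 : ℂ) • ((L₀ + A) * ((L₀ + A)ᴴ * (L₀ + A) - (R₀ + C)ᴴ * (R₀ + C))))
      ((gradCore hn b (sense b X) (L₀ + A) (R₀ + C))ᴴ * (L₀ + A) +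
        (1 / 4 : ℂ) • ((R₀ + C) * ((R₀ + C)ᴴ * (R₀ + C) - (L₀ + A)ᴴ * (L₀ + A)))) := by
    rw [hGr, grad]
    simp only [Matrix.toRows₁_fromRows, Matrix.toRows₂_fromRows]
  rw [← ip_fromRows, ← hGr'] at hreg
  rw [← frobNorm_fromRows_sq, ← hGr'] at hgrad
  have hstep : Matrix.fromRows (L₀ + A) (R₀ + C) - η • Gr - balanced U d V * Q =
      Matrix.fromRows A C - η • Gr := by
    rw [← hH]; abel
  rw [hstep, hH]
  clear_value Gr
  rw [frobNorm_sub_sq (Matrix.fromRows A C) (η • Gr), ip_smul_right, frobNorm_real_smul, mul_pow,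
    sq_abs, ip_comm]
  have h1 : η ^ 2 * frobNorm Gr ^ 2 ≤ η * (128 / 9000 * (σ * g ^ 2)) := by
    calc η ^ 2 * frobNorm Gr ^ 2 ≤ η ^ 2 * (128 * (B * (r * σ₁)) ^ 2 * g ^ 2) := by gcongr
      _ = η * (128 / 9000 * (η * (9000 * (B * (r * σ₁)) ^ 2) * g ^ 2)) := by ring
      _ ≤ η * (128 / 9000 * (σ * g ^ 2)) := by gcongr
  have h2 := mul_le_mul_of_nonneg_left hreg hη0
  have h3 : 0 ≤ η * (σ * g ^ 2) := by positivity
  linarith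

/-- Induction on `t`, re-aligning the target at each iterate. Every rotation of the target is
feasible, so each projection can be compared with the rotation optimal before it. -/
theorem rotDist_sq_le_of_isPGDRun {μ₁ μ ε c : ℝ} (h₁ : 0 < n₁) (h₂ : 0 < n₂)
    (hX : IsSVD (hankel hn X) U d V) (hinc : Incoherent n μ₁ U V) (hμ₁ : μ₁ ≤ μ)
    (hσ : 0 < σ) (hσd : ∀ l, σ ≤ d l) (hd : ∀ l, d l ≤ σ₁) (hr : 0 < r)
    (hB : 1 ≤ B) (hb : ∀ i, ∑ a, ‖b i a‖ ^ 2 ≤ B)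
    (hrip : ∀ A C, |∑ i, ‖sense b (opGAdj n (A * Vᴴ + U * C)) i‖ ^ 2 -
      frobNorm (opGAdj n (A * Vᴴ + U * C)) ^ 2| ≤ 1 / 10 * (frobNorm A ^ 2 + frobNorm C ^ 2))
    (hε : 0 < ε) (hε3 : ε ≤ 1 / 3) (hc : 0 ≤ c) (hcε : 8 * r * c ^ 2 ≤ 2 / 5 * (ε ^ 2 * σ ^ 2 / B))
    (hinit : ∀ Y : Matrix (Fin n₂) (Fin r) ℂ,
      frobNorm ((hankel hn (senseAdj b (sense b X)) - hankel hn X) * Y) ≤ c * frobNorm Y)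
    (hη0 : 0 ≤ η) (hη : η * (9000 * (B * (r * σ₁)) ^ 2) ≤ σ) {M : ℕ → Factors s n₁ n₂ r}
    (hM : IsPGDRun hn hr b (sense b X) μ ε η M) (t : ℕ) :
    rotDist (M t) (balanced U d V) ^ 2 ≤ (1 - η * (σ / 72)) ^ t * (ε ^ 2 * σ / B) := by
  obtain ⟨Z₀, U', d', V', hbest, hZ₀, hM0, hMt⟩ := hM
  have hB0 : 0 < B := by linarith
  have hZ := (frobNorm_sub_sq_le_of_isBestRankApprox hX hZ₀ hbest hc hinit).trans hcε
  have hσ₁ : σ ≤ σ₁ := (hσd ⟨0, hr⟩).trans (hd _)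
  -- The spectral error is at most `ε σ`, so the leading singular value of the initialization is at
  -- least `1 - ε` times the true one; this is the reason for the division in the algorithm.
  have hd0 : ∀ l, d l ≤ d' ⟨0, hr⟩ / (1 - ε) := by
    intro l
    refine (hX.antitone (Fin.mk_le_of_le_val (Nat.zero_le _)) : d l ≤ d ⟨0, hr⟩).trans ?_
    rw [le_div_iff₀ (by linarith)]
    have h1 := hX.head_le hZ₀ hr
    have h2 : frobNorm (Z₀ - hankel hn X) ≤ ε * d ⟨0, hr⟩ := by
      have h3 : frobNorm (Z₀ - hankel hn X) ≤ ε * σ := by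
        refine (abs_le_of_sq_le_sq' (hZ.trans ?_) (by positivity)).2
        rw [mul_pow]
        have : ε ^ 2 * σ ^ 2 / B ≤ ε ^ 2 * σ ^ 2 := div_le_self (by positivity) hB
        nlinarith [sq_nonneg (ε * σ)]
      exact h3.trans (mul_le_mul_of_nonneg_left (hσd _) hε.le)
    linarith
  have hd'0 : 0 ≤ d' ⟨0, hr⟩ / (1 - ε) := hσ.le.trans ((hσd ⟨0, hr⟩).trans (hd0 _))
  have hfeas : ∀ Q ∈ Matrix.unitaryGroup (Fin r) ℂ, balanced U d V * Q ∈
      (feasible n μ (d' ⟨0, hr⟩ / (1 - ε)) : Set (Factors s n₁ n₂ r)) :=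
    fun Q hQ => balanced_mul_mem_feasible hQ hinc hμ₁ hd0 hd'0
  have hν : σ ≤ r * σ₁ := hσ₁.trans (le_mul_of_one_le_left (hσ.le.trans hσ₁) (by exact_mod_cast hr))
  have hrate0 : 0 ≤ η * (σ / 72) := by positivity
  have hrate1 : η * (σ / 72) ≤ 1 := by
    have h1 : σ ≤ B * (r * σ₁) := hν.trans (le_mul_of_one_le_left (hσ.le.trans hν) hB)
    have h2 : η * (9000 * σ ^ 2) ≤ σ := le_trans (by gcongr) hη
    have h3 : η * σ * 9000 ≤ 1 := by
      refine le_of_mul_le_mul_right ?_ hσ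
      calc η * σ * 9000 * σ = η * (9000 * σ ^ 2) := by ring
        _ ≤ 1 * σ := by rwa [one_mul]
    nlinarith
  induction t with
  | zero =>
    obtain ⟨Q, hQ, -, hK, hpos⟩ := exists_aligned (balanced U' d' V') (balanced U d V)
    have hQ1 : Q * Qᴴ = 1 := Matrix.mem_unitaryGroup_iff.1 hQ
    have hQ2 : Qᴴ * Q = 1 := Matrix.mem_unitaryGroup_iff'.1 hQ
    have h1 := frobNorm_projection_sub_le (feasible_convex μ _) hM0 (hfeas Q hQ)
    have h2 : rotDist (M 0) (balanced U d V) ^ 2 ≤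
        frobNorm (balanced U' d' V' - balanced U d V * Q) ^ 2 :=
      pow_le_pow_left₀ (rotDist_nonneg _ _) ((rotDist_le _ _ hQ).trans h1) 2
    have hbal : balanced U' d' V' = balanced U' d' V' * (1 : Matrix (Fin r) (Fin r) ℂ) := (Matrix.mul_one _).symm
    rw [balanced_mul, hbal, balanced_mul] at hK hpos
    have h3 := frobNorm_sub_sq_le_of_balanced
      ((gram_factor hZ₀.left_orthonormal hZ₀.nonneg 1).trans
        (gram_factor hZ₀.right_orthonormal hZ₀.nonneg 1).symm)
      ((gram_factor hX.left_orthonormal hX.nonneg Q).trans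
        (gram_factor hX.right_orthonormal hX.nonneg Q).symm) hK hpos
      (by rw [gram_factor hX.left_orthonormal hX.nonneg Q]; exact fun A => le_ip_mul_gram hσd hQ2 A)
    rw [factor_mul_conjTranspose U V hX.nonneg hQ1,
      factor_mul_conjTranspose U' V' hZ₀.nonneg (by simp), ← hX.eq_mul, ← hZ₀.eq_mul,
      ← balanced_mul, ← balanced_mul, Matrix.mul_one] at h3
    rw [pow_zero, one_mul]
    refine h2.trans ?_
    rw [le_div_iff₀ hB0]
    have h4 := h3.trans hZ
    rw [← mul_div_assoc, le_div_iff₀ hB0] at h4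
    refine le_of_mul_le_mul_left ?_ hσ
    nlinarith
  | succ t ih =>
    obtain ⟨Q, hQ, hdist, hK, -⟩ := exists_aligned (M t) (balanced U d V)
    have h1 := frobNorm_projection_sub_le (feasible_convex μ _) (hMt t) (hfeas Q hQ)
    -- The rate lies in `[0, 1]`, so the iterate is no farther than the initial bound; `ε ≤ 1/3`
    -- gives the `1/9`.
    have hsm : B * frobNorm (M t - balanced U d V * Q) ^ 2 ≤ σ / 9 := by
      rw [← hdist]
      have h2 : (1 - η * (σ / 72)) ^ t * (ε ^ 2 * σ / B) ≤ ε ^ 2 * σ / B :=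
        mul_le_of_le_one_left (by positivity) (pow_le_one₀ (by linarith) (by linarith))
      have h3 := ih.trans h2
      rw [le_div_iff₀ hB0] at h3
      have h4 : ε ^ 2 ≤ 1 / 9 := by nlinarith
      nlinarith
    have h2 := frobNorm_gradient_step_sq_le h₁ h₂ hX hσ hσd hd hr hB hb hrip hη0 hη (M t) hQ hK hsm
    calc rotDist (M (t + 1)) (balanced U d V) ^ 2
        ≤ frobNorm (M (t + 1) - balanced U d V * Q) ^ 2 :=
          pow_le_pow_left₀ (rotDist_nonneg _ _) (rotDist_le _ _ hQ) 2
      _ ≤ frobNorm (M t - η • grad hn b (sense b X) (M t) - balanced U d V * Q) ^ 2 :=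
          pow_le_pow_left₀ (frobNorm_nonneg _) h1 2
      _ ≤ _ := h2
      _ = (1 - η * (σ / 72)) * rotDist (M t) (balanced U d V) ^ 2 := by rw [hdist]
      _ ≤ (1 - η * (σ / 72)) * ((1 - η * (σ / 72)) ^ t * (ε ^ 2 * σ / B)) :=
          mul_le_mul_of_nonneg_left ih (by linarith)
      _ = _ := by ring

end Convergence

/-! ### Normalization of the parameters, and near-isometry on the tangent space -/

section Assembly

variable {Ω : Type*} [MeasurableSpace Ω] {P : Measure Ω} [IsProbabilityMeasure P]
  {s n n₁ n₂ r : ℕ} {μ₀ : ℝ} {b : Fin n → Ω → Fin s → ℂ}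

/-- Isotropy gives each entry second moment `1`, which its almost sure bound must reach. -/
theorem SubspaceModel.one_le (hb : SubspaceModel P μ₀ b) (hs : 0 < s) (hn : 0 < n) : 1 ≤ μ₀ := by
  have h := hb.isotropic ⟨0, hn⟩ ⟨0, hs⟩ ⟨0, hs⟩
  rw [Matrix.one_apply_eq] at h
  have h1 : ‖∫ ω, b ⟨0, hn⟩ ω ⟨0, hs⟩ * star (b ⟨0, hn⟩ ω ⟨0, hs⟩) ∂P‖ ≤ μ₀ * P.real Set.univ := by
    refine norm_integral_le_of_norm_le_const ?_
    filter_upwards [hb.bounded ⟨0, hn⟩] with ω hω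
    rw [norm_mul, norm_star, ← sq]
    exact hω _
  rw [h] at h1
  simpa using h1

/-- Coordinates of the tangent space at a matrix with singular vectors `U`, `V`, followed by
`𝒢*`. -/
def tangentHom (n : ℕ) (U : Matrix (Fin n₁ × Fin s) (Fin r) ℂ) (V : Matrix (Fin n₂) (Fin r) ℂ) :
    (((Fin n₁ × Fin s) × Fin r) ⊕ (Fin r × Fin n₂) → ℂ) →ₗ[ℂ] Matrix (Fin s) (Fin n) ℂ where
  toFun x := opGAdj n (Matrix.of (fun p l => x (Sum.inl (p, l))) * Vᴴ +
    U * Matrix.of (fun l k => x (Sum.inr (l, k))))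
  map_add' x y := by
    rw [← opGAdj_add]
    congr 1
    have h1 : (Matrix.of fun p l => (x + y) (Sum.inl (p, l))) =
      Matrix.of (fun p l => x (Sum.inl (p, l))) + Matrix.of (fun p l => y (Sum.inl (p, l))) := rfl
    have h2 : (Matrix.of fun l k => (x + y) (Sum.inr (l, k))) =
      Matrix.of (fun l k => x (Sum.inr (l, k))) + Matrix.of (fun l k => y (Sum.inr (l, k))) := rfl
    rw [h1, h2, Matrix.add_mul, Matrix.mul_add]
    abel
  map_smul' c x := by
    rw [RingHom.id_apply, ← opGAdj_smul]
    congr 1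
    have h1 : (Matrix.of fun p l => (c • x) (Sum.inl (p, l))) =
      c • Matrix.of (fun p l => x (Sum.inl (p, l))) := rfl
    have h2 : (Matrix.of fun l k => (c • x) (Sum.inr (l, k))) =
      c • Matrix.of (fun l k => x (Sum.inr (l, k))) := rfl
    rw [h1, h2, Matrix.smul_mul, Matrix.mul_smul, smul_add]

/-- Each measurement of `A Vᴴ` or of `U C` is small because one of its factors is incoherent. Adding
the two summands doubles the bound, whence `ρ = 2 μ₀ s c`. -/
theorem measureReal_not_tangent_le (hb : SubspaceModel P μ₀ b) (hn : n₁ + n₂ = n + 1)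
    (h₁ : 0 < n₁) (h₂ : 0 < n₂) (hμ₀ : 0 ≤ μ₀)
    {U : Matrix (Fin n₁ × Fin s) (Fin r) ℂ} {V : Matrix (Fin n₂) (Fin r) ℂ}
    (hU : Uᴴ * U = 1) (hV : Vᴴ * V = 1) {c : ℝ} (hc : 0 ≤ c)
    (hUc : ∀ j, frobNorm (block U j) ^ 2 ≤ c) (hVc : ∀ k, rowNorm V k ^ 2 ≤ c)
    {δ : ℝ} (hδ : 0 < δ) {m : ℕ} (hm : 0 < m) (hmc : 2 * m * (2 * (μ₀ * s * c)) ≤ 1) :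
    P.real {ω | ¬ ∀ A C, |∑ i, ‖sense (fun i => b i ω) (opGAdj n (A * Vᴴ + U * C)) i‖ ^ 2 -
      frobNorm (opGAdj n (A * Vᴴ + U * C)) ^ 2| ≤ δ * (frobNorm A ^ 2 + frobNorm C ^ 2)} ≤
      ((n₁ * s * r + r * n₂ : ℕ) : ℝ) * (18 * m * (2 * (μ₀ * s * c)) / δ ^ 2) ^ m := by
  have hsum : ∀ x : ((Fin n₁ × Fin s) × Fin r) ⊕ (Fin r × Fin n₂) → ℂ, ∑ e, ‖x e‖ ^ 2 =
      frobNorm (Matrix.of fun p l => x (Sum.inl (p, l))) ^ 2 +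
        frobNorm (Matrix.of fun l k => x (Sum.inr (l, k))) ^ 2 := by
    intro x
    simp only [Fintype.sum_sum_type, Fintype.sum_prod_type, frobNorm_sq_eq_sum, Matrix.of_apply]
  have h := measureReal_not_nearIsometry_le hb (tangentHom n U V) (ρ := 2 * (μ₀ * s * c))
    (by positivity) ?_ ?_ hδ hm hmc
  · have hcard : Fintype.card (((Fin n₁ × Fin s) × Fin r) ⊕ (Fin r × Fin n₂)) =
        n₁ * s * r + r * n₂ := by simp
    rw [hcard] at h
    refine le_trans (measureReal_mono ?_) h
    intro ω hω hgood
    refine hω fun A C => ?_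
    have h' := hgood (Sum.elim (fun e => A e.1 e.2) (fun e => C e.1 e.2))
    rw [hsum] at h'
    exact h'
  · intro β hβ x i
    have hβ' : ∑ a, ‖β i a‖ ^ 2 ≤ μ₀ * s := by
      refine (Finset.sum_le_sum fun a _ => hβ i a).trans (le_of_eq ?_)
      simp [mul_comm]
    rw [hsum]
    simp only [tangentHom, LinearMap.coe_mk, AddHom.coe_mk]
    rw [opGAdj_add, sense_add, Pi.add_apply]
    set A : Matrix (Fin n₁ × Fin s) (Fin r) ℂ := Matrix.of fun p l => x (Sum.inl (p, l))
    set C : Matrix (Fin r) (Fin n₂) ℂ := Matrix.of fun l k => x (Sum.inr (l, k))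
    have e1 := norm_sense_opGAdj_mul_sq_le_right β i hβ' A V hVc hc
    have e2 := norm_sense_opGAdj_mul_sq_le_left β i hβ' U Cᴴ hUc hc
    rw [Matrix.conjTranspose_conjTranspose, frobNorm_conjTranspose] at e2
    have e3 := norm_add_le (sense β (opGAdj n (A * Vᴴ)) i) (sense β (opGAdj n (U * C)) i)
    have e4 := pow_le_pow_left₀ (norm_nonneg _) e3 2
    nlinarith [sq_nonneg (‖sense β (opGAdj n (A * Vᴴ)) i‖ - ‖sense β (opGAdj n (U * C)) i‖)]
  · intro x
    rw [hsum]
    simp only [tangentHom, LinearMap.coe_mk, AddHom.coe_mk]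
    set A : Matrix (Fin n₁ × Fin s) (Fin r) ℂ := Matrix.of fun p l => x (Sum.inl (p, l))
    set C : Matrix (Fin r) (Fin n₂) ℂ := Matrix.of fun l k => x (Sum.inr (l, k))
    have e1 := (frobNorm_opGAdj_le hn h₁ h₂ (A * Vᴴ + U * C)).trans (frobNorm_add_le _ _)
    rw [frobNorm_mul_conjTranspose_orthonormal _ hV, frobNorm_orthonormal_mul _ hU] at e1
    have e4 := pow_le_pow_left₀ (frobNorm_nonneg _) e1 2
    nlinarith [sq_nonneg (frobNorm A - frobNorm C)]

theorem le_card_of_orthonormal {V : Matrix (Fin n₂) (Fin r) ℂ} (hV : Vᴴ * V = 1) : r ≤ n₂ := by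
  have h1 : (Vᴴ * V).rank ≤ n₂ := by
    refine (Matrix.rank_mul_le_right _ _).trans ((Matrix.rank_le_card_height V).trans ?_)
    simp
  rw [hV, Matrix.rank_one] at h1
  simpa using h1

/-- The `n₂ ≤ n` squared row norms of `V` add up to `r`. -/
theorem one_le_incoherence {U : Matrix (Fin n₁ × Fin s) (Fin r) ℂ} {V : Matrix (Fin n₂) (Fin r) ℂ}
    {μ₁ : ℝ} (hinc : Incoherent n μ₁ U V) (hV : Vᴴ * V = 1) (hr : 0 < r) (hμ₁ : 0 < μ₁)
    (hn : n₂ ≤ n) : 1 ≤ μ₁ := by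
  have hn0 : 0 < n := hr.trans_le ((le_card_of_orthonormal hV).trans hn)
  have h1 := frobNorm_orthonormal_sq hV
  rw [← sum_rowNorm_sq] at h1
  have h2 := Finset.sum_le_sum fun k (_ : k ∈ Finset.univ) => hinc.2 k
  rw [h1] at h2
  simp only [Finset.sum_const, Finset.card_univ, Fintype.card_fin, nsmul_eq_mul] at h2
  have hr' : (0 : ℝ) < r := by exact_mod_cast hr
  have hn' : (0 : ℝ) < n := by exact_mod_cast hn0
  have h3 : (n₂ : ℝ) ≤ n := by exact_mod_cast hn
  have h4 : (n₂ : ℝ) * (μ₁ * r / n) ≤ n * (μ₁ * r / n) := by gcongr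
  have h5 : (n : ℝ) * (μ₁ * r / n) = μ₁ * r := by field_simp
  refine le_of_mul_le_mul_right ?_ hr'
  linarith

end Assembly

/-! ### Arithmetic of the sample size condition -/

section SampleSize

/-- Consequences of the sample size condition. -/
theorem sampleSize_consequences {N S R L μ₀ μ κ ε : ℝ} (hN : 0 < N) (hS : 1 ≤ S) (hR : 1 ≤ R)
    (hL : 1 / 2 ≤ L) (hμ₀ : 1 ≤ μ₀) (hμ : 1 ≤ μ) (hκ : 1 ≤ κ) (hε : 0 < ε) (hε3 : ε ≤ 1 / 3)
    (h : 100000 * (ε ^ 2)⁻¹ * μ₀ ^ 2 * μ * S ^ 2 * R ^ 2 * κ ^ 2 * L ^ 2 ≤ N) :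
    50000 * (μ₀ * S * (μ * R)) * L ≤ N ∧
      50000 * (μ₀ ^ 2 * μ * S ^ 2 * R ^ 2 * κ ^ 2) * L ≤ ε ^ 2 * N ∧
      1440 * (μ₀ ^ 3 * μ ^ 2 * S ^ 3 * R ^ 3 * κ ^ 2) * L ^ 2 ≤ ε ^ 2 * N ^ 2 := by
  have hε2 : 0 < ε ^ 2 := by positivity
  -- One logarithm is given up where a single power suffices; this costs the factor between `100000`
  -- and `50000`.
  have hL2 : L ≤ 2 * L ^ 2 := by nlinarith
  have h2 : 50000 * (μ₀ ^ 2 * μ * S ^ 2 * R ^ 2 * κ ^ 2) * L ≤ ε ^ 2 * N := by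
    calc 50000 * (μ₀ ^ 2 * μ * S ^ 2 * R ^ 2 * κ ^ 2) * L
        ≤ 50000 * (μ₀ ^ 2 * μ * S ^ 2 * R ^ 2 * κ ^ 2) * (2 * L ^ 2) := by gcongr
      _ = ε ^ 2 * (100000 * (ε ^ 2)⁻¹ * μ₀ ^ 2 * μ * S ^ 2 * R ^ 2 * κ ^ 2 * L ^ 2) := by
        field_simp
        ring
      _ ≤ ε ^ 2 * N := by gcongr
  have hε1 : ε ^ 2 ≤ 1 := by nlinarith
  have h1 : 50000 * (μ₀ * S * (μ * R)) * L ≤ N := by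
    have e1 : μ₀ * S * R ≤ (μ₀ * S * R) ^ 2 := by
      have : 1 ≤ μ₀ * S * R := one_le_mul_of_one_le_of_one_le
        (one_le_mul_of_one_le_of_one_le hμ₀ hS) hR
      nlinarith
    have e2 : (1 : ℝ) ≤ κ ^ 2 := one_le_pow₀ hκ
    calc 50000 * (μ₀ * S * (μ * R)) * L = 50000 * (μ₀ * S * R * μ * 1) * L := by ring
      _ ≤ 50000 * ((μ₀ * S * R) ^ 2 * μ * κ ^ 2) * L := by gcongr
      _ = 50000 * (μ₀ ^ 2 * μ * S ^ 2 * R ^ 2 * κ ^ 2) * L := by ring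
      _ ≤ ε ^ 2 * N := h2
      _ ≤ N := mul_le_of_le_one_left hN.le hε1
  refine ⟨h1, h2, ?_⟩
  calc 1440 * (μ₀ ^ 3 * μ ^ 2 * S ^ 3 * R ^ 3 * κ ^ 2) * L ^ 2
      ≤ 50000 * 50000 * (μ₀ ^ 3 * μ ^ 2 * S ^ 3 * R ^ 3 * κ ^ 2) * L ^ 2 := by gcongr; norm_num
    _ = (50000 * (μ₀ ^ 2 * μ * S ^ 2 * R ^ 2 * κ ^ 2) * L) * (50000 * (μ₀ * S * (μ * R)) * L) := by
      ring
    _ ≤ (ε ^ 2 * N) * N := by gcongr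
    _ = _ := by ring

/-- A moment of order `3 log(S N)` produces `(S N)^(-3)`, which beats the dimension of the
coordinate space. -/
theorem card_mul_pow_ceil_le {S N x : ℝ} {m : ℕ} {C : ℝ} (hSN : 1 ≤ S * N) (hC : C ≤ 2 * (S * N) ^ 2)
    (hx0 : 0 ≤ x) (hx : x ≤ Real.exp (-1)) (hm : 3 * Real.log (S * N) ≤ m) :
    C * x ^ m ≤ 2 * (S * N)⁻¹ := by
  have h0 : 0 < S * N := by linarith
  have h1 : x ^ m ≤ ((S * N) ^ 3)⁻¹ := by
    calc x ^ m ≤ Real.exp (-1) ^ m := pow_le_pow_left₀ hx0 hx m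
      _ = Real.exp (-m) := by rw [← Real.exp_nat_mul, mul_neg_one]
      _ ≤ Real.exp (-(3 * Real.log (S * N))) := Real.exp_le_exp.2 (neg_le_neg hm)
      _ = ((S * N) ^ 3)⁻¹ := by
        rw [Real.exp_neg, ← Real.exp_log (pow_pos h0 3), Real.log_pow]
        norm_num
  calc C * x ^ m ≤ 2 * (S * N) ^ 2 * ((S * N) ^ 3)⁻¹ := by gcongr
    _ = _ := by field_simp

end SampleSize

/-! ### Polynomially small failure probabilities -/

section MainBounds

variable {Ω : Type*} [MeasurableSpace Ω] {P : Measure Ω} [IsProbabilityMeasure P]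
  {s n n₁ n₂ r : ℕ} {μ₀ : ℝ} {b : Fin n → Ω → Fin s → ℂ}

theorem measureReal_not_tangent_le_inv (hb : SubspaceModel P μ₀ b) (hn : n₁ + n₂ = n + 1)
    (h₁ : 0 < n₁) (h₂ : 0 < n₂) (hs : 0 < s) (hμ₀ : 1 ≤ μ₀)
    {U : Matrix (Fin n₁ × Fin s) (Fin r) ℂ} {V : Matrix (Fin n₂) (Fin r) ℂ}
    (hU : Uᴴ * U = 1) (hV : Vᴴ * V = 1) {μ₁ μ : ℝ} (hμ₁ : 0 < μ₁) (hμ : μ₁ ≤ μ)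
    (hinc : Incoherent n μ₁ U V) (hL : 1 / 2 ≤ Real.log ((s : ℝ) * n))
    (hsize : 50000 * (μ₀ * s * (μ * r)) * Real.log ((s : ℝ) * n) ≤ n) :
    P.real {ω | ¬ ∀ A C, |∑ i, ‖sense (fun i => b i ω) (opGAdj n (A * Vᴴ + U * C)) i‖ ^ 2 -
      frobNorm (opGAdj n (A * Vᴴ + U * C)) ^ 2| ≤ 1 / 10 * (frobNorm A ^ 2 + frobNorm C ^ 2)} ≤
      2 * ((s : ℝ) * n)⁻¹ := by
  set L := Real.log ((s : ℝ) * n) with hLdef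
  have hn0 : (0 : ℝ) < n := by
    have : 0 < n := by omega
    exact_mod_cast this
  have hs1 : (1 : ℝ) ≤ s := by exact_mod_cast hs
  have hrn : r ≤ n₂ := le_card_of_orthonormal hV
  -- Rounding up costs at most `1 ≤ 2 L`, so `m ≤ 5 L`.
  set m := ⌈3 * L⌉₊ with hm
  have hm1 : 3 * L ≤ m := Nat.le_ceil _
  have hm2 : (m : ℝ) ≤ 5 * L := by
    have := (Nat.ceil_lt_add_one (a := 3 * L) (by linarith)).le
    linarith
  have hm0 : 0 < m := Nat.ceil_pos.2 (by linarith)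
  have hc : (0 : ℝ) ≤ μ₁ * r / n := by positivity
  -- `1800 = 18 / δ²` with `δ = 1/10`, and `36/100` is just below `e⁻¹`.
  have hρ : 1800 * m * (2 * (μ₀ * s * (μ₁ * r / n))) ≤ 36 / 100 := by
    calc 1800 * m * (2 * (μ₀ * s * (μ₁ * r / n)))
        ≤ 1800 * (5 * L) * (2 * (μ₀ * s * (μ * r / n))) := by gcongr
      _ = (36 / 100 * (50000 * (μ₀ * s * (μ * r)) * L)) / n := by ring
      _ ≤ (36 / 100 * n) / n := by gcongr
      _ = 36 / 100 := by field_simp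
  have h := measureReal_not_tangent_le hb hn h₁ h₂ (by linarith) hU hV hc hinc.1 hinc.2
    (δ := 1 / 10) (by norm_num) hm0 (by
      have : (0 : ℝ) ≤ m * (2 * (μ₀ * s * (μ₁ * r / n))) := by positivity
      linarith)
  refine h.trans (card_mul_pow_ceil_le ?_ ?_ (by positivity) ?_ hm1)
  · have : (1 : ℝ) ≤ n := by
      have : 1 ≤ n := by omega
      exact_mod_cast this
    nlinarith
  · have : n₁ * s * r + r * n₂ ≤ 2 * (s * n) ^ 2 := by
      have e1 : n₁ ≤ n := by omega
      have e2 : n₂ ≤ n := by omega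
      have e3 : n₁ * s * r ≤ n * s * n := Nat.mul_le_mul (Nat.mul_le_mul_right _ e1) (hrn.trans e2)
      have e4 : r * n₂ ≤ n * n := Nat.mul_le_mul (hrn.trans e2) e2
      nlinarith [Nat.mul_le_mul_left (n * n) hs, Nat.mul_le_mul_left (n * n * s) hs]
    exact_mod_cast this
  · refine le_trans (le_of_eq ?_) (hρ.trans ?_)
    · ring
    · rw [Real.exp_neg, le_inv_comm₀ (by norm_num) (Real.exp_pos _)]
      have := Real.exp_one_lt_d9
      norm_num at this ⊢
      linarith

theorem measureReal_not_fourier_le_inv (hb : SubspaceModel P μ₀ b) [NeZero n]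
    (X : Matrix (Fin s) (Fin n) ℂ) {c T : ℝ} (hX : ∀ i, ∑ a, ‖X a i‖ ^ 2 ≤ c ^ 2) (hc : 0 ≤ c)
    (hs : 0 < s) (hT : 0 < T)
    (hV : 9 * Real.log ((s : ℝ) * n) * (μ₀ * frobNorm X ^ 2) ≤ T)
    (hB : 36 * Real.log ((s : ℝ) * n) ^ 2 * (μ₀ ^ 2 * s * c ^ 2) ≤ T) :
    P.real {ω | ¬ ∀ (f : ZMod n) (a : Fin s), ‖∑ i : Fin n, ZMod.stdAddChar (f * (i.val : ZMod n)) *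
      (senseAdj (fun i => b i ω) (sense (fun i => b i ω) X) - X) a i‖ ^ 2 ≤ 2 * T} ≤
      4 * ((s : ℝ) * n)⁻¹ := by
  set L := Real.log ((s : ℝ) * n) with hLdef
  have hn1 : (1 : ℝ) ≤ n := by exact_mod_cast NeZero.one_le
  have hs1 : (1 : ℝ) ≤ s := by exact_mod_cast hs
  have hsn : (1 : ℝ) ≤ s * n := by nlinarith
  have hL : 0 ≤ L := Real.log_nonneg hsn
  have ht : 0 < Real.sqrt T := Real.sqrt_pos.2 hT
  have ht2 : Real.sqrt T ^ 2 = T := Real.sq_sqrt hT.le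
  -- With this `lam`, the linear exponent is `-3 L` and the variance returns at most `L`. The
  -- remaining `(s n)^(-2)` leaves a factor `(s n)⁻¹` after the union bound.
  have h := measureReal_not_fourier_le hb X (t := Real.sqrt T) (lam := 3 * L / Real.sqrt T) hX hc
    (by positivity) (by
      rw [div_mul_eq_mul_div, div_le_one ht]
      refine Real.le_sqrt_of_sq_le (le_trans (le_of_eq ?_) hB)
      rw [mul_pow, mul_pow 2, mul_pow (μ₀ * _), mul_pow μ₀, Real.sq_sqrt (Nat.cast_nonneg _)]
      ring)
  rw [ht2] at h
  refine h.trans ?_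
  have e1 : -(3 * L / Real.sqrt T * Real.sqrt T) + (3 * L / Real.sqrt T) ^ 2 *
      (μ₀ * frobNorm X ^ 2) ≤ -(2 * L) := by
    rw [div_mul_cancel₀ _ ht.ne', div_pow, ht2]
    have : (3 * L) ^ 2 / T * (μ₀ * frobNorm X ^ 2) ≤ L := by
      rw [div_mul_eq_mul_div, div_le_iff₀ hT]
      calc (3 * L) ^ 2 * (μ₀ * frobNorm X ^ 2) = L * (9 * L * (μ₀ * frobNorm X ^ 2)) := by ring
        _ ≤ L * T := by gcongr
    linarith
  calc 4 * (s * n) * Real.exp (-(3 * L / Real.sqrt T * Real.sqrt T) +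
        (3 * L / Real.sqrt T) ^ 2 * (μ₀ * frobNorm X ^ 2))
      ≤ 4 * (s * n) * Real.exp (-(2 * L)) := by gcongr
    _ = 4 * (s * n) * (((s : ℝ) * n) ^ 2)⁻¹ := by
      rw [Real.exp_neg, hLdef, ← Real.exp_log (pow_pos (by linarith : (0 : ℝ) < s * n) 2),
        Real.log_pow]
      norm_num
    _ = _ := by
      field_simp

end MainBounds

end BlindSR

end

/-! ### The main theorem -/

theorem theorem1 :
    ∃ c₀ c₁ c₂ : ℝ, 0 < c₀ ∧ 0 < c₁ ∧ 0 < c₂ ∧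
      ∀ (s n n₁ n₂ r : ℕ) (hn : n₁ + n₂ = n + 1) (hr : 0 < r)
        -- the target matrix, and the compact singular value decomposition of its rank-r lift
        (X : Matrix (Fin s) (Fin n) ℂ)
        (U : Matrix (Fin n₁ × Fin s) (Fin r) ℂ) (d : Fin r → ℝ) (V : Matrix (Fin n₂) (Fin r) ℂ)
        (_ : IsSVD (hankel hn X) U d V) (_ : ∀ l, 0 < d l)
        (σ₁ σᵣ κ : ℝ) (_ : σ₁ = d ⟨0, hr⟩) (_ : σᵣ = d ⟨r - 1, Nat.sub_lt hr Nat.one_pos⟩)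
        (_ : κ = σ₁ / σᵣ)
        (μ₁ μ μ₀ ε η β : ℝ) (_ : 0 < μ₁) (_ : Incoherent n μ₁ U V) (_ : μ₁ ≤ μ)
        (_ : 0 < ε) (_ : ε ≤ 1 / 3)
        (_ : 0 ≤ η) (_ : η ≤ σᵣ / (9000 * (μ₀ * μ * s * r * σ₁) ^ 2)) (_ : β = σᵣ / 72)
        -- the random subspace
        (Ω : Type*) (_ : MeasurableSpace Ω) (P : Measure Ω) (_ : IsProbabilityMeasure P)
        (b : Fin n → Ω → Fin s → ℂ) (_ : SubspaceModel P μ₀ b)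
        (_ : c₀ * (ε ^ 2)⁻¹ * μ₀ ^ 2 * μ * s ^ 2 * r ^ 2 * κ ^ 2 *
          Real.log ((s : ℝ) * n) ^ 2 ≤ n),
        ∃ E : Set Ω, MeasurableSet E ∧ 1 - c₁ * ((s : ℝ) * n) ^ (-c₂) ≤ P.real E ∧
          ∀ ω ∈ E, ∀ M : ℕ → Factors s n₁ n₂ r,
            IsPGDRun hn hr (fun i => b i ω) (sense (fun i => b i ω) X) μ ε η M →
            ∀ t : ℕ, rotDist (M t) (balanced U d V) ^ 2 ≤
              (1 - η * β) ^ t * (ε ^ 2 * σᵣ / (μ₀ * s)) := by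
  -- `6 = 2 + 4` adds the failure probabilities of the near-isometry and of the Fourier bounds.
  refine ⟨100000, 6, 1, by norm_num, by norm_num, one_pos, ?_⟩
  intro s n n₁ n₂ r hn hr X U d V hX hdpos σ₁ σᵣ κ hσ₁ hσᵣ hκ μ₁ μ μ₀ ε η β hμ₁ hinc hμ hε hε3 hη0 hη
    hβ Ω _ P _ b hb hsize
  -- dimensions and elementary bounds
  have hrn₂ : r ≤ n₂ := le_card_of_orthonormal hX.right_orthonormal
  have h₂ : 0 < n₂ := hr.trans_le hrn₂
  -- With no rows, `Uᴴ U` would vanish, contradicting orthonormality since `r > 0`.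
  obtain ⟨h₁, hs⟩ : 0 < n₁ ∧ 0 < s := by
    by_contra hne
    have : IsEmpty (Fin n₁ × Fin s) := by
      rw [isEmpty_prod]
      rcases Nat.eq_zero_or_pos n₁ with h | h
      · subst h; exact Or.inl inferInstance
      · have : s = 0 := by omega
        subst this; exact Or.inr inferInstance
    have h := congrFun (congrFun hX.left_orthonormal ⟨0, hr⟩) ⟨0, hr⟩
    rw [Matrix.mul_apply, Matrix.one_apply_eq] at h
    simp at h
  have hn0 : 0 < n := by omega
  have : NeZero n := ⟨hn0.ne'⟩
  have hnR : (0 : ℝ) < n := by exact_mod_cast hn0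
  have hs1 : (1 : ℝ) ≤ s := by exact_mod_cast hs
  have hr1 : (1 : ℝ) ≤ r := by exact_mod_cast hr
  have hn1 : (1 : ℝ) ≤ n := by exact_mod_cast hn0
  have hμ₀ : 1 ≤ μ₀ := hb.one_le hs hn0
  have hμ1 : 1 ≤ μ := (one_le_incoherence hinc hX.right_orthonormal hr hμ₁ (by omega)).trans hμ
  have hσᵣ0 : 0 < σᵣ := by rw [hσᵣ]; exact hdpos _
  have hdσ₁ : ∀ l, d l ≤ σ₁ := fun l => by
    rw [hσ₁]; exact hX.antitone (Fin.mk_le_of_le_val (Nat.zero_le _))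
  have hσᵣd : ∀ l, σᵣ ≤ d l := fun l => by
    rw [hσᵣ]
    refine hX.antitone ?_
    rw [Fin.le_def]
    have := l.isLt
    simp only
    omega
  have hσᵣ₁ : σᵣ ≤ σ₁ := (hσᵣd ⟨0, hr⟩).trans (hdσ₁ _)
  have hσ₁0 : 0 < σ₁ := hσᵣ0.trans_le hσᵣ₁
  have hκ1 : 1 ≤ κ := by rw [hκ, one_le_div hσᵣ0]; exact hσᵣ₁
  have hσκ : σ₁ = κ * σᵣ := by rw [hκ]; field_simp
  rw [Real.rpow_neg_one]
  -- Here the logarithm vanishes and the sample condition says nothing, but the claimed probability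
  -- is negative and the empty event suffices.
  by_cases hsn : s * n ≤ 1
  · have h1 : (s : ℝ) * n = 1 := by
      have : s * n = 1 := le_antisymm hsn (Nat.mul_pos hs hn0)
      exact_mod_cast this
    refine ⟨∅, MeasurableSet.empty, ?_, fun ω hω => absurd hω (Set.notMem_empty ω)⟩
    rw [h1]
    simp
  have hsn2 : (2 : ℝ) ≤ s * n := by
    have : 2 ≤ s * n := by omega
    exact_mod_cast this
  set L := Real.log ((s : ℝ) * n) with hL
  have hL2 : 1 / 2 ≤ L := by
    have h1 := Real.log_two_gt_d9
    have h2 := Real.log_le_log two_pos hsn2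
    rw [← hL] at h2
    norm_num at h1
    linarith
  obtain ⟨hI1, hI2, hI3⟩ := sampleSize_consequences hnR hs1 hr1 hL2 hμ₀ hμ1 hκ1 hε hε3 hsize
  set B := μ₀ * s with hBdef
  have hB1 : 1 ≤ B := one_le_mul_of_one_le_of_one_le hμ₀ hs1
  -- Chosen so that the lifted error `c² = 2 s T` meets `8 r c² = (2/5) ε² σᵣ² / (μ₀ s)` with
  -- equality, as the initialization needs.
  set T := ε ^ 2 * σᵣ ^ 2 / (40 * (μ₀ * s ^ 2 * r)) with hT
  have hT0 : 0 < T := by positivity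
  -- the exceptional events
  set bad₁ : Set Ω := {ω | ¬ ∀ i, ∑ a, ‖b i ω a‖ ^ 2 ≤ B} with hbad₁
  set bad₂ : Set Ω := {ω | ¬ ∀ A C, |∑ i, ‖sense (fun i => b i ω) (opGAdj n (A * Vᴴ + U * C)) i‖ ^ 2 -
      frobNorm (opGAdj n (A * Vᴴ + U * C)) ^ 2| ≤ 1 / 10 * (frobNorm A ^ 2 + frobNorm C ^ 2)}
    with hbad₂
  set bad₃ : Set Ω := {ω | ¬ ∀ (f : ZMod n) (a : Fin s),
      ‖∑ i : Fin n, ZMod.stdAddChar (f * (i.val : ZMod n)) *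
        (senseAdj (fun i => b i ω) (sense (fun i => b i ω) X) - X) a i‖ ^ 2 ≤ 2 * T} with hbad₃
  have hp₁ : P.real bad₁ = 0 := by
    have : ∀ᵐ ω ∂P, ∀ i, ∑ a, ‖b i ω a‖ ^ 2 ≤ B := ae_all_iff.2 fun i => hb.sum_norm_sq_le i
    rw [Measure.real, hbad₁, ae_iff.1 this, ENNReal.toReal_zero]
  have hp₂ : P.real bad₂ ≤ 2 * ((s : ℝ) * n)⁻¹ :=
    measureReal_not_tangent_le_inv hb hn h₁ h₂ hs hμ₀ hX.left_orthonormal hX.right_orthonormal hμ₁ hμ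
      hinc hL2 hI1
  have hp₃ : P.real bad₃ ≤ 4 * ((s : ℝ) * n)⁻¹ := by
    refine measureReal_not_fourier_le_inv hb X (c := σ₁ * (μ₁ * r / n))
      (sum_norm_column_sq_le_of_incoherent hn h₁ h₂ hX hdσ₁ hinc.1 hinc.2) (by positivity)
      hs hT0 ?_ ?_
    · have h := frobNorm_sq_le_of_incoherent hn h₁ h₂ hX hdσ₁ hinc.1 hinc.2
      rw [hT, le_div_iff₀ (by positivity)]
      calc 9 * L * (μ₀ * frobNorm X ^ 2) * (40 * (μ₀ * s ^ 2 * r))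
          ≤ 9 * L * (μ₀ * (2 * σ₁ ^ 2 * (μ * r / n))) * (40 * (μ₀ * s ^ 2 * r)) := by
            gcongr
            exact h.trans (by gcongr)
        _ = 720 * (μ₀ ^ 2 * μ * s ^ 2 * r ^ 2 * κ ^ 2) * L * σᵣ ^ 2 / n := by rw [hσκ]; ring
        _ ≤ 50000 * (μ₀ ^ 2 * μ * s ^ 2 * r ^ 2 * κ ^ 2) * L * σᵣ ^ 2 / n := by gcongr; norm_num
        _ ≤ ε ^ 2 * n * σᵣ ^ 2 / n := by gcongr
        _ = ε ^ 2 * σᵣ ^ 2 := by field_simp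
    · rw [hT, le_div_iff₀ (by positivity)]
      calc 36 * L ^ 2 * (μ₀ ^ 2 * s * (σ₁ * (μ₁ * r / n)) ^ 2) * (40 * (μ₀ * s ^ 2 * r))
          ≤ 36 * L ^ 2 * (μ₀ ^ 2 * s * (σ₁ * (μ * r / n)) ^ 2) * (40 * (μ₀ * s ^ 2 * r)) := by
            gcongr
        _ = 1440 * (μ₀ ^ 3 * μ ^ 2 * s ^ 3 * r ^ 3 * κ ^ 2) * L ^ 2 * σᵣ ^ 2 / n ^ 2 := by
            rw [hσκ]; ring
        _ ≤ ε ^ 2 * n ^ 2 * σᵣ ^ 2 / n ^ 2 := by gcongr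
        _ = ε ^ 2 * σᵣ ^ 2 := by field_simp
  -- The exceptional sets need not be measurable; a measurable hull has the same measure.
  refine ⟨(toMeasurable P (bad₁ ∪ bad₂ ∪ bad₃))ᶜ, (measurableSet_toMeasurable _ _).compl, ?_, ?_⟩
  · rw [probReal_compl_eq_one_sub (measurableSet_toMeasurable _ _), Measure.real,
      measure_toMeasurable, ← Measure.real]
    have e1 := measureReal_union_le (μ := P) (bad₁ ∪ bad₂) bad₃
    have e2 := measureReal_union_le (μ := P) bad₁ bad₂
    linarith
  · intro ω hω M hM t
    have hω' : ω ∉ bad₁ ∪ bad₂ ∪ bad₃ := fun h => hω (subset_toMeasurable _ _ h)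
    simp only [Set.mem_union, not_or] at hω'
    obtain ⟨⟨hω₁, hω₂⟩, hω₃⟩ := hω'
    have hg₁ : ∀ i, ∑ a, ‖b i ω a‖ ^ 2 ≤ B := not_not.1 hω₁
    have hg₂ := not_not.1 hω₂
    have hg₃ := not_not.1 hω₃
    rw [hβ]
    refine rotDist_sq_le_of_isPGDRun (c := Real.sqrt (s * (2 * T))) h₁ h₂ hX hinc hμ hσᵣ0 hσᵣd hdσ₁ hr
      hB1 hg₁ hg₂ hε hε3 (Real.sqrt_nonneg _) ?_ ?_ hη0 ?_ hM t
    · rw [Real.sq_sqrt (by positivity)]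
      refine le_of_eq ?_
      rw [hT, hBdef]
      field_simp
      norm_num
    · intro Y
      rw [← hankel_sub]
      refine (abs_le_of_sq_le_sq' ?_ (by have := frobNorm_nonneg Y; positivity)).2
      rw [mul_pow, Real.sq_sqrt (by positivity)]
      exact frobNorm_hankel_mul_le hn h₁ h₂ _ hg₃ Y
    · rw [le_div_iff₀ (by positivity)] at hη
      refine le_trans ?_ hη
      -- Since `μ ≥ 1`, the prescribed step size is at most the one required by the contraction.
      have : B * (r * σ₁) ≤ μ₀ * μ * s * r * σ₁ := by
        calc B * (r * σ₁) = μ₀ * 1 * s * r * σ₁ := by rw [hBdef]; ring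
          _ ≤ μ₀ * μ * s * r * σ₁ := by gcongr
      gcongr
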